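/- \textbf{Problem.} Let $(V,d)$ be a finite metric space with $n$ points, each of which has one of $m$ colors, so that $V = V_1 \cup \dots \cup V_m$ is a disjoint union of color classes, and let $k$ and $\ell_i, u_i$ ($1 \le i \le m$) be non-negative integers. A set $S \subseteq V$ is \emph{fair} if $|S| = k$ and $\ell_i \le |S \cap V_i| \le u_i$ for all $i$. Its diversity is $\mathrm{div}(S) = \min_{u \ne v \in S} d(u,v)$ (which is $+\infty$ if $|S| \le 1$). Fair max-min diversification (FMMD) asks for a fair set of maximum diversity; let $\mathrm{OPT}$ be this maximum. Let $\rho$ be the ratio of the largest and the smallest non-zero distance in $V$ (if $n \le 1$, put $\log \rho = 0$ and let the grid search below use the single guess $\tau = 1$). \textbf{Algorithm.} Put $\alpha = \sqrt{\log m}/m$. For a threshold $\gamma > 0$, a budget $b$ and a repetition number $T$, the \emph{main algorithm} first prunes: in each color class it repeatedly selects an unmarked point and marks all points of the class at distance less than $\gamma$ from it, until no unmarked point is left or $b$ points are selected. Let $U$ be the set of all selected points. At most $Tm$ times, or until the result $S$ is fair, it then does the following. (i) \emph{Decomposition.} Let $G$ be the graph on $U$ in which $u,v$ are adjacent if $d(u,v)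 < \gamma\alpha$. Draw a uniformly random permutation $\pi$ of $U$ and a uniformly random integer $R$ with $\max(\lfloor 1/(4\alpha)\rfloor, 1) \le R \le \lfloor 1/(2\alpha) \rfloor$ (for $m = 1$, where $\alpha = 0$, take $R = 1$). Let $C_j$ be the set of points at graph distance at most $R$ from $\pi(j)$ that lie in no $C_i$ with $i<j$, and let $D_j$ be the set of points of $C_j$ at graph distance less than $R$ from $\pi(j)$. (ii) \emph{Assignment.} Solve the integral maximum flow problem in the network with edges from the source $s$ to each $D_j$ (capacity $1$), from $D_j$ to color $i$ if $D_j$ has a point of color $i$ (capacity $1$), from color $i$ to the sink $t$ (capacity $\ell_i$) and to a node $z$ (capacity $u_i - \ell_i$), and from $z$ to $t$ (capacity $k - \sum_i \ell_i$). Let $S$ consist of one point of color $i$ from each $D_j$ that sends flow to color $i$. \textbf{Theorem.} Let $k \le m$. There are an absolute constant $c > 0$ and an absolute polynomial $p$ such that the following holds for all inputs and all $T \in \mathbb{N}$, where distances are available in unit time and arithmetic on real numbers has unit cost. (a) Let $\tau > 0$. The main algorithm with $\gamma = \tau/3$ and $b = n$ always makes at most $p(n,m)\,(T+1)$ steps.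 If some fair set has diversity at least $\tau$, then with probability at least $1 - 2^{-cT}$ the algorithm returns a fair set $S$ with $$\mathrm{div}(S) \ge \frac{\sqrt{\log m}}{3m}\,\tau .$$ (b) Let $\varepsilon > 0$. Consider the grid search that runs the main algorithm with $\gamma = \tau/3$ and $b = n$ for the guesses $\tau = \tau_0 (1+\varepsilon)^i$ from the smallest non-zero distance $\tau_0$ up to the largest distance, and keeps the fair result that belongs to the largest successful guess. It always makes at most $p(n,m)\,(T+1)\,\bigl(1 + (1+\varepsilon^{-1})\log\rho\bigr)$ steps. If a fair set exists, then with probability at least $1 - 2^{-cT}$ the grid search returns a fair set $S$ with $$\mathrm{div}(S) \ge \frac{\sqrt{\log m}}{3m\,(1+\varepsilon)}\,\mathrm{OPT} .$$ -/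

import Mathlib

open scoped ENNReal

noncomputable section

namespace FairDiversity

/-! # The problem -/

/-- The data of a fair max-min diversification problem on a space `V` of points with `m` colors.
The color classes `color ⁻¹' {i}` are the blocks of the partition of `V`. -/
structure Problem (V : Type) (m : ℕ) where
  color : V → Fin m
  lower : Fin m → ℕ
  upper : Fin m → ℕ
  k : ℕ

/-- `S` satisfies the constraints. -/
def Problem.IsFair {V : Type} {m : ℕ} (I : Problem V m) (S : Finset V) : Prop :=
  S.card = I.k ∧ ∀ i : Fin m,
    I.lower i ≤ (S.filter fun v => I.color v = i).card ∧
      (S.filter fun v => I.color v = i).card ≤ I.upper i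

/-- The diversity score, the smallest distance of two distinct points of `S`
(`⊤` if `S` has at most one point). -/
def diversity {V : Type} [MetricSpace V] (S : Finset V) : ℝ≥0∞ := (S : Set V).einfsep

/-- The optimum of the problem. -/
def Problem.opt {V : Type} [MetricSpace V] {m : ℕ} (I : Problem V m) : ℝ≥0∞ :=
  ⨆ S : Finset V, ⨆ _ : I.IsFair S, diversity S

/-- The ratio of the largest and the smallest non-zero distance of a finite metric space. -/
def spread (V : Type) [MetricSpace V] : ℝ :=
  Metric.diam (Set.univ : Set V) / Set.infsep (Set.univ : Set V)

/-! # Programs with a step count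

Programs are first-order recursive functions. A step is charged for every call of a recursive
function and for every elementary operation on the input: a distance query, a look-up of a color
or of a bound, a comparison, a read or write of a matrix entry, a random draw. Apart from such
calls and operations, the body of a function does only a bounded number of arithmetic operations
(real numbers are exact), list constructions and case distinctions. Nothing that takes an unbounded
amount of work is left without charge. -/

/-- A result together with the number of steps spent on it. -/
structure Timed (α : Type) where
  val : α
  steps : ℕ

instance : Monad Timed where
  pure a := ⟨a, 0⟩
  bind x f := ⟨(f x.val).val, x.steps + (f x.val).steps⟩

/-- Charge `c` steps. -/
def charge (c : ℕ) : Timed Unit := ⟨(), c⟩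

/-- Charge one step. -/
def tick : Timed Unit := charge 1

/-- Randomized programs: the joint law of the result and of the number of steps. -/
def Rand (α : Type) : Type := PMF (Timed α)

/-- The law of the result and the number of steps of a randomized program. -/
def Rand.law {α : Type} (x : Rand α) : PMF (Timed α) := x

instance : Monad Rand where
  pure a := PMF.pure ⟨a, 0⟩
  bind x f := PMF.bind x fun a =>
    PMF.map (fun b => ⟨b.val, a.steps + b.steps⟩) (Rand.law (f a.val))

instance : MonadLift Timed Rand where
  monadLift x := PMF.pure x

/-- The probability that the result of a randomized program satisfies `p`. -/
def Rand.prob {α : Type} (x : Rand α) (p : α → Prop) : ℝ≥0∞ :=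
  x.law.toOuterMeasure {a | p a.val}

/-- The program never makes more than `B` steps, whatever the random draws are. -/
def Rand.StepsLE {α : Type} (x : Rand α) (B : ℝ) : Prop :=
  ∀ a ∈ x.law.support, (a.steps : ℝ) ≤ B

/-- A uniformly random permutation `π(1), π(2), …` of the entries of `U`, in `|U| + 1` steps. -/
def randomPerm {V : Type} (U : List V) : Rand (List V) :=
  PMF.map (fun σ : Equiv.Perm (Fin U.length) =>
      (⟨List.ofFn fun i => U.get (σ i), U.length + 1⟩ : Timed (List V)))
    (PMF.uniformOfFintype (Equiv.Perm (Fin U.length)))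

/-- A uniformly random element of `{a, a + 1, …, b}` (the value `a` if `b < a`), in one step. -/
def randomBetween (a b : ℕ) : Rand ℕ :=
  PMF.map (fun i : Fin (b - a + 1) => (⟨a + i, 1⟩ : Timed ℕ))
    (PMF.uniformOfFintype (Fin (b - a + 1)))

/-! ## List programs -/

def lengthT {α : Type} : List α → Timed ℕ
  | [] => do
      tick
      return 0
  | _ :: l => do
      tick
      let c ← lengthT l
      return c + 1

def appendT {α : Type} : List α → List α → Timed (List α)
  | [], l' => do
      tick
      return l'
  | a :: l, l' => do
      tick
      let r ← appendT l l'
      return a :: r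

def mapT {α β : Type} (f : α → Timed β) : List α → Timed (List β)
  | [] => do
      tick
      return []
  | a :: l => do
      tick
      let b ← f a
      let r ← mapT f l
      return b :: r

def filterT {α : Type} (p : α → Timed Bool) : List α → Timed (List α)
  | [] => do
      tick
      return []
  | a :: l => do
      tick
      let b ← p a
      let r ← filterT p l
      if b then return a :: r else return r

def anyT {α : Type} (p : α → Timed Bool) : List α → Timed Bool
  | [] => do
      tick
      return false
  | a :: l => do
      tick
      let b ← p a
      if b then return true else anyT p l

def allT {α : Type} (p : α → Timed Bool) : List α → Timed Bool
  | [] => do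
      tick
      return true
  | a :: l => do
      tick
      let b ← p a
      if b then allT p l else return false

def notT (x : Timed Bool) : Timed Bool := do
  let b ← x
  return !b

def minT : ℝ → List ℝ → Timed ℝ
  | x, [] => do
      tick
      return x
  | x, y :: l => do
      tick
      minT (min x y) l

def maxT : ℝ → List ℝ → Timed ℝ
  | x, [] => do
      tick
      return x
  | x, y :: l => do
      tick
      maxT (max x y) l

section Algorithm

variable {V : Type} [MetricSpace V] [DecidableEq V] {m : ℕ}

/-- Is `d(u, v) < γ`? -/
def distLT (γ : ℝ) (u v : V) : Timed Bool := do
  tick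
  return decide (dist u v < γ)

/-- Is `u = v`? -/
def eqT (u v : V) : Timed Bool := do
  tick
  return decide (u = v)

/-- Does `v` have color `i`? -/
def Problem.hasColor (I : Problem V m) (i : Fin m) (v : V) : Timed Bool := do
  tick
  return decide (I.color v = i)

/-- Does the list `S` of distinct points satisfy the constraints? -/
def Problem.checkFair (I : Problem V m) (S : List V) : Timed Bool := do
  let c ← lengthT S
  if c = I.k then
    allT (fun i => do
      tick
      let Si ← filterT (I.hasColor i) S
      let ci ← lengthT Si
      return decide (I.lower i ≤ ci ∧ ci ≤ I.upper i)) (List.finRange m)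
  else return false

/-! ## Pruning -/

/-- Treats one color with budget `b`: the list holds the unmarked points. Select the first
of them, mark all points at distance less than `γ` from it (itself included), and go on until the
budget is spent or no unmarked point is left. -/
def pruneColor (γ : ℝ) : ℕ → List V → Timed (List V)
  | 0, _ => do
      tick
      return []
  | _ + 1, [] => do
      tick
      return []
  | b + 1, v :: l => do
      tick
      let l' ← filterT (fun u => notT (distLT γ u v)) l
      let r ← pruneColor γ b l'
      return v :: r

def Problem.pruneColors (I : Problem V m) (γ : ℝ) (b : ℕ) (pts : List V) :
    List (Fin m) → Timed (List V)
  | [] => do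
      tick
      return []
  | i :: is => do
      tick
      let Vi ← filterT (I.hasColor i) pts
      let Ui ← pruneColor γ b Vi
      let r ← I.pruneColors γ b pts is
      appendT Ui r

/-- The pruned space `U = U₁ ∪ ⋯ ∪ Uₘ`. -/
def Problem.prune (I : Problem V m) (γ : ℝ) (b : ℕ) (pts : List V) : Timed (List V) :=
  I.pruneColors γ b pts (List.finRange m)

/-! ## Random decomposition -/

/-- Breadth-first search in the graph whose edges are the pairs at distance less than `θ`:
`front` holds the points at graph distance `t` from the center and `unseen` those at a larger
distance. Lists the points at distance `t, …, t + r`, each with its distance. -/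
def bfs (θ : ℝ) : (r t : ℕ) → (front unseen : List V) → Timed (List (V × ℕ))
  | 0, t, front, _ => do
      tick
      mapT (fun v => do tick; return (v, t)) front
  | r + 1, t, front, unseen => do
      tick
      let next ← filterT (fun u => anyT (distLT θ u) front) unseen
      let rest ← filterT (fun u => notT (anyT (distLT θ u) front)) unseen
      let here ← mapT (fun v => do tick; return (v, t)) front
      let far ← bfs θ r (t + 1) next rest
      appendT here far

/-- The ball `B_G(c, R)` in the graph on `U`, each point `u` with its graph distance from `c`. -/
def ball (θ : ℝ) (R : ℕ) (U : List V) (c : V) : Timed (List (V × ℕ)) := do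
  let others ← filterT (fun u => notT (eqT u c)) U
  bfs θ R 0 [c] others

/-- Goes through the centers `π(j), π(j+1), …`, where `Z` holds the points that are already
clustered: `C_j = B_G(π(j), R) \ Z`, and `D_j` is the set of the points of `C_j` at graph distance
less than `R` from `π(j)`. -/
def carve (θ : ℝ) (R : ℕ) (U : List V) : (centers Z : List V) → Timed (List (List V))
  | [], _ => do
      tick
      return []
  | c :: cs, Z => do
      tick
      let B ← ball θ R U c
      let C ← filterT (fun q => notT (anyT (eqT q.1) Z)) B
      let Cpts ← mapT (fun q => do tick; return q.1) C
      let Z' ← appendT Cpts Z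
      let inner ← filterT (fun q => do tick; return decide (q.2 < R)) C
      let D ← mapT (fun q => do tick; return q.1) inner
      let Ds ← carve θ R U cs Z'
      return D :: Ds

/-- The padded decomposition `D₁, D₂, …` of `U`, with `α = √(log m) / m`. The floors are of
numbers at most `m`, and `m + 1` steps are charged for each. For `m = 1` one has `α = 0`, the
graph has no edges, every radius gives the same decomposition, and the radius here is `1`. -/
def decompose (m : ℕ) (U : List V) (γ : ℝ) : Rand (List (List V)) := do
  let α : ℝ := √(Real.log m) / m
  let Δ₁ : ℕ := max ⌊1 / (4 * α)⌋₊ 1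
  let Δ₂ : ℕ := ⌊1 / (2 * α)⌋₊
  charge (2 * (m + 1))
  let π ← randomPerm U
  let R ← randomBetween Δ₁ Δ₂
  carve (γ * α) R U π []

/-! ## Assigning colors to clusters by a maximum flow -/

/-- The nodes of the flow network. -/
inductive Node (m : ℕ) where
  | source : Node m
  | cluster : ℕ → Node m
  | color : Fin m → Node m
  | slack : Node m
  | sink : Node m
  deriving DecidableEq

/-- A matrix of (residual) capacities. -/
abbrev Capacity (m : ℕ) : Type := Node m → Node m → ℕ

/-- Write a matrix entry. -/
def setCap (r : Capacity m) (a b : Node m) (x : ℕ) : Timed (Capacity m) := do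
  tick
  return fun a' b' => if a' = a ∧ b' = b then x else r a' b'

/-- An edge of unit capacity from cluster `i` to the color of each of its points. -/
def Problem.addMembers (I : Problem V m) (i : ℕ) : List V → Capacity m → Timed (Capacity m)
  | [], r => do
      tick
      return r
  | u :: D, r => do
      tick
      let r' ← setCap r (.cluster i) (.color (I.color u)) 1
      I.addMembers i D r'

/-- The edges that leave the source and the clusters, which are numbered from `i` on. -/
def Problem.addClusters (I : Problem V m) :
    ℕ → List (List V) → Capacity m → Timed (Capacity m)
  | _, [], r => do
      tick
      return r
  | i, D :: Ds, r => do
      tick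
      let r₁ ← setCap r .source (.cluster i) 1
      let r₂ ← I.addMembers i D r₁
      I.addClusters (i + 1) Ds r₂

/-- The edges that leave the colors. -/
def Problem.addColors (I : Problem V m) : List (Fin m) → Capacity m → Timed (Capacity m)
  | [], r => do
      tick
      return r
  | j :: js, r => do
      tick
      let r₁ ← setCap r (.color j) .sink (I.lower j)
      let r₂ ← setCap r₁ (.color j) .slack (I.upper j - I.lower j)
      I.addColors js r₂

def Problem.sumLower (I : Problem V m) : List (Fin m) → Timed ℕ
  | [] => do
      tick
      return 0
  | j :: js => do
      tick
      let s ← I.sumLower js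
      return I.lower j + s

/-- The flow network. The differences are non-negative whenever the constraints can be met. -/
def Problem.network (I : Problem V m) (Ds : List (List V)) : Timed (Capacity m) := do
  let r₁ ← I.addClusters 0 Ds fun _ _ => 0
  let r₂ ← I.addColors (List.finRange m) r₁
  let s ← I.sumLower (List.finRange m)
  setCap r₂ .slack .sink (I.k - s)

def clusterNodes (m : ℕ) : ℕ → List (List V) → Timed (List (Node m))
  | _, [] => do
      tick
      return []
  | i, _ :: Ds => do
      tick
      let r ← clusterNodes m (i + 1) Ds
      return .cluster i :: r

/-- All nodes other than the source. -/
def innerNodes (m : ℕ) (Ds : List (List V)) : Timed (List (Node m)) := do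
  let cl ← clusterNodes m 0 Ds
  let co ← mapT (fun j => do tick; return Node.color j) (List.finRange m)
  let r ← appendT co [.slack, .sink]
  appendT cl r

/-- Extends the first path (listed backwards) whose last node has a residual edge to `w`. -/
def extendTo (r : Capacity m) (w : Node m) :
    List (List (Node m)) → Timed (Option (List (Node m)))
  | [] => do
      tick
      return none
  | [] :: ps => do
      tick
      extendTo r w ps
  | (a :: p) :: ps => do
      tick
      if 0 < r a w then return some (w :: a :: p) else extendTo r w ps

/-- One layer of a breadth-first search in the residual graph: the paths to the nodes of `unseen`
that prolong one of `paths` by an edge, and the nodes without such a path. -/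
def nextLayer (r : Capacity m) (paths : List (List (Node m))) :
    List (Node m) → Timed (List (List (Node m)) × List (Node m))
  | [] => do
      tick
      return ([], [])
  | w :: ws => do
      tick
      let o ← extendTo r w paths
      let q ← nextLayer r paths ws
      match o with
      | some p => return (p :: q.1, q.2)
      | none => return (q.1, w :: q.2)

/-- The first path that ends in the sink. -/
def findSink : List (List (Node m)) → Timed (Option (List (Node m)))
  | [] => do
      tick
      return none
  | p :: ps => do
      tick
      if p.head? = some .sink then return some p else findSink ps

/-- Searches an augmenting path by a breadth-first search with at most the given number of
layers. -/
def findPath (r : Capacity m) :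
    ℕ → List (List (Node m)) → List (Node m) → Timed (Option (List (Node m)))
  | 0, _, _ => do
      tick
      return none
  | f + 1, paths, unseen => do
      tick
      let q ← nextLayer r paths unseen
      let o ← findSink q.1
      match o with
      | some p => return some p
      | none => findPath r f q.1 q.2

/-- Pushes one unit of flow along a path (listed backwards). -/
def augment : List (Node m) → Capacity m → Timed (Capacity m)
  | [], r => do
      tick
      return r
  | [_], r => do
      tick
      return r
  | b :: a :: p, r => do
      tick
      let r₁ ← setCap r a b (r a b - 1)
      let r₂ ← setCap r₁ b a (r₁ b a + 1)
      augment (a :: p) r₂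

/-- Augmenting-path method for the maximum flow, with at most the given number of
augmentations. -/
def maxFlow (nodes : List (Node m)) (layers : ℕ) : ℕ → Capacity m → Timed (Capacity m)
  | 0, r => do
      tick
      return r
  | f + 1, r => do
      tick
      let o ← findPath r layers [[.source]] nodes
      match o with
      | none => return r
      | some p => do
          let r' ← augment p r
          maxFlow nodes layers f r'

/-- The first point of cluster `i` to whose color the cluster sends flow. -/
def Problem.pick (I : Problem V m) (r : Capacity m) (i : ℕ) : List V → Timed (Option V)
  | [] => do
      tick
      return none
  | u :: D => do
      tick
      if 0 < r (.color (I.color u)) (.cluster i) then return some u else I.pick r i D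

/-- A point of color `j` from each cluster that sends flow to the color `j`. -/
def Problem.extract (I : Problem V m) (r : Capacity m) : ℕ → List (List V) → Timed (List V)
  | _, [] => do
      tick
      return []
  | i, D :: Ds => do
      tick
      let o ← I.pick r i D
      let S ← I.extract r (i + 1) Ds
      match o with
      | some u => return u :: S
      | none => return S

/-- Solves the integral maximum flow problem and extracts points from the clusters. The source has
one edge of unit capacity per cluster, so there are at most as many augmentations as clusters. -/
def Problem.flow (I : Problem V m) (Ds : List (List V)) : Timed (List V) := do
  let r ← I.network Ds
  let nodes ← innerNodes m Ds
  let layers ← lengthT nodes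
  let c ← lengthT Ds
  let r' ← maxFlow nodes layers c r
  I.extract r' 0 Ds

/-! ## The main algorithm and the grid search -/

/-- Decomposes and assigns, at most the given number of times or until the result satisfies the
constraints. -/
def Problem.repeatUntilFair (I : Problem V m) (U : List V) (γ : ℝ) :
    ℕ → List V → Rand (List V)
  | 0, S => do
      tick
      return S
  | t + 1, _ => do
      tick
      let Ds ← decompose m U γ
      let S ← I.flow Ds
      let ok ← I.checkFair S
      if ok then return S else I.repeatUntilFair U γ t S

/-- The main algorithm, on the space that consists of the points `pts`. -/
def Problem.mainAlgorithm (I : Problem V m) (pts : List V) (γ₁ γ₂ : ℝ) (b T : ℕ) :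
    Rand (List V) := do
  let U ← I.prune γ₁ b pts
  I.repeatUntilFair U γ₂ (T * m) []

/-- The distances of the pairs of points in the list. -/
def pairDists : List V → Timed (List ℝ)
  | [] => do
      tick
      return []
  | u :: l => do
      tick
      let row ← mapT (fun v => do tick; return dist u v) l
      let r ← pairDists l
      appendT row r

/-- The smallest and the largest entry (`1` and `1` for the empty list). -/
def extremes : List ℝ → Timed (ℝ × ℝ)
  | [] => do
      tick
      return (1, 1)
  | x :: l => do
      tick
      let a ← minT x l
      let b ← maxT x l
      return (a, b)

/-- Runs the main algorithm for the guesses `τ, τ (1 + ε), τ (1 + ε)², …` of the optimum, and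
keeps the result that satisfies the constraints and belongs to the largest guess. -/
def Problem.gridLoop (I : Problem V m) (pts : List V) (n T : ℕ) (ε : ℝ) :
    ℕ → ℝ → List V → Rand (List V)
  | 0, _, best => do
      tick
      return best
  | c + 1, τ, best => do
      tick
      let S ← I.mainAlgorithm pts (τ / 3) (τ / 3) n T
      let ok ← I.checkFair S
      I.gridLoop pts n T ε c (τ * (1 + ε)) (if ok then S else best)

/-- The main algorithm with a grid search for the optimum: the guesses are `τ₀ (1 + ε) ^ i` from
the smallest distance `τ₀` up to the largest distance. -/
def Problem.gridSearch (I : Problem V m) (pts : List V) (T : ℕ) (ε : ℝ) : Rand (List V) := do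
  let n ← lengthT pts
  let ds ← pairDists pts
  let e ← extremes ds
  let N : ℕ := ⌊Real.log (e.2 / e.1) / Real.log (1 + ε)⌋₊
  charge (N + 1)
  I.gridLoop pts n T ε (N + 1) e.1 []

end Algorithm

end FairDiversity

end

/-! Only fairness is left to chance. Each core `D_j` omits the boundary layer of its cluster, so
points of different cores are never adjacent and have distance at least θ = γα for every draw
(`carve_pairwise`). The flow step takes at most one point per core, so every returned set has the
required diversity. It remains to bound the probability that some round yields a fair set.

Let O be a fair set of diversity at least τ = 3γ. Moving each of its points to a selected point of
the same color at distance less than γ keeps O fair and leaves all distances above γ. An admissible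
radius satisfies 2Rα ≤ 1, so distinct points of one ball of radius R are closer than γ. Hence balls
around different points of O are disjoint, no cluster holds two points of O, and a ball has at most
one point of each color, thus at most m points.

A point v lies in a core if the point of B(v, R) that comes first in π lies in B(v, R-1). For
disjoint balls these events are independent, with probabilities |B(v, R-1)| / |B(v, R)|
(`card_forall_isFirst`). The average over R of the product of these ratios is at least their
geometric mean, which telescopes (`rpow_le_average`). A ball of radius r that is not a whole
component has more than r points, and at most m points of O are involved as k ≤ m. With the given α
this leaves a probability of at least exp(-128) / m per round (`exists_rpow_bound`,
`Problem.le_prob_decompose`). So Tm rounds all fail with probability at most (1 - c/m)^(Tm) ≤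
2^(-cT), where c = exp(-128).

If all points of O lie in cores, O itself gives a flow of value k. The augmenting paths then reach
the value k, which saturates the edges into the sink, and this is fairness
(`Problem.checkFair_flow`).

In the grid search, some guess is at most OPT and within a factor 1 + ε of it. Successes at larger
guesses only improve the result (`Problem.ensures_gridLoop`), and log(1+ε) ≥ ε/(1+ε) bounds the
number of guesses. -/

namespace FairDiversity

/-! ### Timed programs -/

section Timed

variable {α β : Type}

@[simp] theorem Timed.val_pure (a : α) : (pure a : Timed α).val = a := rfl
@[simp] theorem Timed.steps_pure (a : α) : (pure a : Timed α).steps = 0 := rfl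
@[simp] theorem Timed.val_bind (x : Timed α) (f : α → Timed β) :
    (x >>= f).val = (f x.val).val := rfl
@[simp] theorem Timed.steps_bind (x : Timed α) (f : α → Timed β) :
    (x >>= f).steps = x.steps + (f x.val).steps := rfl
@[simp] theorem tick_steps : tick.steps = 1 := rfl

@[simp] theorem lengthT_val (l : List α) : (lengthT l).val = l.length := by
  induction l <;> simp_all [lengthT]

@[simp] theorem lengthT_steps (l : List α) : (lengthT l).steps = l.length + 1 := by
  induction l <;> simp_all [lengthT]; omega

@[simp] theorem appendT_val (l l' : List α) : (appendT l l').val = l ++ l' := by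
  induction l <;> simp_all [appendT]

@[simp] theorem appendT_steps (l l' : List α) : (appendT l l').steps = l.length + 1 := by
  induction l <;> simp_all [appendT]; omega

@[simp] theorem mapT_val (f : α → Timed β) (l : List α) :
    (mapT f l).val = l.map fun a => (f a).val := by
  induction l <;> simp_all [mapT]

theorem mapT_steps_le (f : α → Timed β) (l : List α) (B : ℕ) (h : ∀ a ∈ l, (f a).steps ≤ B) :
    (mapT f l).steps ≤ l.length * (B + 1) + 1 := by
  induction l with
  | nil => simp [mapT]
  | cons a l ih =>
    have h1 := h a (by simp)
    have h2 := ih fun b hb => h b (by simp [hb])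
    simp only [mapT, Timed.steps_bind, tick_steps, Timed.steps_pure, List.length_cons]
    nlinarith

@[simp] theorem filterT_val (p : α → Timed Bool) (l : List α) :
    (filterT p l).val = l.filter fun a => (p a).val := by
  induction l with
  | nil => simp [filterT]
  | cons a l ih =>
    simp only [filterT, Timed.val_bind, List.filter_cons, ih]
    split <;> simp_all

theorem filterT_steps_le (p : α → Timed Bool) (l : List α) (B : ℕ)
    (h : ∀ a ∈ l, (p a).steps ≤ B) : (filterT p l).steps ≤ l.length * (B + 1) + 1 := by
  induction l with
  | nil => simp [filterT]
  | cons a l ih =>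
    have h1 := h a (by simp)
    have h2 := ih fun b hb => h b (by simp [hb])
    simp only [filterT, Timed.steps_bind, tick_steps, List.length_cons]
    split <;> simp only [Timed.steps_pure] <;> nlinarith

@[simp] theorem anyT_val (p : α → Timed Bool) (l : List α) :
    (anyT p l).val = l.any fun a => (p a).val := by
  induction l with
  | nil => simp [anyT]
  | cons a l ih =>
    simp only [anyT, Timed.val_bind, List.any_cons]
    split <;> simp_all

theorem anyT_steps_le (p : α → Timed Bool) (l : List α) (B : ℕ)
    (h : ∀ a ∈ l, (p a).steps ≤ B) : (anyT p l).steps ≤ l.length * (B + 1) + 1 := by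
  induction l with
  | nil => simp [anyT]
  | cons a l ih =>
    have h1 := h a (by simp)
    have h2 := ih fun b hb => h b (by simp [hb])
    simp only [anyT, Timed.steps_bind, tick_steps, List.length_cons]
    split
    · simp only [Timed.steps_pure]; nlinarith
    · nlinarith

@[simp] theorem allT_val (p : α → Timed Bool) (l : List α) :
    (allT p l).val = l.all fun a => (p a).val := by
  induction l with
  | nil => simp [allT]
  | cons a l ih =>
    simp only [allT, Timed.val_bind, List.all_cons]
    split <;> simp_all

theorem allT_steps_le (p : α → Timed Bool) (l : List α) (B : ℕ)
    (h : ∀ a ∈ l, (p a).steps ≤ B) : (allT p l).steps ≤ l.length * (B + 1) + 1 := by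
  induction l with
  | nil => simp [allT]
  | cons a l ih =>
    have h1 := h a (by simp)
    have h2 := ih fun b hb => h b (by simp [hb])
    simp only [allT, Timed.steps_bind, tick_steps, List.length_cons]
    split
    · nlinarith
    · simp only [Timed.steps_pure]; nlinarith

@[simp] theorem notT_val (x : Timed Bool) : (notT x).val = !x.val := rfl
@[simp] theorem notT_steps (x : Timed Bool) : (notT x).steps = x.steps := rfl

theorem minT_steps (x : ℝ) (l : List ℝ) : (minT x l).steps = l.length + 1 := by
  induction l generalizing x <;> simp_all [minT]; omega

theorem maxT_steps (x : ℝ) (l : List ℝ) : (maxT x l).steps = l.length + 1 := by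
  induction l generalizing x <;> simp_all [maxT]; omega

theorem minT_val_mem (x : ℝ) (l : List ℝ) : (minT x l).val ∈ x :: l := by
  induction l generalizing x with
  | nil => simp [minT]
  | cons y l ih =>
    have := ih (min x y)
    simp only [minT, Timed.val_bind, List.mem_cons] at this ⊢
    rcases this with h | h
    · rw [h]; rcases min_choice x y with h' | h' <;> rw [h'] <;> simp
    · simp [h]

theorem minT_val_le (x : ℝ) (l : List ℝ) : ∀ y ∈ x :: l, (minT x l).val ≤ y := by
  induction l generalizing x with
  | nil => simp [minT]
  | cons z l ih =>
    have := ih (min x z)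
    simp only [minT, Timed.val_bind, List.mem_cons, forall_eq_or_imp, le_min_iff] at this ⊢
    tauto

theorem maxT_val_mem (x : ℝ) (l : List ℝ) : (maxT x l).val ∈ x :: l := by
  induction l generalizing x with
  | nil => simp [maxT]
  | cons y l ih =>
    have := ih (max x y)
    simp only [maxT, Timed.val_bind, List.mem_cons] at this ⊢
    rcases this with h | h
    · rw [h]; rcases max_choice x y with h' | h' <;> rw [h'] <;> simp
    · simp [h]

theorem le_maxT_val (x : ℝ) (l : List ℝ) : ∀ y ∈ x :: l, y ≤ (maxT x l).val := by
  induction l generalizing x with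
  | nil => simp [maxT]
  | cons z l ih =>
    have := ih (max x z)
    simp only [maxT, Timed.val_bind, List.mem_cons, forall_eq_or_imp, max_le_iff] at this ⊢
    tauto

end Timed

/-! ### Randomized programs -/

section Rand

variable {α β : Type}

/-- Every outcome of `x` has a result in `P` and makes at most `B` steps. -/
def Rand.Ensures (x : Rand α) (P : α → Prop) (B : ℕ) : Prop :=
  ∀ a ∈ x.law.support, P a.val ∧ a.steps ≤ B

theorem Rand.mem_support_bind {x : Rand α} {f : α → Rand β} {b : Timed β} :
    b ∈ (x >>= f).law.support ↔
      ∃ a ∈ x.law.support, ∃ c ∈ (f a.val).law.support, b = ⟨c.val, a.steps + c.steps⟩ := by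
  -- The identity is proved for plain `PMF`s, to which the monad operations of `Rand` unfold
  -- definitionally.
  have key : ∀ (x : PMF (Timed α)) (g : Timed α → PMF (Timed β)),
      b ∈ (x.bind fun a => (g a).map
        fun c => (⟨c.val, a.steps + c.steps⟩ : Timed β)).support ↔
      ∃ a ∈ x.support, ∃ c ∈ (g a).support, b = ⟨c.val, a.steps + c.steps⟩ := by
    intro x g
    simp only [PMF.mem_support_bind_iff, PMF.mem_support_map_iff, eq_comm]
  exact key x fun a => f a.val

theorem Rand.mem_support_lift {x : Timed α} {b : Timed α} :
    b ∈ (Rand.law (liftM x)).support ↔ b = x := by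
  change b ∈ (PMF.pure x).support ↔ _
  simp

theorem Rand.mem_support_pure {a : α} {b : Timed α} :
    b ∈ (Rand.law (pure a)).support ↔ b = ⟨a, 0⟩ := by
  change b ∈ (PMF.pure _).support ↔ _
  simp

theorem Rand.Ensures.mono {x : Rand α} {P Q : α → Prop} {A B : ℕ} (h : x.Ensures P A)
    (hPQ : ∀ a, P a → Q a) (hAB : A ≤ B) : x.Ensures Q B :=
  fun a ha => ⟨hPQ _ (h a ha).1, (h a ha).2.trans hAB⟩

/-- The postcondition travels with the step bound, so the cost of `f` has to be bounded only on
results that `x` can produce. -/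
theorem Rand.Ensures.bind {x : Rand α} {f : α → Rand β} {P : α → Prop} {Q : β → Prop} {A B : ℕ}
    (h : x.Ensures P A) (h' : ∀ a, P a → (f a).Ensures Q B) : (x >>= f).Ensures Q (A + B) := by
  intro b hb
  obtain ⟨a, ha, c, hc, rfl⟩ := Rand.mem_support_bind.1 hb
  obtain ⟨h1, h2⟩ := h' _ (h a ha).1 c hc
  exact ⟨h1, add_le_add (h a ha).2 h2⟩

theorem Rand.Ensures.lift_bind {x : Timed α} {f : α → Rand β} {Q : β → Prop} {A B : ℕ}
    (h : x.steps ≤ A) (h' : (f x.val).Ensures Q B) :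
    ((liftM x : Rand α) >>= f).Ensures Q (A + B) := by
  refine Rand.Ensures.bind (P := fun a => a = x.val) ?_ (by rintro _ rfl; exact h')
  intro b hb
  rw [Rand.mem_support_lift.1 hb]
  exact ⟨rfl, h⟩

theorem Rand.ensures_lift {x : Timed α} {P : α → Prop} {A : ℕ} (h : x.steps ≤ A) (hP : P x.val) :
    (liftM x : Rand α).Ensures P A := by
  intro b hb
  rw [Rand.mem_support_lift.1 hb]
  exact ⟨hP, h⟩

theorem Rand.ensures_pure {a : α} {P : α → Prop} (hP : P a) : (pure a : Rand α).Ensures P 0 := by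
  intro b hb
  rw [Rand.mem_support_pure.1 hb]
  exact ⟨hP, le_rfl⟩

theorem Rand.Ensures.stepsLE {x : Rand α} {P : α → Prop} {A : ℕ} (h : x.Ensures P A) {B : ℝ}
    (hB : (A : ℝ) ≤ B) : x.StepsLE B :=
  fun a ha => le_trans (by exact_mod_cast (h a ha).2) hB

/-- The law of the result of a randomized program. -/
noncomputable def Rand.resultLaw (x : Rand α) : PMF α := PMF.map Timed.val x.law

theorem Rand.resultLaw_bind (x : Rand α) (f : α → Rand β) :
    (x >>= f).resultLaw = x.resultLaw.bind fun a => (f a).resultLaw := by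
  have key : ∀ (x : PMF (Timed α)) (g : α → PMF (Timed β)),
      (x.bind fun a => (g a.val).map
        fun c => (⟨c.val, a.steps + c.steps⟩ : Timed β)).map Timed.val =
      (x.map Timed.val).bind fun a => (g a).map Timed.val := by
    intro x g
    rw [PMF.map_bind, PMF.bind_map]
    congr 1
    funext a
    rw [PMF.map_comp]
    rfl
  exact key x f

theorem Rand.resultLaw_lift (x : Timed α) : (liftM x : Rand α).resultLaw = PMF.pure x.val :=
  PMF.pure_map _ _

theorem Rand.resultLaw_pure (a : α) : (pure a : Rand α).resultLaw = PMF.pure a :=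
  PMF.pure_map _ _

theorem Rand.resultLaw_lift_bind (x : Timed α) (f : α → Rand β) :
    ((liftM x : Rand α) >>= f).resultLaw = (f x.val).resultLaw := by
  rw [Rand.resultLaw_bind, Rand.resultLaw_lift, PMF.pure_bind]

theorem Rand.prob_eq (x : Rand α) (p : α → Prop) :
    x.prob p = x.resultLaw.toOuterMeasure {a | p a} := by
  rw [Rand.resultLaw, PMF.toOuterMeasure_map_apply]
  rfl

theorem Rand.prob_lift_bind (x : Timed α) (f : α → Rand β) (p : β → Prop) :
    ((liftM x : Rand α) >>= f).prob p = (f x.val).prob p := by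
  rw [Rand.prob_eq, Rand.prob_eq, Rand.resultLaw_lift_bind]

theorem Rand.prob_bind (x : Rand α) (f : α → Rand β) (p : β → Prop) :
    (x >>= f).prob p = ∑' a, x.resultLaw a * (f a).prob p := by
  simp only [Rand.prob_eq, Rand.resultLaw_bind, PMF.toOuterMeasure_bind_apply]

theorem Rand.mem_support_resultLaw {x : Rand α} {a : α} :
    a ∈ x.resultLaw.support ↔ ∃ b ∈ x.law.support, b.val = a := by
  rw [Rand.resultLaw, PMF.mem_support_map_iff]

/-- The implication is needed on the support only. A fact that holds for every draw can therefore be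
added to a random event for free. -/
theorem Rand.prob_mono {x : Rand α} {p q : α → Prop}
    (h : ∀ b ∈ x.law.support, p b.val → q b.val) : x.prob p ≤ x.prob q :=
  PMF.toOuterMeasure_mono _ fun a ha => h a ha.2 ha.1

theorem Rand.prob_eq_one {x : Rand α} {p : α → Prop} (h : ∀ b ∈ x.law.support, p b.val) :
    x.prob p = 1 :=
  (PMF.toOuterMeasure_apply_eq_one_iff _ _).2 h

theorem Rand.prob_le_one (x : Rand α) (p : α → Prop) : x.prob p ≤ 1 := by
  rw [← Rand.prob_eq_one (x := x) (p := fun _ => True) fun _ _ => trivial]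
  exact Rand.prob_mono fun _ _ _ => trivial

theorem Rand.prob_add_prob_not (x : Rand α) (p : α → Prop) :
    x.prob p + x.prob (fun a => ¬ p a) = 1 := by
  rw [← Rand.prob_eq_one (x := x) (p := fun _ => True) fun _ _ => trivial]
  simp only [Rand.prob, PMF.toOuterMeasure_apply, ← ENNReal.tsum_add]
  congr 1
  funext a
  by_cases h : p a.val <;> simp [Set.indicator, h]

/-- A bound for the probability of `p` after every result of the first program. -/
theorem Rand.le_prob_bind {x : Rand α} {f : α → Rand β} {p : β → Prop} {q : ℝ≥0∞}
    (h : ∀ b ∈ x.law.support, q ≤ (f b.val).prob p) : q ≤ (x >>= f).prob p := by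
  rw [Rand.prob_bind]
  calc q = ∑' a, x.resultLaw a * q := by rw [ENNReal.tsum_mul_right, PMF.tsum_coe, one_mul]
    _ ≤ _ := by
      refine ENNReal.tsum_le_tsum fun a => ?_
      by_cases ha : a ∈ x.resultLaw.support
      · obtain ⟨b, hb, rfl⟩ := Rand.mem_support_resultLaw.1 ha
        gcongr
        exact h b hb
      · rw [PMF.mem_support_iff, not_not] at ha
        simp [ha]

/-- If `r` implies that `p` holds surely afterwards, then `p` is as likely as `r`. -/
theorem Rand.prob_le_prob_bind {x : Rand α} {f : α → Rand β} {p : β → Prop} {r : α → Prop}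
    (h : ∀ a, r a → (f a).prob p = 1) : x.prob r ≤ (x >>= f).prob p := by
  rw [Rand.prob_bind, Rand.prob_eq, PMF.toOuterMeasure_apply]
  refine ENNReal.tsum_le_tsum fun a => ?_
  by_cases ha : r a
  · simp [ha, h a ha]
  · simp [ha]

/-- If `p` is impossible after results in `r` and has probability at most `q` after the others,
then its probability is at most `q` times the probability of the complement of `r`. -/
theorem Rand.prob_bind_le {x : Rand α} {f : α → Rand β} {p : β → Prop} {r : α → Prop} {q : ℝ≥0∞}
    (h0 : ∀ a, r a → (f a).prob p = 0) (h1 : ∀ a, ¬ r a → (f a).prob p ≤ q) :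
    (x >>= f).prob p ≤ x.prob (fun a => ¬ r a) * q := by
  rw [Rand.prob_bind, Rand.prob_eq, PMF.toOuterMeasure_apply, ← ENNReal.tsum_mul_right]
  refine ENNReal.tsum_le_tsum fun a => ?_
  by_cases ha : r a
  · simp [h0 a ha]
  · simp only [Set.indicator, Set.mem_ofPred_eq, ha, not_false_eq_true, if_true]
    gcongr
    exact h1 a ha

end Rand

/-! ### Pruning, the threshold graph and carving -/

section Geometry

variable {V : Type} [MetricSpace V] {m : ℕ}

@[simp] theorem distLT_val (γ : ℝ) (u v : V) : (distLT γ u v).val = decide (dist u v < γ) := rfl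
@[simp] theorem distLT_steps (γ : ℝ) (u v : V) : (distLT γ u v).steps = 1 := rfl
@[simp] theorem eqT_val {V : Type} [DecidableEq V] (u v : V) : (eqT u v).val = decide (u = v) := rfl
@[simp] theorem eqT_steps {V : Type} [DecidableEq V] (u v : V) : (eqT u v).steps = 1 := rfl
@[simp] theorem Problem.hasColor_val {V : Type} (I : Problem V m) (i : Fin m) (v : V) :
    (I.hasColor i v).val = decide (I.color v = i) := rfl
@[simp] theorem Problem.hasColor_steps {V : Type} (I : Problem V m) (i : Fin m) (v : V) :
    (I.hasColor i v).steps = 1 := rfl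

/-! ### Pruning -/

theorem pruneColor_cons_val (γ : ℝ) (b : ℕ) (v : V) (l : List V) :
    (pruneColor γ (b + 1) (v :: l)).val =
      v :: (pruneColor γ b (l.filter fun u => !decide (dist u v < γ))).val := by
  simp [pruneColor]

theorem pruneColor_subset (γ : ℝ) (b : ℕ) (l : List V) :
    (pruneColor γ b l).val ⊆ l := by
  induction b generalizing l with
  | zero => simp [pruneColor]
  | succ b ih =>
    cases l with
    | nil => simp [pruneColor]
    | cons v l =>
      rw [pruneColor_cons_val]
      exact List.cons_subset_cons _ (List.Subset.trans (ih _) (List.filter_sublist.subset))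

theorem pruneColor_pairwise {γ : ℝ} (b : ℕ) (l : List V) :
    (pruneColor γ b l).val.Pairwise fun u v => γ ≤ dist u v := by
  induction b generalizing l with
  | zero => simp [pruneColor]
  | succ b ih =>
    cases l with
    | nil => simp [pruneColor]
    | cons v l =>
      rw [pruneColor_cons_val, List.pairwise_cons]
      refine ⟨fun u hu => ?_, ih _⟩
      have := pruneColor_subset _ _ _ hu
      simp only [List.mem_filter, Bool.not_eq_true', decide_eq_false_iff_not, not_lt] at this
      rw [dist_comm]
      exact this.2

/-- A budget of at least the number of points is never exhausted, so the selection stops only when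
every point is marked, that is, close to a selected one. -/
theorem exists_mem_pruneColor {γ : ℝ} (hγ : 0 < γ) (b : ℕ) (l : List V) (hb : l.length ≤ b) :
    ∀ v ∈ l, ∃ u ∈ (pruneColor γ b l).val, dist v u < γ := by
  induction b generalizing l with
  | zero =>
    obtain rfl : l = [] := List.length_eq_zero_iff.1 (by omega)
    simp
  | succ b ih =>
    cases l with
    | nil => simp
    | cons w l =>
      intro v hv
      rw [pruneColor_cons_val]
      by_cases h : dist v w < γ
      · exact ⟨w, by simp, h⟩
      · rcases List.mem_cons.1 hv with rfl | hv
        · simp [hγ] at h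
        · obtain ⟨u, hu, hd⟩ := ih (l.filter fun u => !decide (dist u w < γ))
            ((List.length_filter_le _ _).trans (by simpa using hb)) v
            (by simpa [hv] using h)
          exact ⟨u, by simp [hu], hd⟩

/-- The colors do not interact. Separation and covering thus reduce to the single run of
`pruneColor` on the color class of `v`. -/
theorem Problem.mem_pruneColors_val (I : Problem V m) (γ : ℝ) (b : ℕ) (pts : List V)
    (is : List (Fin m)) (v : V) :
    v ∈ (I.pruneColors γ b pts is).val ↔
      I.color v ∈ is ∧
        v ∈ (pruneColor γ b (pts.filter fun u => decide (I.color u = I.color v))).val := by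
  induction is with
  | nil => simp [Problem.pruneColors]
  | cons i is ih =>
    simp only [Problem.pruneColors, Timed.val_bind, appendT_val, filterT_val,
      Problem.hasColor_val, List.mem_append, ih, List.mem_cons]
    constructor
    · rintro (h | h)
      · have hi : I.color v = i := by simpa using (List.mem_filter.1 (pruneColor_subset _ _ _ h)).2
        subst hi
        exact ⟨.inl rfl, h⟩
      · exact ⟨.inr h.1, h.2⟩
    · rintro ⟨rfl | h, h'⟩
      · exact .inl h'
      · exact .inr ⟨h, h'⟩

theorem Problem.pruneColors_nodup (I : Problem V m) {γ : ℝ} (hγ : 0 < γ) (b : ℕ) (pts : List V)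
    (is : List (Fin m)) (his : is.Nodup) : (I.pruneColors γ b pts is).val.Nodup := by
  induction is with
  | nil => simp [Problem.pruneColors]
  | cons i is ih =>
    have h0 := ih (List.nodup_cons.1 his).2
    simp only [Problem.pruneColors, Timed.val_bind, appendT_val, filterT_val,
      Problem.hasColor_val]
    refine List.Nodup.append ?_ h0 ?_
    · refine (pruneColor_pairwise (γ := γ) b _).imp ?_
      rintro u v h rfl
      simp only [dist_self] at h
      linarith
    · intro v hv hv'
      have hi : I.color v = i := by simpa using (List.mem_filter.1 (pruneColor_subset _ _ _ hv)).2
      rw [I.mem_pruneColors_val, hi] at hv'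
      exact (List.nodup_cons.1 his).1 hv'.1

theorem Problem.prune_nodup (I : Problem V m) {γ : ℝ} (hγ : 0 < γ) (b : ℕ) (pts : List V) :
    (I.prune γ b pts).val.Nodup :=
  I.pruneColors_nodup hγ b pts _ (List.nodup_finRange m)

/-- Points of the pruned space that have the same color are far from each other. -/
theorem Problem.le_dist_of_mem_prune (I : Problem V m) {γ : ℝ} (b : ℕ) (pts : List V) {u v : V}
    (hu : u ∈ (I.prune γ b pts).val) (hv : v ∈ (I.prune γ b pts).val)
    (hc : I.color u = I.color v) (huv : u ≠ v) : γ ≤ dist u v := by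
  have hu' := ((I.mem_pruneColors_val γ b pts _ u).1 hu).2
  have hv' := ((I.mem_pruneColors_val γ b pts _ v).1 hv).2
  rw [hc] at hu'
  have : Std.Symm fun u v : V => γ ≤ dist u v := ⟨fun x y h => by rwa [dist_comm]⟩
  exact (pruneColor_pairwise (γ := γ) b _).forall hu' hv' huv

/-- The pruned space has a point of the same color near every point. -/
theorem Problem.exists_mem_prune (I : Problem V m) {γ : ℝ} (hγ : 0 < γ) {b : ℕ} {pts : List V}
    (hb : pts.length ≤ b) {v : V} (hv : v ∈ pts) :
    ∃ u ∈ (I.prune γ b pts).val, I.color u = I.color v ∧ dist v u < γ := by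
  obtain ⟨u, hu, hd⟩ := exists_mem_pruneColor hγ b
    (pts.filter fun u => decide (I.color u = I.color v))
    ((List.length_filter_le _ _).trans hb) v (by simp [hv])
  have hc : I.color u = I.color v := by
    simpa using (List.mem_filter.1 (pruneColor_subset _ _ _ hu)).2
  refine ⟨u, (I.mem_pruneColors_val γ b pts _ u).2 ⟨List.mem_finRange _, ?_⟩, hc, hd⟩
  rwa [hc]

/-! ### The graph metric -/

/-- `v` can be reached from `u` by at most `r` steps shorter than `θ` to points of `U`. -/
def Near (θ : ℝ) (U : List V) : ℕ → V → V → Prop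
  | 0, u, v => u = v
  | r + 1, u, v => Near θ U r u v ∨ ∃ w, Near θ U r u w ∧ v ∈ U ∧ dist v w < θ

variable {θ : ℝ} {U : List V}

theorem Near.refl (r : ℕ) (u : V) : Near θ U r u u := by
  induction r with
  | zero => rfl
  | succ r ih => exact .inl ih

theorem Near.mono {r s : ℕ} (hrs : r ≤ s) {u v : V} (h : Near θ U r u v) : Near θ U s u v := by
  induction hrs with
  | refl => exact h
  | step _ ih => exact .inl ih

theorem Near.mem {r : ℕ} {u v : V} (h : Near θ U r u v) (hu : u ∈ U) : v ∈ U := by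
  induction r generalizing v with
  | zero => exact h ▸ hu
  | succ r ih => exact h.elim ih fun ⟨_, _, hv, _⟩ => hv

theorem Near.trans {r s : ℕ} {u v w : V} (h : Near θ U r u v) (h' : Near θ U s v w) :
    Near θ U (r + s) u w := by
  induction s generalizing w with
  | zero => exact h' ▸ h
  | succ s ih =>
    rcases h' with h' | ⟨x, hx, hw, hd⟩
    · exact .inl (ih h')
    · exact .inr ⟨x, ih hx, hw, hd⟩

/-- The path is reversed edge by edge. The reversed path ends in `u`, and `Near` requires every
point after the start to lie in `U`. -/
theorem Near.symm {r : ℕ} {u v : V} (h : Near θ U r u v) (hu : u ∈ U) : Near θ U r v u := by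
  induction r generalizing v with
  | zero => exact Eq.symm h
  | succ r ih =>
    rcases h with h | ⟨x, hx, hv, hd⟩
    · exact .inl (ih h)
    · have h1 : Near θ U 1 v x := .inr ⟨v, rfl, hx.mem hu, by rwa [dist_comm]⟩
      have := h1.trans (ih hx)
      rwa [add_comm] at this

/-- Edge lengths are strictly below `θ` and add up by the triangle inequality. The case `u = v` is
kept apart because an empty path gives no strict bound. -/
theorem Near.eq_or_dist_lt {r : ℕ} {u v : V} (h : Near θ U r u v) :
    u = v ∨ dist u v < r * θ := by
  induction r generalizing v with
  | zero => exact .inl h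
  | succ r ih =>
    rcases h with h | ⟨x, hx, -, hd⟩
    · rcases ih h with h' | h'
      · exact .inl h'
      · by_cases hθ : 0 ≤ θ
        · right
          push_cast
          linarith
        · have : dist u v < 0 := h'.trans_le (mul_nonpos_of_nonneg_of_nonpos (by positivity)
            (le_of_lt (not_le.1 hθ)))
          exact absurd dist_nonneg (not_le.2 this)
    · right
      rw [dist_comm] at hd
      push_cast
      rcases ih hx with rfl | h'
      · have := (dist_nonneg (x := u) (y := v)).trans hd.le
        nlinarith [mul_nonneg (Nat.cast_nonneg (α := ℝ) r) this]
      · linarith [dist_triangle u x v]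

/-- A ball that does not grow in one step does not grow any more. -/
theorem Near.of_stable {r : ℕ} {u : V} (h : ∀ v, Near θ U (r + 1) u v → Near θ U r u v) (s : ℕ)
    {v : V} (hv : Near θ U s u v) : Near θ U r u v := by
  induction s generalizing v with
  | zero => exact hv ▸ Near.refl _ _
  | succ s ih =>
    rcases hv with hv | ⟨w, hw, hvU, hd⟩
    · exact ih hv
    · exact h v (.inr ⟨w, ih hw, hvU, hd⟩)

/-! ### Breadth-first search -/

/-- The hypotheses on `front` and `unseen` are the loop invariant: the sphere of radius `t` around
`c` and the part of `U` outside the ball of radius `t`. -/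
theorem mem_bfs (c : V) (r t : ℕ) (front unseen : List V)
    (hf : ∀ v, v ∈ front ↔ Near θ U t c v ∧ ∀ s < t, ¬ Near θ U s c v)
    (hu : ∀ v, v ∈ unseen ↔ v ∈ U ∧ ¬ Near θ U t c v) (v : V) (s : ℕ) :
    (v, s) ∈ (bfs θ r t front unseen).val ↔
      t ≤ s ∧ s ≤ t + r ∧ Near θ U s c v ∧ ∀ s' < s, ¬ Near θ U s' c v := by
  induction r generalizing t front unseen with
  | zero =>
    simp only [bfs, Timed.val_bind, mapT_val, Timed.val_pure, List.mem_map, Prod.mk.injEq,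
      add_zero]
    constructor
    · rintro ⟨w, hw, rfl, rfl⟩
      exact ⟨le_rfl, le_rfl, (hf w).1 hw⟩
    · rintro ⟨h1, h2, h3⟩
      obtain rfl := le_antisymm h2 h1
      exact ⟨v, (hf v).2 h3, rfl, rfl⟩
  | succ r ih =>
    simp only [bfs, Timed.val_bind, mapT_val, Timed.val_pure, appendT_val, filterT_val, anyT_val,
      notT_val, distLT_val, List.mem_append, List.mem_map, Prod.mk.injEq]
    -- A neighbor of an unseen point that lies in the ball of radius `t` must lie on its sphere;
    -- otherwise the point would have been reached by time `t`.
    have step : ∀ w, w ∈ U → ¬ Near θ U t c w →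
        ((∃ x ∈ front, dist w x < θ) ↔ Near θ U (t + 1) c w) := by
      intro w hw hn
      constructor
      · rintro ⟨x, hx, hd⟩
        exact .inr ⟨x, ((hf x).1 hx).1, hw, hd⟩
      · rintro (h | ⟨x, hx, -, hd⟩)
        · exact absurd h hn
        · refine ⟨x, (hf x).2 ⟨hx, fun s hs hs' => hn ?_⟩, hd⟩
          exact Near.mono (Nat.succ_le_of_lt hs) (.inr ⟨x, hs', hw, hd⟩)
    rw [ih (t + 1)]
    · constructor
      · rintro (⟨w, hw, rfl, rfl⟩ | ⟨h1, h2, h3⟩)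
        · exact ⟨le_rfl, by omega, (hf w).1 hw⟩
        · exact ⟨by omega, by omega, h3⟩
      · rintro ⟨h1, h2, h3⟩
        rcases h1.eq_or_lt with rfl | h1
        · exact .inl ⟨v, (hf v).2 h3, rfl, rfl⟩
        · exact .inr ⟨h1, by omega, h3⟩
    · intro w
      simp only [List.mem_filter, List.any_eq_true, decide_eq_true_eq, hu]
      constructor
      · rintro ⟨⟨hw, hn⟩, h⟩
        exact ⟨(step w hw hn).1 h, fun s hs h' => hn (h'.mono (by omega))⟩
      · rintro ⟨h, h'⟩
        have hn := h' t (by omega)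
        have hw : w ∈ U := h.elim (fun h => absurd h hn) fun ⟨_, _, hw, _⟩ => hw
        exact ⟨⟨hw, hn⟩, (step w hw hn).2 h⟩
    · intro w
      simp only [List.mem_filter, hu, Bool.not_eq_true', List.any_eq_false, decide_eq_true_eq]
      constructor
      · rintro ⟨⟨hw, hn⟩, h⟩
        refine ⟨hw, fun h' => ?_⟩
        obtain ⟨x, hx, hd⟩ := (step w hw hn).2 h'
        exact h x hx hd
      · rintro ⟨hw, hn⟩
        have hn' : ¬ Near θ U t c w := fun h => hn (.inl h)
        exact ⟨⟨hw, hn'⟩, fun x hx hd => hn ((step w hw hn').1 ⟨x, hx, hd⟩)⟩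

theorem mem_ball [DecidableEq V] (R : ℕ) (c : V) (v : V) (s : ℕ) :
    (v, s) ∈ (ball θ R U c).val ↔ s ≤ R ∧ Near θ U s c v ∧ ∀ s' < s, ¬ Near θ U s' c v := by
  simp only [ball, Timed.val_bind, filterT_val, notT_val, eqT_val]
  rw [mem_bfs (U := U) c]
  · simp
  · intro w
    simp [Near, eq_comm (a := w)]
  · intro w
    simp [Near, eq_comm (a := w)]

theorem exists_mem_ball [DecidableEq V] (R : ℕ) (c : V) (v : V) :
    (∃ s, (v, s) ∈ (ball θ R U c).val) ↔ Near θ U R c v := by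
  classical
  simp only [mem_ball]
  constructor
  · rintro ⟨s, hs, h, -⟩
    exact h.mono hs
  · intro h
    -- The search reports the exact graph distance, which is the least such `s`.
    have hex : ∃ s, Near θ U s c v := ⟨R, h⟩
    exact ⟨Nat.find hex, Nat.find_min' hex h, Nat.find_spec hex, fun s' hs' => Nat.find_min hex hs'⟩

/-! ### Carving -/

/-- The cluster of `c` without the points of `Z`. -/
noncomputable def cluster [DecidableEq V] (θ : ℝ) (R : ℕ) (U Z : List V) (c : V) : List V :=
  ((ball θ R U c).val.filter fun q => !Z.any fun z => decide (q.1 = z)).map Prod.fst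

/-- The inner part of the cluster of `c` without the points of `Z`. -/
noncomputable def core [DecidableEq V] (θ : ℝ) (R : ℕ) (U Z : List V) (c : V) : List V :=
  (((ball θ R U c).val.filter fun q => !Z.any fun z => decide (q.1 = z)).filter
    fun q => decide (q.2 < R)).map Prod.fst

theorem carve_cons_val [DecidableEq V] (R : ℕ) (c : V) (cs Z : List V) :
    (carve θ R U (c :: cs) Z).val =
      core θ R U Z c :: (carve θ R U cs (cluster θ R U Z c ++ Z)).val := by
  simp [carve, core, cluster]

theorem mem_cluster [DecidableEq V] {R : ℕ} {Z : List V} {c v : V} :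
    v ∈ cluster θ R U Z c ↔ Near θ U R c v ∧ v ∉ Z := by
  rw [← exists_mem_ball]
  simp only [cluster, List.mem_map, List.mem_filter, Prod.exists, exists_and_right,
    exists_eq_right, Bool.not_eq_true', List.any_eq_false, decide_eq_true_eq]
  refine and_congr_right fun _ => ⟨fun h hv => h v hv rfl, ?_⟩
  rintro h x hx rfl
  exact h hx

/-- Distance less than `R` is distance at most `R - 1`. For `R = 0` this fails, since the core is
empty while `R - 1` is still `0`. -/
theorem mem_core [DecidableEq V] {R : ℕ} (hR : 1 ≤ R) {Z : List V} {c v : V} :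
    v ∈ core θ R U Z c ↔ Near θ U (R - 1) c v ∧ v ∉ Z := by
  rw [← exists_mem_ball]
  simp only [core, List.mem_map, List.mem_filter, Prod.exists, exists_and_right,
    exists_eq_right, Bool.not_eq_true', List.any_eq_false, decide_eq_true_eq, mem_ball]
  constructor
  · rintro ⟨s, ⟨⟨h1, h2⟩, h3⟩, h4⟩
    exact ⟨⟨s, by omega, h2⟩, fun hv => h3 v hv rfl⟩
  · rintro ⟨⟨s, h1, h2⟩, h3⟩
    refine ⟨s, ⟨⟨by omega, h2⟩, ?_⟩, by omega⟩
    rintro x hx rfl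
    exact h3 hx

/-- `Z` only grows during the carving, so later cores avoid the original `Z` too. The common center
bounds the diameter of a core, which later forces separated points into different cores. -/
theorem mem_carve [DecidableEq V] {R : ℕ} (hR : 1 ≤ R) (cs Z : List V) (hcs : cs ⊆ U) {D : List V}
    (hD : D ∈ (carve θ R U cs Z).val) :
    ∃ c ∈ U, ∀ v ∈ D, Near θ U (R - 1) c v ∧ v ∉ Z := by
  induction cs generalizing Z with
  | nil => simp [carve] at hD
  | cons c cs ih =>
    rw [carve_cons_val, List.mem_cons] at hD
    rcases hD with rfl | hD
    · exact ⟨c, hcs (by simp), fun v hv => (mem_core hR).1 hv⟩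
    · obtain ⟨c', hc', h⟩ := ih _ (fun x hx => hcs (by simp [hx])) hD
      refine ⟨c', hc', fun v hv => ⟨(h v hv).1, fun hz => (h v hv).2 (by simp [hz])⟩⟩

/-- Different clusters have a positive distance. -/
theorem carve_pairwise [DecidableEq V] {R : ℕ} (hR : 1 ≤ R) (cs Z : List V) (hcs : cs ⊆ U) :
    (carve θ R U cs Z).val.Pairwise fun D D' => ∀ u ∈ D, ∀ v ∈ D', u ≠ v ∧ θ ≤ dist u v := by
  induction cs generalizing Z with
  | nil => simp [carve]
  | cons c cs ih =>
    rw [carve_cons_val, List.pairwise_cons]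
    have hcs' : cs ⊆ U := fun x hx => hcs (by simp [hx])
    refine ⟨fun D' hD' u hu v hv => ?_, ih _ hcs'⟩
    obtain ⟨c', hc', h⟩ := mem_carve hR cs _ hcs' hD'
    obtain ⟨hv1, hv2⟩ := h v hv
    obtain ⟨hu1, hu2⟩ := (mem_core hR).1 hu
    simp only [List.mem_append, mem_cluster, not_or, not_and, not_not] at hv2
    have hvc : ¬ Near θ U R c v := fun h => hv2.2 (hv2.1 h)
    constructor
    · rintro rfl
      exact hvc (hu1.mono (by omega))
    · by_contra hd
      refine hvc ?_
      -- An edge from the core point `u` would bring `v` into the ball of radius `R` around `c`, so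
      -- `v` would already have been removed.
      have : Near θ U (R - 1 + 1) c v :=
        .inr ⟨u, hu1, hv1.mem hc', by rw [dist_comm]; exact not_le.1 hd⟩
      rwa [Nat.sub_add_cancel hR] at this

/-- A point is clustered if the first center in its ball is not on the boundary. -/
theorem exists_mem_carve [DecidableEq V] {R : ℕ} (hR : 1 ≤ R) {pre post : List V} {c v : V}
    (hpre : ∀ x ∈ pre, x ∈ U ∧ ¬ Near θ U R v x) (hv : Near θ U (R - 1) v c) (hvU : v ∈ U)
    (Z : List V) (hZ : v ∉ Z) : ∃ D ∈ (carve θ R U (pre ++ c :: post) Z).val, v ∈ D := by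
  induction pre generalizing Z with
  | nil =>
    rw [List.nil_append, carve_cons_val]
    exact ⟨_, List.mem_cons_self, (mem_core hR).2 ⟨hv.symm hvU, hZ⟩⟩
  | cons x pre ih =>
    rw [List.cons_append, carve_cons_val]
    -- No earlier center removes `v`: by symmetry of the graph distance, `v` is outside the ball of
    -- radius `R` around that center.
    obtain ⟨D, hD, h⟩ := ih (fun y hy => hpre y (by simp [hy])) (cluster θ R U Z x ++ Z) (by
      simp only [List.mem_append, mem_cluster, not_or, hZ, not_false_eq_true,
        and_true]
      intro h
      exact absurd (h.symm (hpre x (by simp)).1) (hpre x (by simp)).2)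
    exact ⟨D, List.mem_cons_of_mem _ hD, h⟩

end Geometry

/-! ### The flow network -/

section Network

variable {V : Type} {m : ℕ}

@[simp] theorem setCap_val (r : Capacity m) (a b : Node m) (x : ℕ) (a' b' : Node m) :
    (setCap r a b x).val a' b' = if a' = a ∧ b' = b then x else r a' b' := rfl

@[simp] theorem setCap_steps (r : Capacity m) (a b : Node m) (x : ℕ) :
    (setCap r a b x).steps = 1 := rfl

open Classical in
/-- The capacities of the network. -/
noncomputable def Problem.cap (I : Problem V m) (Ds : List (List V)) : Capacity m
  | .source, .cluster i => if i < Ds.length then 1 else 0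
  | .cluster i, .color j => if ∃ D, Ds[i]? = some D ∧ ∃ u ∈ D, I.color u = j then 1 else 0
  | .color j, .sink => I.lower j
  | .color j, .slack => I.upper j - I.lower j
  | .slack, .sink => I.k - ∑ j, I.lower j
  | _, _ => 0

open Classical in
-- Several points of one color write the same entry, so the capacity stays `1` and only existence of
-- such a point matters.
theorem Problem.addMembers_val (I : Problem V m) (i : ℕ) (D : List V) (r : Capacity m)
    (a b : Node m) :
    (I.addMembers i D r).val a b =
      if a = .cluster i ∧ ∃ u ∈ D, b = .color (I.color u) then 1 else r a b := by
  induction D generalizing r with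
  | nil => simp [Problem.addMembers]
  | cons u D ih =>
    simp only [Problem.addMembers, Timed.val_bind, ih, setCap_val, List.mem_cons,
      exists_eq_or_imp]
    split_ifs <;> first | rfl | (exfalso; grind)

open Classical in
theorem Problem.addClusters_val (I : Problem V m) (i : ℕ) (Ds : List (List V)) (r : Capacity m)
    (a b : Node m) :
    (I.addClusters i Ds r).val a b =
      if (a = .source ∧ ∃ n < Ds.length, b = .cluster (i + n)) ∨
        (∃ n D, Ds[n]? = some D ∧ a = .cluster (i + n) ∧ ∃ u ∈ D, b = .color (I.color u))
      then 1 else r a b := by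
  induction Ds generalizing i r with
  | nil => simp [Problem.addClusters]
  | cons D Ds ih =>
    simp only [Problem.addClusters, Timed.val_bind, ih, setCap_val, I.addMembers_val]
    have e1 : (∃ n < (D :: Ds).length, b = Node.cluster (m := m) (i + n)) ↔
        b = .cluster i ∨ ∃ n < Ds.length, b = .cluster (i + 1 + n) := by
      constructor
      · rintro ⟨_ | n, hn, h⟩
        · exact .inl h
        · exact .inr ⟨n, by simpa using hn, by rw [h]; congr 1; omega⟩
      · rintro (h | ⟨n, hn, h⟩)
        · exact ⟨0, by simp, h⟩
        · exact ⟨n + 1, by simpa using hn, by rw [h]; congr 1; omega⟩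
    have e2 : (∃ n D', (D :: Ds)[n]? = some D' ∧ a = .cluster (i + n) ∧
          ∃ u ∈ D', b = .color (I.color u)) ↔
        (a = .cluster i ∧ ∃ u ∈ D, b = .color (I.color u)) ∨
        ∃ n D', Ds[n]? = some D' ∧ a = .cluster (i + 1 + n) ∧
          ∃ u ∈ D', b = .color (I.color u) := by
      constructor
      · rintro ⟨_ | n, D', hn, h, h'⟩
        · simp only [List.getElem?_cons_zero, Option.some.injEq] at hn
          subst hn
          exact .inl ⟨h, h'⟩
        · exact .inr ⟨n, D', by simpa using hn, by rw [h]; congr 1; omega, h'⟩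
      · rintro (⟨h, h'⟩ | ⟨n, D', hn, h, h'⟩)
        · exact ⟨0, D, by simp, h, h'⟩
        · exact ⟨n + 1, D', by simpa using hn, by rw [h]; congr 1; omega, h'⟩
    simp only [e1, e2]
    split_ifs <;> first | rfl | (exfalso; grind)

theorem Problem.addColors_val (I : Problem V m) (js : List (Fin m)) (r : Capacity m)
    (a b : Node m) :
    (I.addColors js r).val a b =
      match a, b with
      | .color j, .sink => if j ∈ js then I.lower j else r (.color j) .sink
      | .color j, .slack => if j ∈ js then I.upper j - I.lower j else r (.color j) .slack
      | a, b => r a b := by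
  induction js generalizing r with
  | nil => cases a <;> cases b <;> simp [Problem.addColors]
  | cons j js ih =>
    simp only [Problem.addColors, Timed.val_bind, ih, setCap_val, List.mem_cons]
    cases a <;> cases b <;> simp
    all_goals split_ifs <;> simp_all

theorem Problem.sumLower_val (I : Problem V m) (js : List (Fin m)) :
    (I.sumLower js).val = (js.map I.lower).sum := by
  induction js with
  | nil => rfl
  | cons j js ih => simp [Problem.sumLower, ih]

theorem Problem.network_val (I : Problem V m) (Ds : List (List V)) :
    (I.network Ds).val = I.cap Ds := by
  funext a b
  simp only [Problem.network, Timed.val_bind, setCap_val, I.addColors_val, I.addClusters_val,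
    I.sumLower_val, List.mem_finRange, if_true]
  have hs : ((List.finRange m).map I.lower).sum = ∑ j, I.lower j := by
    rw [← List.ofFn_eq_map, List.sum_ofFn]
  cases a <;> cases b <;> simp [Problem.cap, hs, eq_comm]
  congr 1
  simp only [Node.cluster.injEq, Node.color.injEq, reduceCtorEq, false_and, false_or, zero_add,
    eq_iff_iff]
  constructor
  · rintro ⟨n, D, hD, rfl, h⟩
    exact ⟨D, hD, h.imp fun _ h => ⟨h.1, h.2.symm⟩⟩
  · rintro ⟨D, hD, h⟩
    exact ⟨_, D, hD, rfl, h.imp fun _ h => ⟨h.1, h.2.symm⟩⟩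

theorem clusterNodes_val (i : ℕ) (Ds : List (List V)) :
    (clusterNodes m i Ds).val = (List.range' i Ds.length).map .cluster := by
  induction Ds generalizing i with
  | nil => rfl
  | cons D Ds ih => simp [clusterNodes, ih, List.range'_succ]

theorem innerNodes_val (Ds : List (List V)) :
    (innerNodes m Ds).val = (List.range' 0 Ds.length).map .cluster ++
      ((List.finRange m).map .color ++ [.slack, .sink]) := by
  simp [innerNodes, clusterNodes_val]

/-- The nodes of a network with `c` clusters. -/
def nodeSet (m c : ℕ) : Finset (Node m) :=
  insert .source (insert .slack (insert .sink
    ((Finset.range c).image .cluster ∪ Finset.univ.image .color)))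

theorem mem_nodeSet_iff (Ds : List (List V)) (a : Node m) :
    a ∈ nodeSet m Ds.length ↔ a = .source ∨ a ∈ (innerNodes m Ds).val := by
  simp only [nodeSet, innerNodes_val, Finset.mem_insert, Finset.mem_union, Finset.mem_image,
    Finset.mem_range, Finset.mem_univ, true_and, List.mem_append, List.mem_map, List.mem_range',
    List.mem_finRange, List.mem_cons, List.not_mem_nil, or_false]
  grind

/-- Splitting sums by the kind of node turns flow conservation into one explicit equation per kind.
-/
theorem sum_nodeSet (c : ℕ) (F : Node m → ℤ) :
    ∑ a ∈ nodeSet m c, F a = F .source + F .slack + F .sink +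
      ∑ i ∈ Finset.range c, F (.cluster i) + ∑ j, F (.color j) := by
  have h1 : Function.Injective (Node.cluster (m := m)) := fun a b h => by simpa using h
  have h2 : Function.Injective (Node.color (m := m)) := fun a b h => by simpa using h
  rw [nodeSet, Finset.sum_insert (by simp), Finset.sum_insert (by simp),
    Finset.sum_insert (by simp), Finset.sum_union, Finset.sum_image h1.injOn,
    Finset.sum_image h2.injOn]
  · ring
  · rw [Finset.disjoint_left]
    simp

end Network

/-! ### Augmenting paths -/

section Augment

variable {m : ℕ}

theorem extendTo_eq_none (r : Capacity m) (w : Node m) (ps : List (List (Node m))) :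
    (extendTo r w ps).val = none ↔ ∀ p ∈ ps, ∀ a, p.head? = some a → r a w = 0 := by
  induction ps with
  | nil => simp [extendTo]
  | cons p ps ih =>
    rcases p with _ | ⟨a, p⟩
    · simp [extendTo, ih]
    · simp only [extendTo, Timed.val_bind, List.mem_cons, forall_eq_or_imp, List.head?_cons,
        Option.some.injEq, forall_eq']
      split_ifs with h
      · grind [Timed.val_pure]
      · rw [ih]
        exact ⟨fun h' => ⟨by omega, h'⟩, fun h' => h'.2⟩

theorem extendTo_eq_some {r : Capacity m} {w : Node m} {ps : List (List (Node m))}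
    {q : List (Node m)} (h : (extendTo r w ps).val = some q) :
    ∃ a p, a :: p ∈ ps ∧ 0 < r a w ∧ q = w :: a :: p := by
  induction ps with
  | nil => simp [extendTo] at h
  | cons p ps ih =>
    rcases p with _ | ⟨a, p⟩
    · simp only [extendTo, Timed.val_bind] at h
      obtain ⟨a, p, h1, h2⟩ := ih h
      exact ⟨a, p, by simp [h1], h2⟩
    · simp only [extendTo, Timed.val_bind] at h
      split_ifs at h with h'
      · simp only [Timed.val_pure, Option.some.injEq] at h
        exact ⟨a, p, by simp, h', h.symm⟩
      · obtain ⟨a, p, h1, h2⟩ := ih h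
        exact ⟨a, p, by simp [h1], h2⟩

theorem nextLayer_val (r : Capacity m) (ps : List (List (Node m))) (ws : List (Node m)) :
    (nextLayer r ps ws).val = (ws.filterMap fun w => (extendTo r w ps).val,
      ws.filter fun w => (extendTo r w ps).val.isNone) := by
  induction ws with
  | nil => simp [nextLayer]
  | cons w ws ih =>
    simp only [nextLayer, Timed.val_bind, ih]
    cases h : (extendTo r w ps).val <;> simp [h]

/-- Each node of `ws` either receives a path or stays unseen. A nonempty layer thus shrinks the
unseen list, which bounds the number of useful layers and the cost of each. -/
theorem nextLayer_length (r : Capacity m) (ps : List (List (Node m))) (ws : List (Node m)) :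
    (nextLayer r ps ws).val.1.length + (nextLayer r ps ws).val.2.length = ws.length := by
  rw [nextLayer_val]
  induction ws with
  | nil => simp
  | cons w ws ih =>
    cases h : (extendTo r w ps).val <;> simp [h] at ih ⊢ <;> omega

theorem findSink_eq_none {ps : List (List (Node m))} (h : (findSink ps).val = none) :
    ∀ p ∈ ps, p.head? ≠ some .sink := by
  induction ps with
  | nil => simp
  | cons p ps ih =>
    simp only [findSink, Timed.val_bind] at h
    split_ifs at h with h'
    simp only [List.mem_cons, forall_eq_or_imp]
    exact ⟨h', ih h⟩

theorem findSink_eq_some {ps : List (List (Node m))} {p : List (Node m)}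
    (h : (findSink ps).val = some p) : p ∈ ps ∧ p.head? = some .sink := by
  induction ps with
  | nil => simp [findSink] at h
  | cons q ps ih =>
    simp only [findSink, Timed.val_bind] at h
    split_ifs at h with h'
    · simp only [Timed.val_pure, Option.some.injEq] at h
      subst h
      exact ⟨by simp, h'⟩
    · exact ⟨by simp [(ih h).1], (ih h).2⟩

/-- A path in the residual graph from the source, listed backwards. -/
structure IsResidualPath (r : Capacity m) (p : List (Node m)) : Prop where
  nodup : p.Nodup
  chain : p.IsChain fun b a => 0 < r a b
  last : p.getLast? = some .source

theorem mem_nextLayer_fst {r : Capacity m} {ps : List (List (Node m))} {ws : List (Node m)}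
    {q : List (Node m)} (hq : q ∈ (nextLayer r ps ws).val.1) :
    ∃ w a p, w ∈ ws ∧ a :: p ∈ ps ∧ 0 < r a w ∧ q = w :: a :: p ∧
      (extendTo r w ps).val ≠ none := by
  rw [nextLayer_val] at hq
  obtain ⟨w, hw, h⟩ := List.mem_filterMap.1 hq
  obtain ⟨a, p, h1, h2, h3⟩ := extendTo_eq_some h
  exact ⟨w, a, p, hw, h1, h2, h3, by simp [h]⟩

theorem mem_nextLayer_snd {r : Capacity m} {ps : List (List (Node m))} {ws : List (Node m)}
    {w : Node m} :
    w ∈ (nextLayer r ps ws).val.2 ↔ w ∈ ws ∧ ∀ p ∈ ps, ∀ a, p.head? = some a → r a w = 0 := by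
  rw [nextLayer_val, List.mem_filter, Option.isNone_iff_eq_none, extendTo_eq_none]

/-- Paths avoid the unseen nodes, and a path is prolonged by an unseen node only; this keeps it free
of repetitions. -/
theorem isResidualPath_nextLayer {r : Capacity m} {ps : List (List (Node m))} {ws : List (Node m)}
    (h : ∀ p ∈ ps, IsResidualPath r p ∧ ∀ a ∈ p, a ∉ ws) :
    ∀ q ∈ (nextLayer r ps ws).val.1,
      IsResidualPath r q ∧ ∀ a ∈ q, a ∉ (nextLayer r ps ws).val.2 := by
  intro q hq
  obtain ⟨w, a, p, hw, hp, hr, rfl, hne⟩ := mem_nextLayer_fst hq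
  obtain ⟨⟨h1, h2, h3⟩, h4⟩ := h _ hp
  refine ⟨⟨List.nodup_cons.2 ⟨fun hm => h4 w hm hw, h1⟩, ?_, ?_⟩, ?_⟩
  · exact List.isChain_cons_cons.2 ⟨hr, h2⟩
  · rw [List.getLast?_cons_cons]
    exact h3
  · intro b hb
    rw [mem_nextLayer_snd]
    rintro ⟨h5, h6⟩
    rcases List.mem_cons.1 hb with rfl | hb
    · exact hne ((extendTo_eq_none _ _ _).2 h6)
    · exact h4 b hb h5

/-- The last conjunct keeps the path inside the node set over which `outCap` sums. -/
theorem findPath_eq_some {r : Capacity m} {f : ℕ} {ps : List (List (Node m))}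
    {ws : List (Node m)} (h : ∀ p ∈ ps, IsResidualPath r p ∧ ∀ a ∈ p, a ∉ ws)
    {q : List (Node m)} (hq : (findPath r f ps ws).val = some q) :
    IsResidualPath r q ∧ q.head? = some .sink ∧ ∀ a ∈ q, a ∈ ws ∨ ∃ p ∈ ps, a ∈ p := by
  induction f generalizing ps ws with
  | zero => simp [findPath] at hq
  | succ f ih =>
    have hmem : ∀ q ∈ (nextLayer r ps ws).val.1, ∀ a ∈ q, a ∈ ws ∨ ∃ p ∈ ps, a ∈ p := by
      intro q hq a ha
      obtain ⟨w, b, p, hw, hp, -, rfl, -⟩ := mem_nextLayer_fst hq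
      rcases List.mem_cons.1 ha with rfl | ha
      · exact .inl hw
      · exact .inr ⟨_, hp, ha⟩
    simp only [findPath, Timed.val_bind] at hq
    cases hs : (findSink (nextLayer r ps ws).val.1).val with
    | some p =>
      simp only [hs, Timed.val_pure, Option.some.injEq] at hq
      subst hq
      obtain ⟨h1, h2⟩ := findSink_eq_some hs
      exact ⟨(isResidualPath_nextLayer h _ h1).1, h2, hmem _ h1⟩
    | none =>
      simp only [hs] at hq
      obtain ⟨h1, h2, h3⟩ := ih (isResidualPath_nextLayer h) hq
      refine ⟨h1, h2, fun a ha => ?_⟩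
      rcases h3 a ha with h4 | ⟨p, hp, h4⟩
      · exact .inl (mem_nextLayer_snd.1 h4).1
      · exact hmem p hp a h4

/-- If there is no augmenting path, then the sink is on the far side of a saturated cut. -/
theorem findPath_eq_none {r : Capacity m} {f : ℕ} {ps : List (List (Node m))}
    {ws : List (Node m)} (N : Finset (Node m)) (hf : ws.length ≤ f) (hsink : .sink ∈ ws)
    (h : ∀ a ∈ N, a ∉ ws → (∃ p ∈ ps, p.head? = some a) ∨ ∀ b ∈ ws, r a b = 0)
    (hn : (findPath r f ps ws).val = none) :
    ∃ W : List (Node m), W ⊆ ws ∧ .sink ∈ W ∧ ∀ a ∈ N, a ∉ W → ∀ b ∈ W, r a b = 0 := by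
  induction f generalizing ps ws with
  | zero =>
    obtain rfl : ws = [] := List.length_eq_zero_iff.1 (by omega)
    simp at hsink
  | succ f ih =>
    simp only [findPath, Timed.val_bind] at hn
    cases hs : (findSink (nextLayer r ps ws).val.1).val with
    | some p => simp [hs] at hn
    | none =>
      simp only [hs] at hn
      have hlen := nextLayer_length r ps ws
      have hcase : ∀ a ∈ ws, a ∉ (nextLayer r ps ws).val.2 →
          ∃ p ∈ (nextLayer r ps ws).val.1, p.head? = some a := by
        intro a ha hna
        rw [nextLayer_val] at hna ⊢
        cases he : (extendTo r a ps).val with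
        | none => exact absurd (List.mem_filter.2 ⟨ha, by simp [he]⟩) hna
        | some q =>
          obtain ⟨b, p, -, -, rfl⟩ := extendTo_eq_some he
          exact ⟨_, List.mem_filterMap.2 ⟨a, ha, he⟩, rfl⟩
      have hsub : (nextLayer r ps ws).val.2 ⊆ ws := fun a ha => (mem_nextLayer_snd.1 ha).1
      have hsink' : .sink ∈ (nextLayer r ps ws).val.2 := by
        by_contra hc
        obtain ⟨p, hp, hp'⟩ := hcase _ hsink hc
        exact findSink_eq_none hs p hp hp'
      -- The invariant `h` passes to the next layer: a node left unseen has no residual edge from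
      -- the old layer or from any node seen before.
      have hold : ∀ a ∈ N, a ∉ ws → ∀ b ∈ (nextLayer r ps ws).val.2, r a b = 0 := by
        intro a ha haw b hb
        obtain ⟨hb1, hb2⟩ := mem_nextLayer_snd.1 hb
        rcases h a ha haw with ⟨p, hp, hpa⟩ | h'
        · exact hb2 p hp a hpa
        · exact h' b hb1
      -- An empty layer means that nothing new is reachable, and the unseen nodes form the far side
      -- of the cut. Otherwise the unseen list gets shorter, so `f` layers suffice.
      by_cases h0 : (nextLayer r ps ws).val.1 = []
      · refine ⟨_, hsub, hsink', fun a ha haW b hb => ?_⟩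
        by_cases haw : a ∈ ws
        · obtain ⟨p, hp, -⟩ := hcase a haw haW
          simp [h0] at hp
        · exact hold a ha haw b hb
      · have := List.length_pos_iff.2 h0
        obtain ⟨W, hW1, hW2, hW3⟩ := ih (by omega) hsink' (fun a ha haW => by
          by_cases haw : a ∈ ws
          · exact .inl (hcase a haw haW)
          · exact .inr (hold a ha haw)) hn
        exact ⟨W, fun a ha => hsub (hW1 ha), hW2, hW3⟩

/-- The residual capacity that leaves `v`. -/
def outCap (N : Finset (Node m)) (r : Capacity m) (v : Node m) : ℤ := ∑ w ∈ N, (r v w : ℤ)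

/-- Pushing a unit from `a` to `b` moves one unit of residual capacity from `(a, b)` to `(b, a)`.
The outgoing capacity rises by one at `b` and drops by one at `a`, and these changes cancel at inner
nodes of the path. -/
theorem augment_spec (N : Finset (Node m)) (p : List (Node m)) (r : Capacity m)
    (hnd : p.Nodup) (hch : p.IsChain fun b a => 0 < r a b) (hN : ∀ a ∈ p, a ∈ N)
    {s t : Node m} (hs : p.getLast? = some s) (ht : p.head? = some t) :
    (∀ a b, (augment p r).val a b + (augment p r).val b a = r a b + r b a) ∧
    ∀ v, outCap N (augment p r).val v =
      outCap N r v + ((if v = t then 1 else 0) - if v = s then 1 else 0) := by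
  induction p generalizing r t with
  | nil => simp at ht
  | cons b p ih =>
    obtain rfl : b = t := by simpa using ht
    cases p with
    | nil =>
      obtain rfl : b = s := by simpa using hs
      simp [augment]
    | cons a p =>
      simp only [augment, Timed.val_bind]
      have hba : b ≠ a := fun h => (List.nodup_cons.1 hnd).1 (by simp [h])
      have hab : a ≠ b := hba.symm
      have hpos : 0 < r a b := (List.isChain_cons_cons.1 hch).1
      set r₁ := (setCap r a b (r a b - 1)).val with hr₁
      set r₂ := (setCap r₁ b a (r₁ b a + 1)).val with hr₂
      have hval : ∀ x y, r₂ x y = if x = b ∧ y = a then r b a + 1 else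
          if x = a ∧ y = b then r a b - 1 else r x y := by
        intro x y
        simp only [hr₂, hr₁, setCap_val]
        simp [hba]
      have hbn : b ∉ a :: p := (List.nodup_cons.1 hnd).1
      -- The rest of the path avoids `b`, so its entries are untouched and it is still a residual
      -- path.
      obtain ⟨h1, h2⟩ := ih r₂ (List.nodup_cons.1 hnd).2 (by
          refine List.IsChain.imp_of_mem_imp ?_ (List.isChain_cons_cons.1 hch).2
          intro x y hx hy hxy
          rw [hval]
          have hxb : x ≠ b := fun h => hbn (h ▸ hx)
          have hyb : y ≠ b := fun h => hbn (h ▸ hy)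
          simpa [hxb, hyb] using hxy)
        (fun x hx => hN x (by simp [hx])) (by rwa [List.getLast?_cons_cons] at hs) rfl
      refine ⟨fun x y => ?_, fun v => ?_⟩
      · rw [h1, hval, hval]
        by_cases e1 : x = b ∧ y = a
        · obtain ⟨rfl, rfl⟩ := e1
          simp [hab]
          omega
        · by_cases e2 : x = a ∧ y = b
          · obtain ⟨rfl, rfl⟩ := e2
            simp [hab]
            omega
          · have e3 : ¬ (y = b ∧ x = a) := fun h => e2 ⟨h.2, h.1⟩
            have e4 : ¬ (y = a ∧ x = b) := fun h => e1 ⟨h.2, h.1⟩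
            simp [e1, e2, e3, e4]
      · rw [h2]
        have hpt : ∀ w, (r₂ v w : ℤ) = r v w + (if w = a then if v = b then 1 else 0 else 0) -
            (if w = b then if v = a then 1 else 0 else 0) := by
          intro w
          rw [hval]
          by_cases hvb : v = b
          · subst hvb
            by_cases hwa : w = a
            · subst hwa; simp [hba]
            · simp [hwa, hba]
          · by_cases hva : v = a
            · subst hva
              by_cases hwb : w = b
              · subst hwb
                simp [hab, Nat.cast_sub (Nat.succ_le_of_lt hpos)]
              · simp [hab, hwb]
            · simp [hva, hvb]
        have hsum : outCap N r₂ v = outCap N r v + (if v = b then 1 else 0) -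
            (if v = a then 1 else 0) := by
          simp only [outCap, hpt, Finset.sum_sub_distrib, Finset.sum_add_distrib,
            Finset.sum_ite_eq']
          simp [hN]
        rw [hsum]
        ring

/-- `r` is the residual capacity of a flow of value `t`. -/
structure IsResidual (N : Finset (Node m)) (cap r : Capacity m) (t : ℤ) : Prop where
  add_eq : ∀ a b, r a b + r b a = cap a b + cap b a
  out_eq : ∀ v, outCap N r v =
    outCap N cap v + t * ((if v = .sink then 1 else 0) - if v = .source then 1 else 0)

/-- Each augmentation adds one to the value. Either all `f` augmentations take place, or a search
fails and leaves a saturated cut. -/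
theorem maxFlow_spec {N : Finset (Node m)} {nodes : List (Node m)}
    (hN : ∀ a, a ∈ N ↔ a = .source ∨ a ∈ nodes) (hsource : .source ∉ nodes)
    (hsink : .sink ∈ nodes) {cap : Capacity m} (f : ℕ) {r : Capacity m} {t : ℤ}
    (h : IsResidual N cap r t) :
    ∃ t', IsResidual N cap (maxFlow nodes nodes.length f r).val t' ∧
      (t' = t + f ∨ ∃ W : List (Node m), W ⊆ nodes ∧ .sink ∈ W ∧
        ∀ a ∈ N, a ∉ W → ∀ b ∈ W, (maxFlow nodes nodes.length f r).val a b = 0) := by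
  induction f generalizing r t with
  | zero => exact ⟨t, by simpa [maxFlow] using h, .inl (by simp)⟩
  | succ f ih =>
    simp only [maxFlow, Timed.val_bind]
    cases hp : (findPath r nodes.length [[.source]] nodes).val with
    | none =>
      refine ⟨t, h, .inr ?_⟩
      refine findPath_eq_none N le_rfl hsink (fun a ha han => .inl ?_) hp
      obtain rfl := ((hN a).1 ha).resolve_right han
      exact ⟨_, List.mem_singleton_self _, rfl⟩
    | some p =>
      obtain ⟨⟨h1, h2, h3⟩, h4, h5⟩ := findPath_eq_some (by
        intro p hp
        rw [List.mem_singleton] at hp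
        subst hp
        exact ⟨⟨by simp, by simp, rfl⟩, by simpa using hsource⟩) hp
      obtain ⟨h6, h7⟩ := augment_spec N p r h1 h2 (fun a ha => (hN a).2 (by
        rcases h5 a ha with h | ⟨q, hq, haq⟩
        · exact .inr h
        · rw [List.mem_singleton] at hq
          subst hq
          exact .inl (by simpa using haq))) h3 h4
      obtain ⟨t', h8, h9⟩ := ih (r := (augment p r).val) (t := t + 1)
        ⟨fun a b => (h6 a b).trans (h.add_eq a b), fun v => by
          rw [h7, h.out_eq]
          ring⟩
      refine ⟨t', h8, ?_⟩
      rcases h9 with h9 | h9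
      · left
        rw [h9]
        push_cast
        ring
      · exact .inr h9

end Augment

/-! ### Optimality of the flow and the flow of a fair set -/

section MaxFlow

variable {m : ℕ}

/-- The value of a flow is at most the value of a residual flow with a saturated cut. -/
theorem IsResidual.value_le {N : Finset (Node m)} {cap r : Capacity m} {t K : ℤ}
    (h : IsResidual N cap r t) (hsource : .source ∈ N) {g : Capacity m}
    (hg : ∀ a b, g a b ≤ cap a b)
    (hflow : ∀ v ∈ N, ∑ w ∈ N, ((g v w : ℤ) - g w v) =
      K * ((if v = .source then 1 else 0) - if v = .sink then 1 else 0))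
    (W : List (Node m)) (hW : .source ∉ W) (hW' : .sink ∈ W)
    (hcut : ∀ a ∈ N, a ∉ W → ∀ b ∈ W, r a b = 0) : K ≤ t := by
  -- The net flow encoded by `r` is `cap a b - r a b`, so `d` is the difference of the two net
  -- flows. It is antisymmetric, hence cancels within the source side of the cut, and it is
  -- nonpositive across the cut, where `r` vanishes. Its total outflow from the source side is `K -
  -- t`.
  set d : Node m → Node m → ℤ := fun a b => g a b - g b a - cap a b + r a b with hd
  have hanti : ∀ a b, d a b = - d b a := by
    intro a b
    have : (r a b : ℤ) + r b a = cap a b + cap b a := by exact_mod_cast h.add_eq a b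
    simp only [hd]
    linarith
  have hsum : ∀ v ∈ N, ∑ w ∈ N, d v w =
      (K - t) * ((if v = .source then 1 else 0) - if v = .sink then 1 else 0) := by
    intro v hv
    have h1 := h.out_eq v
    have h2 := hflow v hv
    simp only [outCap] at h1
    simp only [Finset.sum_sub_distrib] at h2
    simp only [hd, Finset.sum_sub_distrib, Finset.sum_add_distrib, h1, h2]
    ring
  have h0 : ∑ a ∈ N with a ∉ W, ∑ b ∈ N with b ∉ W, d a b = 0 := by
    have h1 : ∑ a ∈ N with a ∉ W, ∑ b ∈ N with b ∉ W, d a b =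
        - ∑ a ∈ N with a ∉ W, ∑ b ∈ N with b ∉ W, d a b := by
      conv_lhs => rw [Finset.sum_comm]
      simp only [← Finset.sum_neg_distrib]
      exact Finset.sum_congr rfl fun a _ => Finset.sum_congr rfl fun b _ => hanti b a
    linarith
  have h1 : ∑ a ∈ N with a ∉ W, ∑ b ∈ N, d a b = K - t := by
    rw [Finset.sum_congr rfl fun a ha => hsum a (Finset.mem_filter.1 ha).1]
    rw [← Finset.mul_sum, Finset.sum_sub_distrib, Finset.sum_ite_eq', Finset.sum_ite_eq']
    simp [hsource, hW, hW']
  have h2 : ∑ a ∈ N with a ∉ W, ∑ b ∈ N, d a b ≤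
      ∑ a ∈ N with a ∉ W, ∑ b ∈ N with b ∉ W, d a b := by
    refine Finset.sum_le_sum fun a ha => ?_
    rw [Finset.mem_filter] at ha
    rw [← Finset.sum_filter_add_sum_filter_not N (fun b => b ∉ W)]
    have : ∑ b ∈ N with ¬ b ∉ W, d a b ≤ 0 := by
      refine Finset.sum_nonpos fun b hb => ?_
      rw [Finset.mem_filter, not_not] at hb
      have h3 : (r a b : ℤ) = 0 := by exact_mod_cast hcut a ha.1 ha.2 b hb.2
      have h4 : (g a b : ℤ) ≤ cap a b := by exact_mod_cast hg a b
      have h5 : (0 : ℤ) ≤ g b a := by positivity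
      simp only [hd]
      linarith
    linarith
  linarith

variable {V : Type}

theorem Problem.sum_card_color (I : Problem V m) (O : Finset V) :
    ∑ j, (O.filter fun v => I.color v = j).card = O.card :=
  (Finset.card_eq_sum_card_fiberwise fun _ _ => Finset.mem_coe.2 (Finset.mem_univ _)).symm

/-- This makes the truncated subtraction in the capacity from `slack` to `sink` exact. -/
theorem Problem.IsFair.sum_lower_le {I : Problem V m} {O : Finset V} (hO : I.IsFair O) :
    ∑ j, I.lower j ≤ I.k := by
  rw [← hO.1, ← I.sum_card_color O]
  exact Finset.sum_le_sum fun j _ => (hO.2 j).1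

/-- The flow that assigns every point `o` of `O` to the cluster `φ o`. -/
def Problem.flowOf (I : Problem V m) (O : Finset V) (φ : V → ℕ) : Capacity m
  | .source, .cluster i => (O.filter fun o => φ o = i).card
  | .cluster i, .color j => ((O.filter fun o => I.color o = j).filter fun o => φ o = i).card
  | .color j, .sink => I.lower j
  | .color j, .slack => (O.filter fun o => I.color o = j).card - I.lower j
  | .slack, .sink => I.k - ∑ j, I.lower j
  | _, _ => 0

/-- Injectivity of `φ` means that a cluster is used by at most one point, which respects the unit
capacities; the upper bounds of fairness respect the edges into `slack`. -/
theorem Problem.flowOf_le_cap (I : Problem V m) {O : Finset V} (hO : I.IsFair O) {φ : V → ℕ}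
    {Ds : List (List V)} (hφ : ∀ o ∈ O, ∃ D, Ds[φ o]? = some D ∧ o ∈ D)
    (hinj : Set.InjOn φ O) (a b : Node m) : I.flowOf O φ a b ≤ I.cap Ds a b := by
  have h1 : ∀ i, (O.filter fun o => φ o = i).card ≤ 1 := fun i =>
    Finset.card_le_one.2 fun x hx y hy => by
      rw [Finset.mem_filter] at hx hy
      exact hinj hx.1 hy.1 (hx.2.trans hy.2.symm)
  cases a <;> cases b <;> simp only [Problem.flowOf, Problem.cap, le_refl]
  case source.cluster i =>
    split_ifs with hi
    · exact h1 i
    · refine le_of_eq (Finset.card_eq_zero.2 (Finset.filter_eq_empty_iff.2 ?_))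
      rintro o ho rfl
      obtain ⟨D, hD, -⟩ := hφ o ho
      exact hi (List.getElem?_eq_some_iff.1 hD).1
  case cluster.color i j =>
    split_ifs with hi
    · refine le_trans (Finset.card_le_card ?_) (h1 i)
      exact Finset.filter_subset_filter _ (Finset.filter_subset _ _)
    · refine le_of_eq (Finset.card_eq_zero.2 (Finset.filter_eq_empty_iff.2 ?_))
      rintro o ho rfl
      rw [Finset.mem_filter] at ho
      obtain ⟨D, hD, hoD⟩ := hφ o ho.1
      exact hi ⟨D, hD, o, hoD, ho.2⟩
  case color.slack j => exact Nat.sub_le_sub_right (hO.2 j).2 _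

/-- At a color the class size splits into the lower bound and the excess. At `slack` the excesses
add up to `k` minus the sum of the lower bounds. -/
theorem Problem.flowOf_conservation (I : Problem V m) {O : Finset V} (hO : I.IsFair O) {φ : V → ℕ}
    {c : ℕ} (hφ : ∀ o ∈ O, φ o < c) : ∀ v ∈ nodeSet m c,
    ∑ w ∈ nodeSet m c, ((I.flowOf O φ v w : ℤ) - I.flowOf O φ w v) =
      (I.k : ℤ) * ((if v = .source then 1 else 0) - if v = .sink then 1 else 0) := by
  have hfib : ∀ P : Finset V, P ⊆ O →
      ∑ i ∈ Finset.range c, ((P.filter fun o => φ o = i).card : ℤ) = P.card := by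
    intro P hP
    have := Finset.card_eq_sum_card_fiberwise (s := P) (t := Finset.range c) (f := φ)
      fun o ho => Finset.mem_coe.2 (Finset.mem_range.2 (hφ o (hP ho)))
    exact_mod_cast this.symm
  have hk : ∑ j, (((O.filter fun o => I.color o = j).card : ℕ) : ℤ) = I.k := by
    rw [← hO.1, ← I.sum_card_color O]
    push_cast
    rfl
  have hl := hO.sum_lower_le
  have hsub : ∀ j, (((O.filter fun o => I.color o = j).card - I.lower j : ℕ) : ℤ) =
      (O.filter fun o => I.color o = j).card - I.lower j := fun j => Nat.cast_sub (hO.2 j).1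
  intro v _
  rw [sum_nodeSet]
  cases v with
  | source => simp [Problem.flowOf, hfib O subset_rfl, hO.1]
  | slack => simp [Problem.flowOf, hsub, Nat.cast_sub hl, hk]
  | sink =>
    simp [Problem.flowOf, Nat.cast_sub hl]
    ring
  | color j => simp [Problem.flowOf, hsub, hfib _ (Finset.filter_subset _ O)]
  | cluster i =>
    have : ∑ j, ((((O.filter fun o => I.color o = j).filter fun o => φ o = i).card : ℕ) : ℤ) =
        (O.filter fun o => φ o = i).card := by
      rw [← I.sum_card_color (O.filter fun o => φ o = i)]
      push_cast
      simp only [Finset.filter_filter, and_comm]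
    simp [Problem.flowOf, this]

/-! ### Extraction of the points -/

theorem Problem.pick_eq_none {I : Problem V m} {r : Capacity m} {i : ℕ} {D : List V}
    (h : (I.pick r i D).val = none) : ∀ u ∈ D, r (.color (I.color u)) (.cluster i) = 0 := by
  induction D with
  | nil => simp
  | cons u D ih =>
    simp only [Problem.pick, Timed.val_bind] at h
    split_ifs at h with h'
    simp only [List.mem_cons, forall_eq_or_imp]
    exact ⟨by omega, ih h⟩

theorem Problem.pick_eq_some {I : Problem V m} {r : Capacity m} {i : ℕ} {D : List V} {u : V}
    (h : (I.pick r i D).val = some u) : u ∈ D ∧ 0 < r (.color (I.color u)) (.cluster i) := by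
  induction D with
  | nil => simp [Problem.pick] at h
  | cons v D ih =>
    simp only [Problem.pick, Timed.val_bind] at h
    split_ifs at h with h'
    · simp only [Timed.val_pure, Option.some.injEq] at h
      subst h
      exact ⟨by simp, h'⟩
    · exact ⟨by simp [(ih h).1], (ih h).2⟩

theorem Problem.extract_cons_val (I : Problem V m) (r : Capacity m) (i : ℕ) (D : List V)
    (Ds : List (List V)) : (I.extract r i (D :: Ds)).val =
      (I.pick r i D).val.toList ++ (I.extract r (i + 1) Ds).val := by
  simp only [Problem.extract, Timed.val_bind]
  cases (I.pick r i D).val <;> simp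

theorem Problem.mem_extract {I : Problem V m} {r : Capacity m} {i : ℕ} {Ds : List (List V)} {u : V}
    (h : u ∈ (I.extract r i Ds).val) : ∃ D ∈ Ds, u ∈ D := by
  induction Ds generalizing i with
  | nil => simp [Problem.extract] at h
  | cons D Ds ih =>
    rw [I.extract_cons_val, List.mem_append, Option.mem_toList] at h
    rcases h with h | h
    · exact ⟨D, by simp, (Problem.pick_eq_some h).1⟩
    · obtain ⟨D', h1, h2⟩ := ih h
      exact ⟨D', by simp [h1], h2⟩

theorem Problem.extract_pairwise {I : Problem V m} {r : Capacity m} (i : ℕ) {Ds : List (List V)}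
    {R : V → V → Prop} (h : Ds.Pairwise fun D D' => ∀ u ∈ D, ∀ v ∈ D', R u v) :
    (I.extract r i Ds).val.Pairwise R := by
  induction Ds generalizing i with
  | nil => simp [Problem.extract]
  | cons D Ds ih =>
    rw [List.pairwise_cons] at h
    rw [I.extract_cons_val, List.pairwise_append]
    refine ⟨?_, ih _ h.2, fun u hu v hv => ?_⟩
    · cases (I.pick r i D).val <;> simp
    · obtain ⟨D', hD', hv'⟩ := Problem.mem_extract hv
      exact h.1 D' hD' u (Problem.pick_eq_some (Option.mem_toList.1 hu)).1 v hv'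

/-- By hypothesis a cluster sends one unit to the color of its picked point and nothing elsewhere,
so color counts of the output are flow amounts into the colors. -/
theorem Problem.length_filter_extract {I : Problem V m} {r : Capacity m} (i : ℕ)
    {Ds : List (List V)} (h : ∀ n D, Ds[n]? = some D → ∀ j,
      r (.color j) (.cluster (i + n)) =
        if (I.pick r (i + n) D).val.map I.color = some j then 1 else 0) (j : Fin m) :
    ((I.extract r i Ds).val.filter fun u => decide (I.color u = j)).length =
      ∑ n ∈ Finset.range Ds.length, r (.color j) (.cluster (i + n)) := by
  induction Ds generalizing i with
  | nil => simp [Problem.extract]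
  | cons D Ds ih =>
    have h0 := h 0 D rfl j
    rw [add_zero] at h0
    rw [I.extract_cons_val, List.filter_append, List.length_append, ih (i + 1), List.length_cons,
      Finset.sum_range_succ', add_zero, add_comm, h0]
    · congr 1
      · exact Finset.sum_congr rfl fun n _ => by rw [add_assoc, add_comm 1]
      · cases (I.pick r i D).val with
        | none => simp
        | some u => by_cases hu : I.color u = j <;> simp [hu]
    · intro n D' hD' j'
      have := h (n + 1) D' (by simpa using hD') j'
      rwa [add_comm n, ← add_assoc] at this

theorem Problem.sum_length_filter (I : Problem V m) (S : List V) :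
    ∑ j, (S.filter fun u => decide (I.color u = j)).length = S.length := by
  induction S with
  | nil => simp
  | cons u S ih =>
    simp only [List.filter_cons, List.length_cons, ← ih]
    have : ∀ j, (if decide (I.color u = j) = true then u :: S.filter fun v => decide (I.color v = j)
        else S.filter fun v => decide (I.color v = j)).length =
        (S.filter fun v => decide (I.color v = j)).length + if I.color u = j then 1 else 0 := by
      intro j
      by_cases h : I.color u = j <;> simp [h]
    simp only [this, Finset.sum_add_distrib, Finset.sum_ite_eq, Finset.mem_univ, if_true]

theorem Problem.checkFair_eq_true (I : Problem V m) (S : List V) :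
    (I.checkFair S).val = true ↔ S.length = I.k ∧ ∀ j,
      I.lower j ≤ (S.filter fun u => decide (I.color u = j)).length ∧
      (S.filter fun u => decide (I.color u = j)).length ≤ I.upper j := by
  simp only [Problem.checkFair, Timed.val_bind, lengthT_val]
  split_ifs with h <;> simp [h]

/-- The flow computation yields a fair set if there are points in distinct clusters that form a
fair set. -/
theorem Problem.checkFair_flow (I : Problem V m) {O : Finset V} (hO : I.IsFair O) {φ : V → ℕ}
    {Ds : List (List V)} (hφ : ∀ o ∈ O, ∃ D, Ds[φ o]? = some D ∧ o ∈ D)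
    (hinj : Set.InjOn φ O) : (I.checkFair (I.flow Ds).val).val = true := by
  simp only [Problem.flow, Timed.val_bind, lengthT_val, I.network_val]
  set nodes := (innerNodes m Ds).val with hnodes
  set c := Ds.length with hc
  set N := nodeSet m c with hN
  have hlt : ∀ o ∈ O, φ o < c := fun o ho => by
    obtain ⟨D, hD, -⟩ := hφ o ho
    exact (List.getElem?_eq_some_iff.1 hD).1
  have hsourceN : Node.source ∈ N := (mem_nodeSet_iff Ds _).2 (.inl rfl)
  have hsource : Node.source ∉ nodes := by simp [hnodes, innerNodes_val]
  have hsink : Node.sink ∈ nodes := by simp [hnodes, innerNodes_val]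
  -- If all `c` augmentations take place, the value is `c`, and this is enough because the points of
  -- `O` occupy distinct clusters.
  have hkc : I.k ≤ c := by
    rw [← hO.1, ← Finset.card_range c]
    exact Finset.card_le_card_of_injOn φ (fun o ho => Finset.mem_coe.2
      (Finset.mem_range.2 (hlt o ho))) hinj
  obtain ⟨t, ⟨hadd, hout⟩, ht⟩ := maxFlow_spec (N := N) (mem_nodeSet_iff Ds) hsource hsink
    (cap := I.cap Ds) c (r := I.cap Ds) (t := 0) ⟨fun _ _ => rfl, fun v => by simp⟩
  set r := (maxFlow nodes nodes.length c (I.cap Ds)).val with hr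
  have hkt : (I.k : ℤ) ≤ t := by
    rcases ht with ht | ⟨W, hW1, hW2, hW3⟩
    · rw [ht]
      simpa using hkc
    · exact IsResidual.value_le (K := I.k) ⟨hadd, hout⟩ hsourceN (I.flowOf_le_cap hO hφ hinj)
        (I.flowOf_conservation hO hlt) W (fun h => hsource (hW1 h)) hW2 hW3
  have hl := hO.sum_lower_le
  have hz : ∀ a b, I.cap Ds a b = 0 → I.cap Ds b a = 0 → r a b = 0 := by
    intro a b h1 h2
    have := hadd a b
    omega
  have haddZ : ∀ a b, (r a b : ℤ) = I.cap Ds a b + I.cap Ds b a - r b a := by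
    intro a b
    have := hadd a b
    zify at this
    linarith
  -- the edges into the sink are saturated
  have hsinkout := hout .sink
  simp only [outCap, hN, sum_nodeSet] at hsinkout
  have e1 : ∀ i, r .sink (.cluster i) = 0 := fun i => hz _ _ rfl rfl
  have e2 : r .sink .sink = 0 := hz _ _ rfl rfl
  have e3 : r .sink .source = 0 := hz _ _ rfl rfl
  have e4 : (r .sink .slack : ℤ) = I.k - (∑ j, (I.lower j : ℤ)) - r .slack .sink := by
    rw [haddZ]
    simp [Problem.cap, Nat.cast_sub hl]
  have e5 : ∀ j, (r .sink (.color j) : ℤ) = I.lower j - r (.color j) .sink := by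
    intro j
    rw [haddZ]
    simp [Problem.cap]
  simp only [e1, e2, e3, e4, e5] at hsinkout
  simp [Problem.cap, Finset.sum_sub_distrib] at hsinkout
  have hnn : (0 : ℤ) ≤ ∑ j, (r (.color j) .sink : ℤ) :=
    Finset.sum_nonneg fun _ _ => by positivity
  -- The capacities into the sink add up to `k`, so a value of at least `k` is exactly `k` and
  -- leaves nothing residual there.
  have htk : t = I.k := by
    have : (0 : ℤ) ≤ r .slack .sink := by positivity
    linarith
  have hsat : ∀ j, r (.color j) .sink = 0 := by
    have h0 : ∑ j, (r (.color j) .sink : ℤ) = 0 := by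
      have : (0 : ℤ) ≤ r .slack .sink := by positivity
      linarith
    intro j
    have := (Finset.sum_eq_zero_iff_of_nonneg (fun _ _ => by positivity)).1 h0 j (Finset.mem_univ j)
    exact_mod_cast this
  -- the flow through a color
  have hcolor : ∀ j, ∑ i ∈ Finset.range c, (r (.color j) (.cluster i) : ℤ) + r (.color j) .slack =
      I.lower j + (I.upper j - I.lower j : ℕ) := by
    intro j
    have h1 := hout (.color j)
    simp only [outCap, hN, sum_nodeSet, hsat j, hz (.color j) .source rfl rfl,
      fun j' => hz (.color j) (.color j') rfl rfl] at h1
    simp [Problem.cap] at h1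
    linarith
  have hslack : ∀ j, r (.color j) .slack ≤ I.upper j - I.lower j := by
    intro j
    have := hadd (.color j) .slack
    simp [Problem.cap] at this
    omega
  -- the flow through a cluster
  have hcap1 : ∀ i j, r (.color j) (.cluster i) ≤ I.cap Ds (.cluster i) (.color j) := by
    intro i j
    have := hadd (.color j) (.cluster i)
    have h0 : I.cap Ds (.color j) (.cluster i) = 0 := rfl
    omega
  have hcluster : ∀ i, ∑ j, (r (.color j) (.cluster i) : ℤ) = r (.cluster i) .source := by
    intro i
    have h1 := hout (.cluster i)
    simp only [outCap, hN, sum_nodeSet, hz (.cluster i) .slack rfl rfl,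
      hz (.cluster i) .sink rfl rfl, fun i' => hz (.cluster i) (.cluster i') rfl rfl,
      fun j => haddZ (.cluster i) (.color j), Finset.sum_sub_distrib, Finset.sum_add_distrib] at h1
    have h0 : ∀ j, I.cap Ds (.color j) (.cluster i) = 0 := fun _ => rfl
    have h2 : I.cap Ds (.cluster i) .source = 0 := rfl
    have h3 : I.cap Ds (.cluster i) .slack = 0 := rfl
    have h4 : I.cap Ds (.cluster i) .sink = 0 := rfl
    have h5 : ∀ i', I.cap Ds (.cluster i) (.cluster i') = 0 := fun _ => rfl
    simp [h0, h2, h3, h4, h5] at h1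
    linarith
  have hle1 : ∀ i, r (.cluster i) .source ≤ 1 := by
    intro i
    have := hadd (.cluster i) .source
    have h1 : I.cap Ds .source (.cluster i) ≤ 1 := by
      simp only [Problem.cap]
      split_ifs <;> omega
    have h2 : I.cap Ds (.cluster i) .source = 0 := rfl
    omega
  -- The reverse residual capacity from a color to a cluster is the flow from the cluster to the
  -- color. A cluster carries at most one unit, so the first point whose color receives flow
  -- accounts for all of it.
  have hpick : ∀ n D, Ds[n]? = some D → ∀ j, r (.color j) (.cluster (0 + n)) =
      if (I.pick r (0 + n) D).val.map I.color = some j then 1 else 0 := by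
    intro n D hD j
    rw [zero_add]
    cases hp : (I.pick r n D).val with
    | none =>
      simp only [Option.map_none, reduceCtorEq, if_false]
      by_contra hne
      have h1 := hcap1 n j
      simp only [Problem.cap] at h1
      split_ifs at h1 with h2
      · obtain ⟨D', hD', u, hu, rfl⟩ := h2
        obtain rfl : D = D' := Option.some.inj (hD.symm.trans hD')
        exact hne (Problem.pick_eq_none hp u hu)
      · omega
    | some u =>
      have h1 := (Problem.pick_eq_some hp).2
      have h2 : ∑ j, r (.color j) (.cluster n) ≤ 1 := by
        have h3 : (∑ j, (r (.color j) (.cluster n) : ℤ)) ≤ 1 := by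
          rw [hcluster]
          exact_mod_cast hle1 n
        exact_mod_cast h3
      simp only [Option.map_some, Option.some.injEq]
      split_ifs with hu
      · subst hu
        have := Finset.single_le_sum (f := fun j => r (.color j) (.cluster n))
          (fun _ _ => Nat.zero_le _) (Finset.mem_univ (I.color u))
        omega
      · have h4 := Finset.sum_le_sum_of_subset (f := fun j => r (.color j) (.cluster n))
          (Finset.subset_univ {I.color u, j})
        rw [Finset.sum_pair hu] at h4
        omega
  have hcount := fun j => Problem.length_filter_extract 0 hpick j
  simp only [zero_add] at hcount
  rw [I.checkFair_eq_true]
  constructor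
  -- The number of extracted points is the total flow out of the source.
  · rw [← I.sum_length_filter]
    simp only [hcount]
    have h1 := hout .source
    have h0 : ∀ i, (r .source (.cluster i) : ℤ) = I.cap Ds .source (.cluster i) -
        r (.cluster i) .source := by
      intro i
      rw [haddZ]
      simp [Problem.cap]
    simp only [outCap, hN, sum_nodeSet, hz .source .slack rfl rfl, hz .source .sink rfl rfl,
      hz .source .source rfl rfl, fun j => hz .source (.color j) rfl rfl, h0,
      Finset.sum_sub_distrib, ← hcluster] at h1
    have h3 : I.cap Ds .source .slack = 0 := rfl
    have h4 : I.cap Ds .source .sink = 0 := rfl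
    have h5 : I.cap Ds .source .source = 0 := rfl
    have h6 : ∀ j, I.cap Ds .source (.color j) = 0 := fun _ => rfl
    simp [h3, h4, h5, h6, htk] at h1
    rw [Finset.sum_comm] at h1
    zify
    linarith
  · intro j
    rw [hcount j]
    have h1 := hcolor j
    have h2 := hslack j
    -- With this the natural subtraction is exact, and the inflow is `upper j` minus the unused
    -- capacity towards `slack`, which is between `0` and `upper j - lower j`.
    have h3 : I.lower j ≤ I.upper j := (hO.2 j).1.trans (hO.2 j).2
    constructor <;> zify <;> zify [h3] at h1 h2 <;> linarith

theorem Problem.flow_pairwise (I : Problem V m) {Ds : List (List V)} {R : V → V → Prop}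
    (h : Ds.Pairwise fun D D' => ∀ u ∈ D, ∀ v ∈ D', R u v) : (I.flow Ds).val.Pairwise R :=
  Problem.extract_pairwise 0 h

end MaxFlow

/-! ### First elements of a random permutation -/

section FirstElement

variable {ι κ : Type} [LinearOrder ι]

/-- In the enumeration `σ`, the element `b` is the first one of `B`. -/
def IsFirst (σ : Equiv.Perm ι) (B : Finset ι) (b : ι) : Prop :=
  b ∈ B ∧ ∀ c ∈ B, σ.symm b ≤ σ.symm c

theorem IsFirst.unique {σ : Equiv.Perm ι} {B : Finset ι} {b c : ι} (hb : IsFirst σ B b)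
    (hc : IsFirst σ B c) : b = c :=
  σ.symm.injective (le_antisymm (hb.2 c hc.1) (hc.2 b hb.1))

theorem exists_isFirst (σ : Equiv.Perm ι) {B : Finset ι} (hB : B.Nonempty) :
    ∃ b, IsFirst σ B b := by
  obtain ⟨b, hb, h⟩ := B.exists_min_image σ.symm hB
  exact ⟨b, hb, h⟩

/-- Exchanging the values `a` and `b` puts `b` at the position of `a`, the earliest among the
positions occupied by `B`. -/
theorem IsFirst.swap_mul {σ : Equiv.Perm ι} {B : Finset ι} {a b : ι} (h : IsFirst σ B a)
    (hb : b ∈ B) : IsFirst (Equiv.swap a b * σ) B b := by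
  refine ⟨hb, fun c hc => ?_⟩
  have h1 : ∀ x, (Equiv.swap a b * σ).symm x = σ.symm (Equiv.swap a b x) := fun x => rfl
  rw [h1, h1, Equiv.swap_apply_right]
  refine h.2 _ ?_
  rw [Equiv.swap_apply_def]
  split_ifs
  · exact hb
  · exact h.1
  · exact hc

theorem IsFirst.swap_mul_of_notMem {σ : Equiv.Perm ι} {B : Finset ι} {a b c : ι}
    (h : IsFirst σ B c) (ha : a ∉ B) (hb : b ∉ B) : IsFirst (Equiv.swap a b * σ) B c := by
  have h1 : ∀ x ∈ B, (Equiv.swap a b * σ).symm x = σ.symm x := fun x hx => by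
    change σ.symm (Equiv.swap a b x) = _
    rw [Equiv.swap_apply_of_ne_of_ne] <;> rintro rfl <;> contradiction
  refine ⟨h.1, fun x hx => ?_⟩
  rw [h1 c h.1, h1 x hx]
  exact h.2 x hx

open Classical in
/-- In a set of permutations that is invariant under the transpositions of elements of `B`, all
elements of `B` are equally often the first one. -/
theorem card_filter_isFirst [Fintype ι] (E : Finset (Equiv.Perm ι)) {A B : Finset ι} (hA : A ⊆ B)
    (hB : B.Nonempty) (hE : ∀ σ ∈ E, ∀ a ∈ B, ∀ b ∈ B, Equiv.swap a b * σ ∈ E) :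
    (E.filter fun σ => ∃ b ∈ A, IsFirst σ B b).card * B.card = E.card * A.card := by
  -- Composition with the transposition of `a` and `b` is injective and maps permutations with `a`
  -- first to permutations with `b` first.
  have hle : ∀ a ∈ B, ∀ b ∈ B, (E.filter fun σ => IsFirst σ B a).card ≤
      (E.filter fun σ => IsFirst σ B b).card := by
    intro a ha b hb
    refine Finset.card_le_card_of_injOn (fun σ => Equiv.swap a b * σ) ?_ ?_
    · intro σ hσ
      rw [Finset.mem_coe, Finset.mem_filter] at hσ ⊢
      exact ⟨hE σ hσ.1 a ha b hb, hσ.2.swap_mul hb⟩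
    · intro σ _ τ _ h
      exact mul_left_cancel h
  obtain ⟨b₀, hb₀⟩ := hB
  have heq : ∀ b ∈ B, (E.filter fun σ => IsFirst σ B b).card =
      (E.filter fun σ => IsFirst σ B b₀).card := fun b hb =>
    le_antisymm (hle b hb b₀ hb₀) (hle b₀ hb₀ b hb)
  have hun : ∀ A ⊆ B, (E.filter fun σ => ∃ b ∈ A, IsFirst σ B b).card =
      A.card * (E.filter fun σ => IsFirst σ B b₀).card := by
    intro A hA
    have : (E.filter fun σ => ∃ b ∈ A, IsFirst σ B b) =
        A.biUnion fun b => E.filter fun σ => IsFirst σ B b := by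
      ext σ
      simp only [Finset.mem_filter, Finset.mem_biUnion]
      tauto
    rw [this, Finset.card_biUnion]
    · rw [Finset.sum_congr rfl fun b hb => heq b (hA hb), Finset.sum_const, smul_eq_mul]
    · intro a _ b _ hab
      rw [Function.onFun, Finset.disjoint_left]
      intro σ h1 h2
      exact hab ((Finset.mem_filter.1 h1).2.unique (Finset.mem_filter.1 h2).2)
  have hall : E.filter (fun σ => ∃ b ∈ B, IsFirst σ B b) = E := by
    refine Finset.filter_true_of_mem fun σ _ => ?_
    obtain ⟨b, hb⟩ := exists_isFirst σ ⟨b₀, hb₀⟩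
    exact ⟨b, hb.1, hb⟩
  have hcard := hun B subset_rfl
  rw [hall] at hcard
  rw [hun A hA, hcard]
  ring

open Classical in
/-- The first elements of disjoint sets in a random permutation are independent and uniform. -/
theorem card_forall_isFirst [Fintype ι] (O : Finset κ) (A B : κ → Finset ι) (hA : ∀ o ∈ O, A o ⊆ B o)
    (hB : ∀ o ∈ O, (B o).Nonempty)
    (hdisj : ∀ o ∈ O, ∀ o' ∈ O, o ≠ o' → Disjoint (B o) (B o')) :
    (Finset.univ.filter fun σ : Equiv.Perm ι => ∀ o ∈ O, ∃ b ∈ A o, IsFirst σ (B o) b).card *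
      ∏ o ∈ O, (B o).card = Fintype.card (Equiv.Perm ι) * ∏ o ∈ O, (A o).card := by
  induction O using Finset.induction_on with
  | empty => simp [Finset.card_univ]
  | insert x O hx ih =>
    have ih := ih (fun o ho => hA o (by simp [ho])) (fun o ho => hB o (by simp [ho]))
      fun o ho o' ho' => hdisj o (by simp [ho]) o' (by simp [ho'])
    -- The event for the other sets is invariant under transpositions within `B x`, as these sets
    -- are disjoint from `B x`. Independence follows by conditioning on that event.
    have h1 := card_filter_isFirst
      (Finset.univ.filter fun σ : Equiv.Perm ι => ∀ o ∈ O, ∃ b ∈ A o, IsFirst σ (B o) b)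
      (hA x (by simp)) (hB x (by simp)) (by
        intro σ hσ a ha b hb
        rw [Finset.mem_filter] at hσ ⊢
        refine ⟨Finset.mem_univ _, fun o ho => ?_⟩
        obtain ⟨c, hc, hfirst⟩ := hσ.2 o ho
        have hd := Finset.disjoint_left.1 (hdisj x (by simp) o (by simp [ho])
          (by rintro rfl; exact hx ho))
        exact ⟨c, hc, hfirst.swap_mul_of_notMem (hd ha) (hd hb)⟩)
    rw [Finset.filter_filter] at h1
    have h2 : (Finset.univ.filter fun σ : Equiv.Perm ι =>
        ∀ o ∈ insert x O, ∃ b ∈ A o, IsFirst σ (B o) b) =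
        Finset.univ.filter fun σ : Equiv.Perm ι => (∀ o ∈ O, ∃ b ∈ A o, IsFirst σ (B o) b) ∧
          ∃ b ∈ A x, IsFirst σ (B x) b := by
      ext σ
      simp only [Finset.mem_filter, Finset.mem_univ, true_and, Finset.forall_mem_insert]
      tauto
    rw [h2, Finset.prod_insert hx, Finset.prod_insert hx, ← mul_assoc, h1]
    calc _ = ((Finset.univ.filter fun σ : Equiv.Perm ι =>
          ∀ o ∈ O, ∃ b ∈ A o, IsFirst σ (B o) b).card * ∏ o ∈ O, (B o).card) * (A x).card := by
          ring
      _ = _ := by rw [ih]; ring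

end FirstElement

/-! ### The success probability -/

/-- The average over the radii telescopes. -/
theorem rpow_le_average {κ : Type} (O : Finset κ) (a : κ → ℕ → ℝ) (ha : ∀ o ∈ O, ∀ r, 0 < a o r)
    {β : ℝ} (hβ : 0 < β) (hβ1 : β ≤ 1) {L m : ℕ} (hL : 0 < L) (hm : O.card ≤ m)
    (h : ∀ o ∈ O, β ≤ a o 0 / a o L) :
    β ^ ((m : ℝ) / L) ≤ ∑ i ∈ Finset.range L, (L : ℝ)⁻¹ * ∏ o ∈ O, a o i / a o (i + 1) := by
  have hL' : (0 : ℝ) < L := by exact_mod_cast hL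
  have hpos : ∀ i, 0 < ∏ o ∈ O, a o i / a o (i + 1) := fun i =>
    Finset.prod_pos fun o ho => div_pos (ha o ho _) (ha o ho _)
  -- The inequality of arithmetic and geometric means with equal weights; the product over the radii
  -- then telescopes for each `o`.
  have h1 := Real.geom_mean_le_arith_mean_weighted (Finset.range L) (fun _ => (L : ℝ)⁻¹)
    (fun i => ∏ o ∈ O, a o i / a o (i + 1)) (fun _ _ => by positivity)
    (by simp [hL'.ne']) fun i _ => (hpos i).le
  refine le_trans ?_ h1
  rw [Real.finsetProd_rpow _ _ fun i _ => (hpos i).le, Finset.prod_comm]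
  have h2 : ∏ o ∈ O, ∏ i ∈ Finset.range L, a o i / a o (i + 1) = ∏ o ∈ O, a o 0 / a o L := by
    refine Finset.prod_congr rfl fun o ho => ?_
    have : ∀ n, ∏ i ∈ Finset.range n, a o i / a o (i + 1) = a o 0 / a o n := by
      intro n
      induction n with
      | zero => simp [(ha o ho 0).ne']
      | succ n ih =>
        rw [Finset.prod_range_succ, ih, div_mul_div_cancel₀ (ha o ho n).ne']
    exact this L
  rw [h2]
  -- There are at most `m` factors, and `β ≤ 1` lets the exponent be raised to `m`.
  have h3 : β ^ m ≤ ∏ o ∈ O, a o 0 / a o L :=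
    calc β ^ m ≤ β ^ O.card := pow_le_pow_of_le_one hβ.le hβ1 hm
      _ = ∏ o ∈ O, β := by simp
      _ ≤ _ := Finset.prod_le_prod (fun _ _ => hβ.le) h
  calc β ^ ((m : ℝ) / L) = (β ^ m) ^ ((L : ℝ)⁻¹) := by
        rw [div_eq_mul_inv, Real.rpow_mul hβ.le, Real.rpow_natCast]
    _ ≤ _ := Real.rpow_le_rpow (by positivity) h3 (by positivity)

/-- The bounds for the radius in the decomposition. -/
noncomputable def minRadius (m : ℕ) : ℕ := max ⌊1 / (4 * (√(Real.log m) / m))⌋₊ 1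
noncomputable def maxRadius (m : ℕ) : ℕ := ⌊1 / (2 * (√(Real.log m) / m))⌋₊

theorem one_le_minRadius (m : ℕ) : 1 ≤ minRadius m := le_max_right _ _

theorem half_le_sqrt_log {m : ℕ} (hm : 2 ≤ m) : 1 / 2 ≤ √(Real.log m) := by
  refine Real.le_sqrt_of_sq_le ?_
  have h : Real.log 2 ≤ Real.log m := Real.log_le_log (by norm_num) (by exact_mod_cast hm)
  have := Real.log_two_gt_d9
  linarith

theorem two_mul_sqrt_log_le {m : ℕ} (hm : 2 ≤ m) : 2 * √(Real.log m) ≤ m := by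
  have hm' : (2 : ℝ) ≤ m := by exact_mod_cast hm
  have h : √(Real.log m) ≤ m / 2 := by
    refine Real.sqrt_le_iff.2 ⟨by positivity, ?_⟩
    have := Real.log_le_sub_one_of_pos (x := m) (by linarith)
    nlinarith [sq_nonneg ((m : ℝ) - 2)]
  linarith

/-- False for `m = 1`: there the division by zero gives `maxRadius = 0`, while `minRadius = 1`. -/
theorem minRadius_le_maxRadius {m : ℕ} (hm : 2 ≤ m) : minRadius m ≤ maxRadius m := by
  have hs := half_le_sqrt_log hm
  have hs2 := two_mul_sqrt_log_le hm
  have hm' : (0 : ℝ) < m := by positivity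
  refine max_le (Nat.floor_le_floor ?_) ?_
  · gcongr
    norm_num
  · refine Nat.le_floor ?_
    rw [Nat.cast_one, le_div_iff₀ (by positivity), one_mul, ← mul_div_assoc, div_le_one hm']
    exact hs2

theorem maxRadius_le (m : ℕ) : maxRadius m ≤ m := by
  rcases lt_or_ge m 2 with hm | hm
  · have : m = 0 ∨ m = 1 := by omega
    rcases this with rfl | rfl <;> simp [maxRadius]
  · have hs := half_le_sqrt_log hm
    have hm' : (0 : ℝ) < m := by positivity
    refine Nat.floor_le_of_le ?_
    rw [div_le_iff₀ (by positivity)]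
    field_simp
    linarith

/-- Every admissible radius is at most `1 / (2 α)`. -/
theorem two_mul_radius_le {m : ℕ} (hm : 1 ≤ m) {R : ℕ}
    (hR : R ≤ minRadius m + (maxRadius m - minRadius m)) :
    2 * (R : ℝ) * (√(Real.log m) / m) ≤ 1 := by
  rcases Nat.eq_or_lt_of_le hm with rfl | hm
  · simp
  · have hs := half_le_sqrt_log hm
    have hm' : (0 : ℝ) < m := by positivity
    rw [Nat.add_sub_of_le (minRadius_le_maxRadius hm)] at hR
    have h1 : (R : ℝ) ≤ 1 / (2 * (√(Real.log m) / m)) :=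
      le_trans (by exact_mod_cast hR) (Nat.floor_le (by positivity))
    rw [le_div_iff₀ (by positivity)] at h1
    linarith

/-- With s = √(log m) and x = 1/(4α) = m/(4s), the smallest radius is at least x/2 and there are at
least x radii. So β = 1/(8s) works with an exponent of at most 4s, and (8s)^(-4s) has to be compared
with exp(-128 - s²). For `m = 1` one takes β = 1. -/
theorem exists_rpow_bound {m : ℕ} (hm : 1 ≤ m) :
    ∃ β : ℝ, 0 < β ∧ β ≤ 1 ∧ β ≤ minRadius m / m ∧
      Real.exp (-128) / m ≤ β ^ ((m : ℝ) / (maxRadius m - minRadius m + 1 : ℕ)) := by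
  rcases Nat.eq_or_lt_of_le hm with rfl | hm
  · refine ⟨1, one_pos, le_rfl, ?_, ?_⟩
    · simp [minRadius]
    · simp
  · have hs := half_le_sqrt_log hm
    have hs2 : √(Real.log m) ^ 2 = Real.log m :=
      Real.sq_sqrt (Real.log_nonneg (by exact_mod_cast hm.le))
    have hm' : (0 : ℝ) < m := by positivity
    set s := √(Real.log m) with hsdef
    set x : ℝ := 1 / (4 * (s / m)) with hx
    have hxpos : 0 < x := by positivity
    have hxm : x = m / (4 * s) := by rw [hx]; field_simp
    have hmin : x / 2 ≤ minRadius m := by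
      have : (minRadius m : ℝ) = max (⌊x⌋₊ : ℝ) 1 := by simp [minRadius, hx, hsdef]
      rw [this]
      have := Nat.lt_floor_add_one x
      rcases le_total x 2 with h | h
      · exact le_trans (by linarith) (le_max_right _ _)
      · exact le_trans (by linarith) (le_max_left _ _)
    -- The largest radius is the floor of 2x and the smallest is at most max(x, 1). For x ≤ 1 a
    -- single radius already suffices.
    have hL : x ≤ (maxRadius m - minRadius m + 1 : ℕ) := by
      have h1 := minRadius_le_maxRadius hm
      push_cast [Nat.cast_sub h1]
      have h2 : 2 * x < maxRadius m + 1 := by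
        have : 2 * x = 1 / (2 * (s / m)) := by rw [hx]; field_simp; norm_num
        rw [this]
        exact Nat.lt_floor_add_one _
      have h3 : (minRadius m : ℝ) ≤ max x 1 := by
        have : (minRadius m : ℝ) = max (⌊x⌋₊ : ℝ) 1 := by simp [minRadius, hx, hsdef]
        rw [this]
        exact max_le_max_right _ (Nat.floor_le hxpos.le)
      rcases le_total x 1 with h | h
      · rw [max_eq_right h] at h3
        have : (minRadius m : ℝ) ≤ maxRadius m := by exact_mod_cast h1
        linarith
      · rw [max_eq_left h] at h3
        linarith
    refine ⟨1 / (8 * s), by positivity, ?_, ?_, ?_⟩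
    · rw [div_le_one (by positivity)]
      linarith
    · rw [le_div_iff₀ hm']
      refine le_trans (le_of_eq ?_) hmin
      rw [hxm]
      field_simp
      norm_num
    · have h1 : (m : ℝ) / (maxRadius m - minRadius m + 1 : ℕ) ≤ 4 * s := by
        rw [div_le_iff₀ (hxpos.trans_le hL)]
        have : (m : ℝ) = 4 * s * x := by rw [hxm]; field_simp
        rw [this]
        gcongr
      refine le_trans ?_ (Real.rpow_le_rpow_of_exponent_ge (by positivity)
        (by rw [div_le_one (by positivity)]; linarith) h1)
      -- The tangent of the logarithm at 64, together with 6 log 2 ≤ 5.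
      have h2 : Real.log (8 * s) ≤ 4 + s / 8 := by
        have e : 8 * s = 64 * (s / 8) := by ring
        rw [e, Real.log_mul (by norm_num) (by positivity)]
        have e1 := Real.log_le_sub_one_of_pos (x := s / 8) (by positivity)
        have e2 : Real.log 64 = 6 * Real.log 2 := by
          rw [show (64 : ℝ) = 2 ^ (6 : ℕ) by norm_num, Real.log_pow]
          norm_num
        have := Real.log_two_lt_d9
        linarith
      rw [Real.rpow_def_of_pos (by positivity), one_div, Real.log_inv]
      have h3 : Real.exp (-128) / m = Real.exp (-128 - s ^ 2) := by
        rw [Real.exp_sub, hs2, Real.exp_log hm']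
      rw [h3]
      refine Real.exp_le_exp.2 ?_
      -- The claim is 4s(4 + s/8) ≤ 128 + s², which is (s - 16)² ≥ 0. This is where 128 comes from.
      nlinarith [sq_nonneg (s - 16), mul_le_mul_of_nonneg_left h2 (by positivity : 0 ≤ 4 * s)]

/-! ### Uniform draws as finite averages -/

section Uniform

variable {α β : Type}

theorem Rand.prob_uniform_bind {ι : Type} [Fintype ι] [Nonempty ι] (g : ι → Timed α) {x : Rand α}
    (hx : x.law = PMF.map g (PMF.uniformOfFintype ι)) (f : α → Rand β) (p : β → Prop) :
    (x >>= f).prob p = ∑ i, (Fintype.card ι : ℝ≥0∞)⁻¹ * (f (g i).val).prob p := by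
  rw [Rand.prob_eq, Rand.resultLaw_bind]
  have h : x.resultLaw = PMF.map (Timed.val ∘ g) (PMF.uniformOfFintype ι) := by
    rw [Rand.resultLaw, hx, PMF.map_comp]
  rw [h, PMF.bind_map, PMF.toOuterMeasure_bind_apply, tsum_fintype]
  simp only [PMF.uniformOfFintype_apply, Rand.prob_eq, Function.comp]

theorem Rand.prob_lift (x : Timed α) (p : α → Prop) [Decidable (p x.val)] :
    (liftM x : Rand α).prob p = if p x.val then 1 else 0 := by
  rw [Rand.prob_eq, Rand.resultLaw_lift, PMF.toOuterMeasure_pure_apply]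
  simp only [Set.mem_ofPred_eq]
  congr

theorem prob_randomPerm_bind {V : Type} (U : List V) (f : List V → Rand β) (p : β → Prop) :
    (randomPerm U >>= f).prob p = ∑ σ : Equiv.Perm (Fin U.length),
      (Fintype.card (Equiv.Perm (Fin U.length)) : ℝ≥0∞)⁻¹ *
        (f (List.ofFn fun i => U.get (σ i))).prob p :=
  Rand.prob_uniform_bind _ rfl _ _

theorem prob_randomBetween_bind (a b : ℕ) (f : ℕ → Rand β) (p : β → Prop) :
    (randomBetween a b >>= f).prob p =
      ∑ i ∈ Finset.range (b - a + 1), ((b - a + 1 : ℕ) : ℝ≥0∞)⁻¹ * (f (a + i)).prob p := by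
  rw [Finset.sum_range]
  refine (Rand.prob_uniform_bind _ rfl _ _).trans ?_
  simp

end Uniform

/-! ### The success probability of one decomposition -/

section Decomposition

variable {V : Type} [MetricSpace V] {m : ℕ}

open Classical in
/-- The probability of an event for the decomposition, as an average over the radii. -/
theorem prob_decompose [DecidableEq V] (U : List V) (γ : ℝ) (p : List (List V) → Prop) :
    (decompose m U γ).prob p = ∑ i ∈ Finset.range (maxRadius m - minRadius m + 1),
      ((maxRadius m - minRadius m + 1 : ℕ) : ℝ≥0∞)⁻¹ *
        ((Fintype.card (Equiv.Perm (Fin U.length)) : ℝ≥0∞)⁻¹ *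
          (Finset.univ.filter fun σ : Equiv.Perm (Fin U.length) =>
            p (carve (γ * (√(Real.log m) / m)) (minRadius m + i) U
              (List.ofFn fun j => U.get (σ j)) []).val).card) := by
  have h : (decompose m U γ).prob p = ∑ σ : Equiv.Perm (Fin U.length),
      (Fintype.card (Equiv.Perm (Fin U.length)) : ℝ≥0∞)⁻¹ *
      ∑ i ∈ Finset.range (maxRadius m - minRadius m + 1),
        ((maxRadius m - minRadius m + 1 : ℕ) : ℝ≥0∞)⁻¹ *
        if p (carve (γ * (√(Real.log m) / m)) (minRadius m + i) U
              (List.ofFn fun j => U.get (σ j)) []).val then 1 else 0 := by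
    simp only [decompose]
    rw [Rand.prob_lift_bind, prob_randomPerm_bind]
    refine Finset.sum_congr rfl fun σ _ => ?_
    rw [prob_randomBetween_bind]
    simp only [Rand.prob_lift]
    rfl
  rw [h]
  simp only [Finset.mul_sum]
  rw [Finset.sum_comm]
  refine Finset.sum_congr rfl fun i _ => ?_
  rw [Finset.card_filter]
  push_cast
  simp only [Finset.mul_sum]
  refine Finset.sum_congr rfl fun σ _ => ?_
  ring

open Classical in
/-- The positions in `U` of the points at graph distance at most `R` from `v`. -/
noncomputable def ballPositions (θ : ℝ) (U : List V) (R : ℕ) (v : V) : Finset (Fin U.length) :=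
  Finset.univ.filter fun i => Near θ U R v (U.get i)

theorem mem_ballPositions {θ : ℝ} {U : List V} {R : ℕ} {v : V} {i : Fin U.length} :
    i ∈ ballPositions θ U R v ↔ Near θ U R v (U.get i) := by
  simp [ballPositions]

theorem ballPositions_mono {θ : ℝ} {U : List V} {R R' : ℕ} (h : R ≤ R') (v : V) :
    ballPositions θ U R v ⊆ ballPositions θ U R' v := fun i hi => by
  rw [mem_ballPositions] at hi ⊢
  exact hi.mono h

theorem ballPositions_nonempty {θ : ℝ} {U : List V} {v : V} (hv : v ∈ U) (R : ℕ) :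
    (ballPositions θ U R v).Nonempty := by
  obtain ⟨i, hi⟩ := List.get_of_mem hv
  exact ⟨i, mem_ballPositions.2 (hi ▸ Near.refl _ _)⟩

/-- A ball of radius `r` has more than `r` points unless it is a component of the graph. -/
theorem lt_card_ballPositions {θ : ℝ} {U : List V} {v : V} (hv : v ∈ U) (r : ℕ) :
    r < (ballPositions θ U r v).card ∨ ∀ s, ballPositions θ U s v ⊆ ballPositions θ U r v := by
  induction r with
  | zero => exact .inl (Finset.card_pos.2 (ballPositions_nonempty hv 0))
  | succ r ih =>
    rcases ih with ih | ih
    · by_cases h : ballPositions θ U (r + 1) v ⊆ ballPositions θ U r v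
      · right
        intro s i hi
        rw [mem_ballPositions] at hi ⊢
        refine (Near.of_stable (r := r) (fun w hw => ?_) s hi).mono (by omega)
        obtain ⟨j, rfl⟩ := List.get_of_mem (hw.mem hv)
        exact mem_ballPositions.1 (h (mem_ballPositions.2 hw))
      · left
        have := Finset.card_lt_card
          (Finset.ssubset_iff_subset_ne.2 ⟨ballPositions_mono (Nat.le_succ r) v, fun he => h he.ge⟩)
        exact lt_of_le_of_lt (Nat.succ_le_of_lt ih) this
    · exact .inr fun s => (ih s).trans (ballPositions_mono (Nat.le_succ r) v)

/-- A point is clustered if the first point of its ball is not on the boundary of the ball. -/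
theorem exists_mem_carve_of_isFirst [DecidableEq V] {θ : ℝ} {U : List V} {R : ℕ} (hR : 1 ≤ R) {v : V} (hv : v ∈ U)
    {σ : Equiv.Perm (Fin U.length)} {b : Fin U.length} (hb : b ∈ ballPositions θ U (R - 1) v)
    (hfirst : IsFirst σ (ballPositions θ U R v) b) :
    ∃ D ∈ (carve θ R U (List.ofFn fun j => U.get (σ j)) []).val, v ∈ D := by
  set π := List.ofFn fun j => U.get (σ j) with hπ
  have hlen : π.length = U.length := by simp [hπ]
  set p := σ.symm b with hp
  have hp' : (p : ℕ) < π.length := by rw [hlen]; exact p.isLt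
  have hsplit : π = π.take p ++ U.get b :: π.drop (p + 1) := by
    have hb' : π[(p : ℕ)] = U.get b := by simp [hπ, hp]
    rw [← hb', ← List.drop_eq_getElem_cons hp', List.take_append_drop]
  rw [hsplit]
  refine exists_mem_carve hR ?_ (mem_ballPositions.1 hb) hv [] (by simp)
  intro x hx
  obtain ⟨q, hq, rfl⟩ := List.mem_take_iff_getElem.1 hx
  have hqU : q < U.length := by omega
  have he : π[q] = U.get (σ ⟨q, hqU⟩) := by simp [hπ]
  rw [he]
  refine ⟨List.get_mem _ _, fun hn => ?_⟩
  have := hfirst.2 _ (mem_ballPositions.2 hn)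
  rw [Equiv.symm_apply_apply] at this
  have h2 : (p : ℕ) ≤ q := this
  omega

/-- Turns the counting identity of `card_forall_isFirst`, which avoids division, into a lower bound
for the share of good permutations. -/
theorem prod_div_le_of_mul_eq {κ : Type} {O : Finset κ} {f g : κ → ℕ} {n N G : ℕ}
    (hg : ∀ o ∈ O, 0 < g o) (hN : 0 < N) (h : n * ∏ o ∈ O, g o = N * ∏ o ∈ O, f o) (hn : n ≤ G) :
    ∏ o ∈ O, (f o : ℝ) / g o ≤ (N : ℝ)⁻¹ * G := by
  have hB : (0 : ℝ) < ∏ o ∈ O, (g o : ℝ) := Finset.prod_pos fun o ho => by exact_mod_cast hg o ho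
  have hN' : (0 : ℝ) < N := by exact_mod_cast hN
  have h' : (n : ℝ) * ∏ o ∈ O, (g o : ℝ) = N * ∏ o ∈ O, (f o : ℝ) := by exact_mod_cast h
  have hn' : (n : ℝ) ≤ G := by exact_mod_cast hn
  rw [Finset.prod_div_distrib, div_le_iff₀ hB, inv_mul_eq_div, div_mul_eq_mul_div,
    le_div_iff₀ hN', mul_comm _ (N : ℝ), ← h']
  gcongr

/-- The decomposition is good for a well-separated fair set with probability at least `c / m`. -/
theorem Problem.le_prob_decompose [DecidableEq V] (I : Problem V m) (hm : 1 ≤ m) {U : List V} (hU : U.Nodup)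
    {γ : ℝ} (hγ : 0 < γ)
    (hcol : ∀ u ∈ U, ∀ v ∈ U, I.color u = I.color v → u ≠ v → γ ≤ dist u v)
    {O : Finset V} (hO : I.IsFair O) (hOU : ∀ o ∈ O, o ∈ U) (hk : I.k ≤ m)
    (hsep : ∀ o ∈ O, ∀ o' ∈ O, o ≠ o' → γ < dist o o') :
    ENNReal.ofReal (Real.exp (-128) / m) ≤
      (decompose m U γ).prob fun Ds => (I.checkFair (I.flow Ds).val).val = true := by
  classical
  set θ := γ * (√(Real.log m) / m) with hθ
  have hθ0 : 0 ≤ θ := by positivity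
  set L := maxRadius m - minRadius m + 1 with hL
  -- Two points joined by `2R` edges are equal or closer than `γ`. This makes balls disjoint, keeps
  -- the colors in a ball distinct, and separates the points of `O` into different clusters.
  have hrad : ∀ R, R ≤ minRadius m + (maxRadius m - minRadius m) → ∀ u v,
      Near θ U (R + R) u v → u = v ∨ dist u v < γ := by
    intro R hR u v h
    refine h.eq_or_dist_lt.imp_right fun h => h.trans_le ?_
    have := two_mul_radius_le hm hR
    push_cast
    calc ((R : ℝ) + R) * θ = γ * (2 * R * (√(Real.log m) / m)) := by rw [hθ]; ring
      _ ≤ γ * 1 := by gcongr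
      _ = γ := mul_one γ
  -- balls around different points of `O` are disjoint
  have hdisj : ∀ R, R ≤ minRadius m + (maxRadius m - minRadius m) → ∀ o ∈ O, ∀ o' ∈ O, o ≠ o' →
      Disjoint (ballPositions θ U R o) (ballPositions θ U R o') := by
    intro R hR o ho o' ho' hne
    rw [Finset.disjoint_left]
    intro i h1 h2
    rw [mem_ballPositions] at h1 h2
    rcases hrad R hR _ _ (h1.trans (h2.symm (hOU o' ho'))) with h | h
    · exact hne h
    · exact absurd h (not_lt.2 (hsep o ho o' ho' hne).le)
  have hcard : ∀ R, R ≤ minRadius m + (maxRadius m - minRadius m) → ∀ o ∈ O,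
      (ballPositions θ U R o).card ≤ m := by
    intro R hR o ho
    rw [← Fintype.card_fin m, ← Finset.card_univ]
    -- Two points of a ball are closer than `γ`, and points of equal color are not, so the colors
    -- are injective on the ball.
    refine Finset.card_le_card_of_injOn (fun i => I.color (U.get i)) (fun _ _ => by simp) ?_
    intro i hi j hj hij
    rw [Finset.mem_coe, mem_ballPositions] at hi hj
    rcases hrad R hR _ _ ((hi.symm (hOU o ho)).trans hj) with h | h
    · exact hU.injective_get h
    · by_contra hne
      exact absurd h (not_lt.2 (hcol _ (List.get_mem _ _) _ (List.get_mem _ _) hij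
        fun h => hne (hU.injective_get h)))
  -- the probability for a fixed radius
  set good : ℕ → Finset (Equiv.Perm (Fin U.length)) := fun i => Finset.univ.filter fun σ =>
    (I.checkFair (I.flow (carve θ (minRadius m + i) U
      (List.ofFn fun j => U.get (σ j)) []).val).val).val = true with hgood
  have hgoodcard : ∀ i ∈ Finset.range L,
      ∏ o ∈ O, ((ballPositions θ U (minRadius m - 1 + i) o).card : ℝ) /
        (ballPositions θ U (minRadius m - 1 + (i + 1)) o).card ≤
      ((Fintype.card (Equiv.Perm (Fin U.length)) : ℕ) : ℝ)⁻¹ * (good i).card := by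
    intro i hi
    rw [Finset.mem_range, hL] at hi
    have h1m := one_le_minRadius m
    have hR : minRadius m + i ≤ minRadius m + (maxRadius m - minRadius m) := by omega
    have hR1 : 1 ≤ minRadius m + i := by omega
    -- The sequence of ball sizes starts at radius `minRadius m - 1`, so that its `i`-th ratio
    -- compares the balls of radii `R - 1` and `R` for `R = minRadius m + i`.
    have e1 : minRadius m - 1 + i = minRadius m + i - 1 := by omega
    have e2 : minRadius m - 1 + (i + 1) = minRadius m + i := by omega
    rw [e1, e2]
    have hcount := card_forall_isFirst O (fun o => ballPositions θ U (minRadius m + i - 1) o)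
      (fun o => ballPositions θ U (minRadius m + i) o)
      (fun o _ => ballPositions_mono (Nat.sub_le _ _) o)
      (fun o ho => ballPositions_nonempty (hOU o ho) _) (hdisj _ hR)
    have hsub : ∀ σ : Equiv.Perm (Fin U.length), (∀ o ∈ O,
        ∃ b ∈ ballPositions θ U (minRadius m + i - 1) o,
          IsFirst σ (ballPositions θ U (minRadius m + i) o) b) → σ ∈ good i := by
      intro σ hσ
      rw [hgood, Finset.mem_filter]
      refine ⟨Finset.mem_univ _, ?_⟩
      have hex : ∀ o ∈ O, ∃ (n : ℕ) (D : List V), (carve θ (minRadius m + i) U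
          (List.ofFn fun j => U.get (σ j)) []).val[n]? = some D ∧ o ∈ D := by
        intro o ho
        obtain ⟨b, hb, hfirst⟩ := hσ o ho
        obtain ⟨D, hD, hoD⟩ := exists_mem_carve_of_isFirst hR1 (hOU o ho) hb hfirst
        obtain ⟨n, hn⟩ := List.getElem?_of_mem hD
        exact ⟨n, D, hn, hoD⟩
      choose! φ hφ using hex
      refine I.checkFair_flow hO hφ ?_
      intro o ho o' ho' hoo
      obtain ⟨D, hD, hoD⟩ := hφ o ho
      obtain ⟨D', hD', hoD'⟩ := hφ o' ho'
      rw [← hoo] at hD'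
      obtain rfl : D = D' := Option.some.inj (hD.symm.trans hD')
      obtain ⟨c, hc, h⟩ := mem_carve hR1 (List.ofFn fun j => U.get (σ j)) [] (by
        intro x hx
        rw [List.mem_ofFn] at hx
        obtain ⟨j, rfl⟩ := hx
        exact List.get_mem _ _) (List.mem_of_getElem? hD)
      by_contra hne
      rcases hrad _ hR _ _ ((((h o hoD).1.mono (Nat.sub_le _ _)).symm hc).trans
        ((h o' hoD').1.mono (Nat.sub_le _ _))) with h | h
      · exact hne h
      · exact absurd h (not_lt.2 (hsep o ho o' ho' hne).le)
    exact prod_div_le_of_mul_eq (fun o ho => Finset.card_pos.2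
      (ballPositions_nonempty (hOU o ho) _)) Fintype.card_pos hcount (Finset.card_le_card
      fun σ hσ => hsub σ ((@Finset.mem_filter _ _ (_) _ _).1 hσ).2)
  -- the average over the radii
  obtain ⟨β, hβ0, hβ1, hβm, hβ⟩ := exists_rpow_bound hm
  have hm0 : (0 : ℝ) < m := by exact_mod_cast hm
  have hone : ∀ o ∈ O, ∀ r, (0 : ℝ) < (ballPositions θ U r o).card := fun o ho r => by
    exact_mod_cast Finset.card_pos.2 (ballPositions_nonempty (hOU o ho) _)
  have havg := rpow_le_average O (fun o r => ((ballPositions θ U (minRadius m - 1 + r) o).card : ℝ))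
    (fun o ho r => hone o ho _) hβ0 hβ1 (L := L) (m := m) (Nat.succ_pos _) (hO.1 ▸ hk) (by
      intro o ho
      have h1m := one_le_minRadius m
      have hc := hcard (minRadius m - 1 + L) (by omega) o ho
      rw [add_zero]
      -- Either the smallest ball has at least `minRadius m` points, against at most `m` in the
      -- largest one, or it is a whole component and the ratio is one.
      rcases lt_card_ballPositions (θ := θ) (hOU o ho) (minRadius m - 1) with h | h
      · refine hβm.trans ?_
        have h' : minRadius m ≤ (ballPositions θ U (minRadius m - 1) o).card := by omega
        have := hone o ho (minRadius m - 1 + L)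
        gcongr
      · refine hβ1.trans ?_
        rw [one_le_div (hone o ho _)]
        exact_mod_cast Finset.card_le_card (h _))
  rw [prob_decompose]
  refine le_trans (ENNReal.ofReal_le_ofReal (hβ.trans (havg.trans
    (Finset.sum_le_sum fun i hi => mul_le_mul_of_nonneg_left (hgoodcard i hi)
      (by positivity))))) (le_of_eq ?_)
  rw [ENNReal.ofReal_sum_of_nonneg fun _ _ => by positivity]
  refine Finset.sum_congr rfl fun i _ => ?_
  have hN : (0 : ℝ) < (Fintype.card (Equiv.Perm (Fin U.length)) : ℕ) := by
    exact_mod_cast Fintype.card_pos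
  rw [ENNReal.ofReal_mul (by positivity), ENNReal.ofReal_mul (by positivity),
    ENNReal.ofReal_inv_of_pos (by positivity), ENNReal.ofReal_inv_of_pos hN,
    ENNReal.ofReal_natCast, ENNReal.ofReal_natCast, ENNReal.ofReal_natCast]
  congr!

end Decomposition

section Steps

variable {V : Type} {m : ℕ}

/-! ### Step counts: pruning -/

theorem pruneColor_length_le [MetricSpace V] (γ : ℝ) (b : ℕ) (l : List V) :
    (pruneColor γ b l).val.length ≤ l.length := by
  induction b generalizing l with
  | zero => simp [pruneColor]
  | succ b ih =>
    cases l with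
    | nil => simp [pruneColor]
    | cons v l =>
      rw [pruneColor_cons_val]
      simpa using (ih _).trans (List.length_filter_le _ _)

theorem pruneColor_steps_le [MetricSpace V] (γ : ℝ) (b : ℕ) (l : List V) :
    (pruneColor γ b l).steps ≤ l.length * (2 * l.length + 2) + 1 := by
  induction b generalizing l with
  | zero => simp [pruneColor]
  | succ b ih =>
    cases l with
    | nil => simp [pruneColor]
    | cons v l =>
      simp only [pruneColor, Timed.steps_bind, tick_steps, Timed.steps_pure, List.length_cons,
        filterT_val]
      have h1 := filterT_steps_le (fun u => notT (distLT γ u v)) l 1 fun _ _ => by simp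
      set l' := l.filter fun u => (notT (distLT γ u v)).val with hl'
      have h2 := ih l'
      have h3 : l'.length ≤ l.length := List.length_filter_le _ _
      have h4 : l'.length * (2 * l'.length + 2) ≤ l.length * (2 * l.length + 2) := by gcongr
      nlinarith

theorem Problem.pruneColors_steps_le [MetricSpace V] (I : Problem V m) (γ : ℝ) (b : ℕ)
    (pts : List V) (is : List (Fin m)) : (I.pruneColors γ b pts is).steps ≤
      is.length * (2 * pts.length ^ 2 + 5 * pts.length + 4) + 1 := by
  induction is with
  | nil => simp [Problem.pruneColors]
  | cons i is ih =>
    simp only [Problem.pruneColors, Timed.steps_bind, tick_steps, List.length_cons,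
      filterT_val, appendT_steps]
    have h1 := filterT_steps_le (I.hasColor i) pts 1 fun _ _ => by simp
    set l' := pts.filter fun u => (I.hasColor i u).val with hl'
    have h2 := pruneColor_steps_le γ b l'
    have h3 : l'.length ≤ pts.length := List.length_filter_le _ _
    have h4 : l'.length * (2 * l'.length + 2) ≤ pts.length * (2 * pts.length + 2) := by gcongr
    have h5 := pruneColor_length_le γ b l'
    nlinarith

/-! ### Step counts: decomposition -/

theorem bfs_length_le [MetricSpace V] (θ : ℝ) (r t : ℕ) (front unseen : List V) :
    (bfs θ r t front unseen).val.length ≤ front.length + unseen.length := by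
  induction r generalizing t front unseen with
  | zero => simp [bfs]
  | succ r ih =>
    simp only [bfs, Timed.val_bind, appendT_val, List.length_append, mapT_val, List.length_map,
      filterT_val, notT_val]
    refine Nat.add_le_add_left ((ih _ _ _).trans ?_) _
    rw [List.length_eq_length_filter_add (l := unseen)
      fun u => (anyT (distLT θ u) front).val]

/-- `K` survives the recursion because the next layer and the rest partition `unseen`. -/
theorem bfs_steps_le [MetricSpace V] (θ : ℝ) (r t : ℕ) (front unseen : List V) (K : ℕ)
    (hK : front.length + unseen.length ≤ K) :
    (bfs θ r t front unseen).steps ≤ (r + 1) * (4 * K ^ 2 + 7 * K + 5) := by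
  have hm := mapT_steps_le (fun v : V => (do tick; return (v, t) : Timed (V × ℕ))) front 1
    fun _ _ => by simp
  induction r generalizing t front unseen with
  | zero =>
    simp only [bfs, Timed.steps_bind, tick_steps]
    nlinarith
  | succ r ih =>
    simp only [bfs, Timed.steps_bind, tick_steps, Timed.val_bind, filterT_val, mapT_val,
      appendT_steps, List.length_map]
    have ha : ∀ u, (anyT (distLT θ u) front).steps ≤ 2 * front.length + 1 := fun u =>
      (anyT_steps_le (distLT θ u) front 1 fun _ _ => by simp).trans (by omega)
    have h1 := filterT_steps_le (fun u => anyT (distLT θ u) front) unseen _ fun u _ => ha u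
    have h2 := filterT_steps_le (fun u => notT (anyT (distLT θ u) front)) unseen _ fun u _ => ha u
    have h3 := ih (t + 1) (unseen.filter fun u => (anyT (distLT θ u) front).val)
      (unseen.filter fun u => (notT (anyT (distLT θ u) front)).val) (by
        have := List.length_eq_length_filter_add (l := unseen)
          fun u => (anyT (distLT θ u) front).val
        simp only [notT_val]
        omega) (mapT_steps_le _ _ 1 fun _ _ => by simp)
    have h4 : unseen.length * (2 * front.length + 1 + 1) ≤ K * (2 * K + 1 + 1) := by
      gcongr <;> omega
    nlinarith

variable [MetricSpace V] [DecidableEq V]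

theorem ball_length_le (θ : ℝ) (R : ℕ) (U : List V) (c : V) :
    (ball θ R U c).val.length ≤ U.length + 1 := by
  simp only [ball, Timed.val_bind, filterT_val]
  refine (bfs_length_le _ _ _ _ _).trans ?_
  rw [List.length_singleton, add_comm]
  gcongr
  exact List.length_filter_le _ _

theorem ball_steps_le (θ : ℝ) (R : ℕ) (U : List V) (c : V) :
    (ball θ R U c).steps ≤ 2 * U.length + 1 +
      (R + 1) * (4 * (U.length + 1) ^ 2 + 7 * (U.length + 1) + 5) := by
  simp only [ball, Timed.steps_bind, filterT_val]
  have h1 := filterT_steps_le (fun u => notT (eqT u c)) U 1 fun _ _ => by simp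
  have h2 := bfs_steps_le θ R 0 [c] (U.filter fun u => (notT (eqT u c)).val) (U.length + 1) (by
    have := List.length_filter_le (fun u => (notT (eqT u c)).val) U
    simp only [List.length_singleton]
    omega)
  omega

theorem carve_length (θ : ℝ) (R : ℕ) (U cs Z : List V) :
    (carve θ R U cs Z).val.length = cs.length := by
  induction cs generalizing Z with
  | nil => simp [carve]
  | cons c cs ih => rw [carve_cons_val]; simp [ih]

theorem length_le_of_mem_carve (θ : ℝ) (R : ℕ) (U cs Z : List V) :
    ∀ D ∈ (carve θ R U cs Z).val, D.length ≤ U.length + 1 := by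
  induction cs generalizing Z with
  | nil => simp [carve]
  | cons c cs ih =>
    rw [carve_cons_val, List.forall_mem_cons]
    refine ⟨?_, ih _⟩
    rw [core, List.length_map]
    exact (List.length_filter_le _ _).trans ((List.length_filter_le _ _).trans
      (ball_length_le θ R U c))

/-- `u` bounds the size of every ball and `z` the length of `Z` at all times: each remaining center
adds at most `u` entries, which `hz` has already paid for. -/
theorem carve_steps_le (θ : ℝ) (R : ℕ) (U cs Z : List V) (u z : ℕ) (hu : U.length + 1 ≤ u)
    (hz : Z.length + cs.length * u ≤ z) :
    (carve θ R U cs Z).steps ≤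
      cs.length * ((R + 1) * (4 * u ^ 2 + 7 * u + 5) + u * (2 * z + 11) + 7) + 1 := by
  induction cs generalizing Z with
  | nil => simp [carve]
  | cons c cs ih =>
    simp only [carve, Timed.steps_bind, tick_steps, Timed.val_bind, filterT_val, mapT_val,
      appendT_steps, appendT_val, List.length_map, Timed.steps_pure, List.length_cons,
      Timed.val_pure]
    set B := (ball θ R U c).val with hB
    set C := B.filter fun q => (notT (anyT (eqT q.1) Z)).val with hC
    have hBl : B.length ≤ u := (ball_length_le θ R U c).trans hu
    have hCl : C.length ≤ u := (List.length_filter_le _ _).trans hBl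
    have h1 := ball_steps_le θ R U c
    have h1' : (R + 1) * (4 * (U.length + 1) ^ 2 + 7 * (U.length + 1) + 5) ≤
        (R + 1) * (4 * u ^ 2 + 7 * u + 5) := by gcongr
    have h2 := filterT_steps_le (fun q : V × ℕ => notT (anyT (eqT q.1) Z)) B (2 * Z.length + 1)
      fun q _ => (anyT_steps_le (eqT q.1) Z 1 fun _ _ => by simp).trans (by omega)
    have hcu : (cs.length + 1) * u = cs.length * u + u := by ring
    have h2' : B.length * (2 * Z.length + 1 + 1) ≤ u * (2 * z + 2) := by
      refine Nat.mul_le_mul hBl ?_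
      rw [List.length_cons, hcu] at hz
      omega
    have h3 := mapT_steps_le (fun q : V × ℕ => (do tick; return q.1 : Timed V)) C 1
      fun _ _ => by simp
    have h4 := filterT_steps_le (fun q : V × ℕ => (do tick; return decide (q.2 < R) : Timed Bool))
      C 1 fun _ _ => by simp
    have h5 := mapT_steps_le (fun q : V × ℕ => (do tick; return q.1 : Timed V))
      (C.filter fun q => decide (q.2 < R)) 1 fun _ _ => by simp
    have h5' : (C.filter fun q => decide (q.2 < R)).length ≤ u :=
      (List.length_filter_le _ _).trans hCl
    have h6 := ih (List.map (fun q => q.1) C ++ Z) (by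
      rw [List.length_append, List.length_map]
      rw [List.length_cons, hcu] at hz
      omega)
    nlinarith

end Steps

section FlowSteps

variable {V : Type} {m : ℕ}

/-! ### Step counts: flow -/

theorem Problem.addMembers_steps (I : Problem V m) (i : ℕ) (D : List V) (r : Capacity m) :
    (I.addMembers i D r).steps = 2 * D.length + 1 := by
  induction D generalizing r with
  | nil => simp [Problem.addMembers]
  | cons u D ih => simp [Problem.addMembers, ih]; omega

theorem Problem.addClusters_steps_le (I : Problem V m) (i : ℕ) (Ds : List (List V))
    (r : Capacity m) (d : ℕ) (hd : ∀ D ∈ Ds, D.length ≤ d) :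
    (I.addClusters i Ds r).steps ≤ Ds.length * (2 * d + 3) + 1 := by
  induction Ds generalizing i r with
  | nil => simp [Problem.addClusters]
  | cons D Ds ih =>
    simp only [Problem.addClusters, Timed.steps_bind, tick_steps, I.addMembers_steps,
      setCap_steps, List.length_cons]
    have h1 := hd D (by simp)
    have h2 := ih (i + 1) (I.addMembers i D (setCap r .source (.cluster i) 1).val).val
      fun D hD => hd D (by simp [hD])
    nlinarith

theorem Problem.addColors_steps (I : Problem V m) (js : List (Fin m)) (r : Capacity m) :
    (I.addColors js r).steps = 3 * js.length + 1 := by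
  induction js generalizing r with
  | nil => simp [Problem.addColors]
  | cons j js ih => simp [Problem.addColors, ih]; omega

theorem Problem.sumLower_steps (I : Problem V m) (js : List (Fin m)) :
    (I.sumLower js).steps = js.length + 1 := by
  induction js with
  | nil => simp [Problem.sumLower]
  | cons j js ih => simp [Problem.sumLower, ih]; omega

theorem Problem.network_steps_le (I : Problem V m) (Ds : List (List V)) (d : ℕ)
    (hd : ∀ D ∈ Ds, D.length ≤ d) :
    (I.network Ds).steps ≤ Ds.length * (2 * d + 3) + 4 * m + 4 := by
  simp only [Problem.network, Timed.steps_bind, I.addColors_steps, I.sumLower_steps,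
    setCap_steps, List.length_finRange]
  have := I.addClusters_steps_le 0 Ds (fun _ _ => 0) d hd
  omega

theorem clusterNodes_steps (i : ℕ) (Ds : List (List V)) :
    (clusterNodes m i Ds).steps = Ds.length + 1 := by
  induction Ds generalizing i with
  | nil => simp [clusterNodes]
  | cons D Ds ih => simp [clusterNodes, ih]; omega

theorem innerNodes_steps_le (Ds : List (List V)) :
    (innerNodes m Ds).steps ≤ 2 * Ds.length + 3 * m + 4 := by
  have h := mapT_steps_le (fun j : Fin m => (do tick; return Node.color j : Timed (Node m)))
    (List.finRange m) 1 fun _ _ => by simp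
  simp only [List.length_finRange] at h
  simp only [innerNodes, Timed.steps_bind, clusterNodes_steps, appendT_steps, mapT_val,
    List.length_map, List.length_finRange, clusterNodes_val, List.length_range']
  omega

theorem innerNodes_length (Ds : List (List V)) :
    (innerNodes m Ds).val.length = Ds.length + m + 2 := by
  simp [innerNodes_val]
  omega

theorem extendTo_steps_le (r : Capacity m) (w : Node m) (ps : List (List (Node m))) :
    (extendTo r w ps).steps ≤ ps.length + 1 := by
  induction ps with
  | nil => simp [extendTo]
  | cons p ps ih =>
    rcases p with _ | ⟨a, p⟩
    · simp only [extendTo, Timed.steps_bind, tick_steps, List.length_cons]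
      omega
    · simp only [extendTo, Timed.steps_bind, tick_steps, List.length_cons]
      split_ifs
      · simp only [Timed.steps_pure]
        omega
      · omega

theorem nextLayer_steps_le (r : Capacity m) (ps : List (List (Node m))) (ws : List (Node m)) :
    (nextLayer r ps ws).steps ≤ ws.length * (ps.length + 2) + 1 := by
  induction ws with
  | nil => simp [nextLayer]
  | cons w ws ih =>
    simp only [nextLayer, Timed.steps_bind, tick_steps, List.length_cons]
    have h := extendTo_steps_le r w ps
    cases (extendTo r w ps).val <;> simp only [Timed.steps_pure] <;> nlinarith

theorem findSink_steps_le (ps : List (List (Node m))) :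
    (findSink ps).steps ≤ ps.length + 1 := by
  induction ps with
  | nil => simp [findSink]
  | cons p ps ih =>
    simp only [findSink, Timed.steps_bind, tick_steps, List.length_cons]
    split_ifs
    · simp only [Timed.steps_pure]
      omega
    · omega

theorem findPath_steps_le (r : Capacity m) (f : ℕ) (ps : List (List (Node m)))
    (ws : List (Node m)) (P : ℕ) (hps : ps.length ≤ P) (hws : ws.length ≤ P) :
    (findPath r f ps ws).steps ≤ f * (P ^ 2 + 3 * P + 3) + 1 := by
  induction f generalizing ps ws with
  | zero => simp [findPath]
  | succ f ih =>
    simp only [findPath, Timed.steps_bind, tick_steps]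
    have h1 := nextLayer_steps_le r ps ws
    have h2 := findSink_steps_le (nextLayer r ps ws).val.1
    have h3 := nextLayer_length r ps ws
    have h4 : ws.length * (ps.length + 2) ≤ P * (P + 2) := by gcongr
    cases (findSink (nextLayer r ps ws).val.1).val with
    | some p =>
      simp only [Timed.steps_pure]
      nlinarith
    | none =>
      have h5 := ih (nextLayer r ps ws).val.1 (nextLayer r ps ws).val.2 (by omega) (by omega)
      simp only
      nlinarith

/-- A path gains one node per layer; this bounds the cost of an augmentation. -/
theorem findPath_length_le {r : Capacity m} {f : ℕ} {ps : List (List (Node m))}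
    {ws : List (Node m)} {ℓ : ℕ} (hps : ∀ p ∈ ps, p.length ≤ ℓ) {q : List (Node m)}
    (hq : (findPath r f ps ws).val = some q) : q.length ≤ ℓ + f := by
  induction f generalizing ps ws ℓ with
  | zero => simp [findPath] at hq
  | succ f ih =>
    have hlen : ∀ p ∈ (nextLayer r ps ws).val.1, p.length ≤ ℓ + 1 := by
      intro p hp
      obtain ⟨w, a, p, -, hp', -, rfl, -⟩ := mem_nextLayer_fst hp
      have := hps _ hp'
      simp only [List.length_cons] at this ⊢
      omega
    simp only [findPath, Timed.val_bind] at hq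
    cases hs : (findSink (nextLayer r ps ws).val.1).val with
    | some p =>
      simp only [hs, Timed.val_pure, Option.some.injEq] at hq
      subst hq
      have := hlen _ (findSink_eq_some hs).1
      omega
    | none =>
      simp only [hs] at hq
      have := ih hlen hq
      omega

theorem augment_steps_le (p : List (Node m)) (r : Capacity m) :
    (augment p r).steps ≤ 3 * p.length + 1 := by
  induction p generalizing r with
  | nil => simp [augment]
  | cons b p ih =>
    cases p with
    | nil => simp [augment]
    | cons a p =>
      have := ih (setCap (setCap r a b (r a b - 1)).val b a
        ((setCap r a b (r a b - 1)).val b a + 1)).val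
      simp only [augment, Timed.steps_bind, tick_steps, setCap_steps, List.length_cons] at this ⊢
      omega

theorem maxFlow_steps_le (nodes : List (Node m)) (f : ℕ) (r : Capacity m) (w : ℕ)
    (hw : nodes.length ≤ w) (hw1 : 1 ≤ w) :
    (maxFlow nodes nodes.length f r).steps ≤ f * (w * (w ^ 2 + 3 * w + 6) + 6) + 1 := by
  induction f generalizing r with
  | zero => simp [maxFlow]
  | succ f ih =>
    simp only [maxFlow, Timed.steps_bind, tick_steps]
    have h1 := findPath_steps_le r nodes.length [[.source]] nodes w (by simpa using hw1) hw
    have h1' : nodes.length * (w ^ 2 + 3 * w + 3) ≤ w * (w ^ 2 + 3 * w + 3) := by gcongr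
    cases hp : (findPath r nodes.length [[.source]] nodes).val with
    | none =>
      simp only [Timed.steps_pure]
      nlinarith
    | some p =>
      simp only [Timed.steps_bind]
      have h2 := augment_steps_le p r
      have h3 := findPath_length_le (ℓ := 1) (by simp) hp
      have h4 := ih (augment p r).val
      nlinarith

theorem Problem.pick_steps_le (I : Problem V m) (r : Capacity m) (i : ℕ) (D : List V) :
    (I.pick r i D).steps ≤ D.length + 1 := by
  induction D with
  | nil => simp [Problem.pick]
  | cons u D ih =>
    simp only [Problem.pick, Timed.steps_bind, tick_steps, List.length_cons]
    split_ifs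
    · simp only [Timed.steps_pure]
      omega
    · omega

theorem Problem.extract_steps_le (I : Problem V m) (r : Capacity m) (i : ℕ) (Ds : List (List V))
    (d : ℕ) (hd : ∀ D ∈ Ds, D.length ≤ d) :
    (I.extract r i Ds).steps ≤ Ds.length * (d + 2) + 1 := by
  induction Ds generalizing i with
  | nil => simp [Problem.extract]
  | cons D Ds ih =>
    simp only [Problem.extract, Timed.steps_bind, tick_steps, List.length_cons]
    have h1 := hd D (by simp)
    have h2 := ih (i + 1) fun D hD => hd D (by simp [hD])
    have h3 := I.pick_steps_le r i D
    cases (I.pick r i D).val <;> simp only [Timed.steps_pure] <;> nlinarith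

theorem Problem.extract_length_le (I : Problem V m) (r : Capacity m) (i : ℕ)
    (Ds : List (List V)) : (I.extract r i Ds).val.length ≤ Ds.length := by
  induction Ds generalizing i with
  | nil => simp [Problem.extract]
  | cons D Ds ih =>
    rw [I.extract_cons_val, List.length_append, List.length_cons]
    have h1 := ih (i + 1)
    have h2 : (I.pick r i D).val.toList.length ≤ 1 := by cases (I.pick r i D).val <;> simp
    omega

theorem Problem.flow_length_le (I : Problem V m) (Ds : List (List V)) :
    (I.flow Ds).val.length ≤ Ds.length :=
  I.extract_length_le _ _ _

theorem Problem.flow_steps_le (I : Problem V m) (Ds : List (List V)) (d : ℕ)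
    (hd : ∀ D ∈ Ds, D.length ≤ d) (w : ℕ) (hw : Ds.length + m + 2 ≤ w) :
    (I.flow Ds).steps ≤ w * (w * (w ^ 2 + 3 * w + 6) + 3 * d + 25) := by
  simp only [Problem.flow, Timed.steps_bind, lengthT_steps, lengthT_val]
  have h1 := I.network_steps_le Ds d hd
  have h2 := innerNodes_steps_le (m := m) Ds
  have h3 := innerNodes_length (m := m) Ds
  have h4 := maxFlow_steps_le (innerNodes m Ds).val Ds.length (I.network Ds).val w (by omega)
    (by omega)
  have h5 := I.extract_steps_le (maxFlow (innerNodes m Ds).val (innerNodes m Ds).val.length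
    Ds.length (I.network Ds).val).val 0 Ds d hd
  have h6 : Ds.length * (w * (w ^ 2 + 3 * w + 6) + 6) ≤ w * (w * (w ^ 2 + 3 * w + 6) + 6) := by
    gcongr
    omega
  have h7 : Ds.length * (2 * d + 3) ≤ w * (2 * d + 3) := by
    gcongr
    omega
  have h8 : Ds.length * (d + 2) ≤ w * (d + 2) := by
    gcongr
    omega
  nlinarith

theorem Problem.checkFair_steps_le (I : Problem V m) (S : List V) :
    (I.checkFair S).steps ≤ S.length + 1 + (m * (3 * S.length + 4) + 1) := by
  simp only [Problem.checkFair, Timed.steps_bind, lengthT_steps]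
  split_ifs
  · gcongr
    refine (allT_steps_le _ _ (3 * S.length + 3) fun i _ => ?_).trans ?_
    · simp only [Timed.steps_bind, tick_steps, Timed.steps_pure, filterT_val, lengthT_steps]
      have h1 := filterT_steps_le (I.hasColor i) S 1 fun _ _ => by simp
      have h2 := List.length_filter_le (fun u => (I.hasColor i u).val) S
      omega
    · rw [List.length_finRange]
  · simp

end FlowSteps

/-! ### Guarantees for the main algorithm -/

section Main

theorem ensures_randomPerm {V : Type} (U : List V) :
    (randomPerm U).Ensures (fun π => π.length = U.length ∧ π ⊆ U) (U.length + 1) := by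
  intro a ha
  obtain ⟨σ, -, rfl⟩ := (PMF.mem_support_map_iff _ _ _).1 ha
  refine ⟨⟨by simp, fun x hx => ?_⟩, le_rfl⟩
  obtain ⟨i, rfl⟩ := List.mem_ofFn.1 hx
  exact List.get_mem _ _

theorem ensures_randomBetween (a b : ℕ) :
    (randomBetween a b).Ensures (fun R => a ≤ R ∧ R ≤ a + (b - a)) 1 := by
  intro x hx
  obtain ⟨i, -, rfl⟩ := (PMF.mem_support_map_iff _ _ _).1 hx
  have := i.isLt
  exact ⟨⟨by simp, by simp; omega⟩, le_rfl⟩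

variable {V : Type} [MetricSpace V] {m : ℕ}

/-- The points are distinct and have mutual distances at least `θ`. -/
def Separated (θ : ℝ) (S : List V) : Prop := S.Pairwise fun u v => u ≠ v ∧ θ ≤ dist u v

theorem Separated.nodup {θ : ℝ} {S : List V} (h : Separated θ S) : S.Nodup := h.imp And.left

theorem Separated.length_le [Fintype V] {θ : ℝ} {S : List V} (h : Separated θ S) :
    S.length ≤ Fintype.card V := h.nodup.length_le_card

theorem Separated.le_diversity [DecidableEq V] {θ : ℝ} {S : List V} (h : Separated θ S) :
    ENNReal.ofReal θ ≤ diversity S.toFinset := by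
  rw [diversity, Set.le_einfsep_iff]
  intro x hx y hy hxy
  rw [edist_dist]
  refine ENNReal.ofReal_le_ofReal ?_
  have : Std.Symm fun u v : V => u ≠ v ∧ θ ≤ dist u v :=
    ⟨fun x y h => ⟨h.1.symm, by rw [dist_comm]; exact h.2⟩⟩
  exact (h.forall (by simpa using hx) (by simpa using hy) hxy).2

theorem Problem.isFair_toFinset {V : Type} [DecidableEq V] {I : Problem V m} {S : List V}
    (hS : S.Nodup) (h : (I.checkFair S).val = true) : I.IsFair S.toFinset := by
  rw [I.checkFair_eq_true] at h
  refine ⟨by rw [List.toFinset_card_of_nodup hS, h.1], fun i => ?_⟩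
  have : (S.toFinset.filter fun v => I.color v = i).card =
      (S.filter fun u => decide (I.color u = i)).length := by
    have he : (S.toFinset.filter fun v => I.color v = i) =
        (S.filter fun u => decide (I.color u = i)).toFinset := by
      ext
      simp
    rw [he, List.toFinset_card_of_nodup (hS.filter _)]
  rw [this]
  exact h.2 i

/-- The threshold for the edges of the graph. -/
noncomputable def edgeBound (m : ℕ) (γ : ℝ) : ℝ := γ * (√(Real.log m) / m)

theorem edgeBound_mono (m : ℕ) {γ γ' : ℝ} (h : γ ≤ γ') : edgeBound m γ ≤ edgeBound m γ' :=
  mul_le_mul_of_nonneg_right h (by positivity)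

/-- Sizes and separation of the cores hold for every draw, so they are kept as a sure postcondition
next to the step count. -/
theorem ensures_decompose [DecidableEq V] (U : List V) (γ : ℝ) {M : ℕ} (hM : U.length + m + 1 ≤ M) :
    (decompose m U γ).Ensures (fun Ds => Ds.length = U.length ∧
      (∀ D ∈ Ds, D.length ≤ U.length + 1) ∧
      Ds.Pairwise fun D D' => ∀ u ∈ D, ∀ v ∈ D', u ≠ v ∧ edgeBound m γ ≤ dist u v)
      (57 * M ^ 4) := by
  have h : (decompose m U γ).Ensures (fun Ds => Ds.length = U.length ∧
      (∀ D ∈ Ds, D.length ≤ U.length + 1) ∧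
      Ds.Pairwise fun D D' => ∀ u ∈ D, ∀ v ∈ D', u ≠ v ∧ edgeBound m γ ≤ dist u v)
      (2 * (m + 1) + ((U.length + 1) + (1 +
        (M * ((M + 1) * (4 * M ^ 2 + 7 * M + 5) + M * (2 * M ^ 2 + 11) + 7) + 1)))) := by
    refine Rand.Ensures.lift_bind le_rfl ((ensures_randomPerm U).bind fun π hπ =>
      (ensures_randomBetween (minRadius m) (maxRadius m)).bind fun R hR => ?_)
    have h1 := one_le_minRadius m
    have hR1 : 1 ≤ R := h1.trans hR.1
    have hRM : R ≤ M := by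
      have h2 := maxRadius_le m
      -- For `m < 2` the upper radius bound is below the lower one, and the draw is always `1`.
      rcases Nat.lt_or_ge m 2 with hm | hm
      · have h3 : minRadius m = 1 := by
          have : m = 0 ∨ m = 1 := by omega
          rcases this with rfl | rfl <;> simp [minRadius]
        omega
      · have h3 := minRadius_le_maxRadius hm
        omega
    refine Rand.ensures_lift ?_ ⟨by rw [carve_length]; exact hπ.1,
      length_le_of_mem_carve _ _ _ _ _, carve_pairwise hR1 π [] hπ.2⟩
    refine (carve_steps_le _ R U π [] M (M ^ 2) (by omega) ?_).trans ?_
    · rw [hπ.1, List.length_nil, zero_add, sq]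
      gcongr
      omega
    · rw [hπ.1]
      gcongr
      omega
  refine h.mono (fun _ h => h) ?_
  have hM1 : 1 ≤ M := by omega
  have p0 : 1 ≤ M ^ 4 := Nat.one_le_pow _ _ hM1
  have p1 : M ≤ M ^ 4 := Nat.le_self_pow (by norm_num) M
  have p2 : M ^ 2 ≤ M ^ 4 := Nat.pow_le_pow_right hM1 (by norm_num)
  have p3 : M ^ 3 ≤ M ^ 4 := Nat.pow_le_pow_right hM1 (by norm_num)
  have e : M * ((M + 1) * (4 * M ^ 2 + 7 * M + 5) + M * (2 * M ^ 2 + 11) + 7) =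
      6 * M ^ 4 + 11 * M ^ 3 + 23 * M ^ 2 + 12 * M := by ring
  rw [e]
  omega

theorem Problem.flow_separated (I : Problem V m) {γ : ℝ} {Ds : List (List V)}
    (h : Ds.Pairwise fun D D' => ∀ u ∈ D, ∀ v ∈ D', u ≠ v ∧ edgeBound m γ ≤ dist u v) :
    Separated (edgeBound m γ) (I.flow Ds).val :=
  I.flow_pairwise h

theorem Problem.checkFair_steps_le_of_length {V : Type} (I : Problem V m) {S : List V} {M : ℕ}
    (hM : S.length + m + 1 ≤ M) : (I.checkFair S).steps ≤ 9 * M ^ 2 := by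
  refine (I.checkFair_steps_le S).trans ?_
  have hM1 : 1 ≤ M := by omega
  have h1 : m * (3 * S.length + 4) ≤ M * (3 * M + 4) := by
    gcongr <;> omega
  nlinarith

/-- A round costs 57 + 120 + 9 + 1 = 187 units of `M ^ 4`: decomposition, flow, fairness check and
the loop step. -/
theorem Problem.ensures_repeatUntilFair [DecidableEq V] (I : Problem V m) (U : List V) (γ : ℝ) {M : ℕ}
    (hM : U.length + m + 1 ≤ M) (t : ℕ) (S : List V) (hS : Separated (edgeBound m γ) S) :
    (I.repeatUntilFair U γ t S).Ensures (Separated (edgeBound m γ)) (t * (187 * M ^ 4) + 1) := by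
  have hM1 : 1 ≤ M := by omega
  have p0 : 1 ≤ M ^ 4 := Nat.one_le_pow _ _ hM1
  have p1 : M ≤ M ^ 4 := Nat.le_self_pow (by norm_num) M
  have p2 : M ^ 2 ≤ M ^ 4 := Nat.pow_le_pow_right hM1 (by norm_num)
  have p3 : M ^ 3 ≤ M ^ 4 := Nat.pow_le_pow_right hM1 (by norm_num)
  induction t generalizing S with
  | zero =>
    have h : (I.repeatUntilFair U γ 0 S).Ensures (Separated (edgeBound m γ)) (1 + 0) := by
      rw [Problem.repeatUntilFair]
      exact Rand.Ensures.lift_bind le_rfl (Rand.ensures_pure hS)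
    simpa using h
  | succ t ih =>
    have h : ∀ Ds : List (List V), (Ds.length = U.length ∧
        (∀ D ∈ Ds, D.length ≤ U.length + 1) ∧
        Ds.Pairwise fun D D' => ∀ u ∈ D, ∀ v ∈ D', u ≠ v ∧ edgeBound m γ ≤ dist u v) →
        (I.flow Ds).steps ≤ 120 * M ^ 4 ∧ (I.checkFair (I.flow Ds).val).steps ≤ 9 * M ^ 4 ∧
        Separated (edgeBound m γ) (I.flow Ds).val := by
      rintro Ds ⟨h1, h2, h3⟩
      refine ⟨(I.flow_steps_le Ds M (fun D hD => (h2 D hD).trans (by omega)) (2 * M)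
        (by omega)).trans ?_, (I.checkFair_steps_le_of_length (M := M) ?_).trans (by omega),
        I.flow_separated h3⟩
      · have e : 2 * M * (2 * M * ((2 * M) ^ 2 + 3 * (2 * M) + 6) + 3 * M + 25) =
          16 * M ^ 4 + 24 * M ^ 3 + 30 * M ^ 2 + 50 * M := by ring
        rw [e]
        omega
      · have := I.flow_length_le Ds
        omega
    have h' : (I.repeatUntilFair U γ (t + 1) S).Ensures (Separated (edgeBound m γ))
        (1 + (57 * M ^ 4 + (120 * M ^ 4 + (9 * M ^ 4 + (t * (187 * M ^ 4) + 1))))) := by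
      rw [Problem.repeatUntilFair]
      refine Rand.Ensures.lift_bind le_rfl ((ensures_decompose U γ hM).bind
        fun Ds hDs => Rand.Ensures.lift_bind (h Ds hDs).1
          (Rand.Ensures.lift_bind (h Ds hDs).2.1 ?_))
      split_ifs
      · exact (Rand.ensures_pure (h Ds hDs).2.2).mono (fun _ h => h) (by omega)
      · exact ih _ (h Ds hDs).2.2
    refine h'.mono (fun _ h => h) ?_
    have e : (t + 1) * (187 * M ^ 4) = t * (187 * M ^ 4) + 187 * M ^ 4 := by ring
    rw [e]
    omega

theorem Problem.prune_length_le [Fintype V] (I : Problem V m) {γ : ℝ} (hγ : 0 < γ) (b : ℕ) (pts : List V) :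
    (I.prune γ b pts).val.length ≤ Fintype.card V :=
  (I.prune_nodup hγ b pts).length_le_card

theorem Problem.ensures_mainAlgorithm [Fintype V] [DecidableEq V] (I : Problem V m) {pts : List V} (hpts : pts.Nodup) {γ : ℝ}
    (hγ : 0 < γ) (b T : ℕ) {M : ℕ} (hM : M = Fintype.card V + m + 1) :
    (I.mainAlgorithm pts γ γ b T).Ensures (Separated (edgeBound m γ))
      (200 * M ^ 5 * (T + 1)) := by
  have hn : pts.length ≤ Fintype.card V := hpts.length_le_card
  have hM1 : 1 ≤ M := by omega
  have p0 : 1 ≤ M ^ 5 := Nat.one_le_pow _ _ hM1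
  have p1 : M ≤ M ^ 5 := Nat.le_self_pow (by norm_num) M
  have p2 : M ^ 2 ≤ M ^ 5 := Nat.pow_le_pow_right hM1 (by norm_num)
  have p3 : M ^ 3 ≤ M ^ 5 := Nat.pow_le_pow_right hM1 (by norm_num)
  have h1 : (I.prune γ b pts).steps ≤ M * (2 * M ^ 2 + 5 * M + 4) + 1 := by
    refine (I.pruneColors_steps_le γ b pts _).trans ?_
    rw [List.length_finRange]
    gcongr <;> omega
  have h2 := I.prune_length_le hγ b pts
  have h3 := I.ensures_repeatUntilFair (I.prune γ b pts).val γ (M := M) (by omega) (T * m) []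
    List.Pairwise.nil
  refine (Rand.Ensures.lift_bind h1 h3).mono (fun _ h => h) ?_
  have e : T * m * (187 * M ^ 4) ≤ T * M * (187 * M ^ 4) := by
    gcongr
    omega
  have e2 : T * M * (187 * M ^ 4) = 187 * (M ^ 5 * T) := by ring
  have e3 : 200 * M ^ 5 * (T + 1) = 200 * (M ^ 5 * T) + 200 * M ^ 5 := by ring
  have e4 : M * (2 * M ^ 2 + 5 * M + 4) = 2 * M ^ 3 + 5 * M ^ 2 + 4 * M := by ring
  rw [e3, e4]
  omega

/-! ### The success probability of the main algorithm -/

/-- Every round uses fresh randomness on the same `U`. A success ends the loop, so the failure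
probabilities multiply. -/
theorem Problem.prob_repeatUntilFair_not [DecidableEq V] (I : Problem V m) (U : List V) (γ : ℝ) {p : ℝ≥0∞}
    (hp : p ≤ (decompose m U γ).prob fun Ds => (I.checkFair (I.flow Ds).val).val = true)
    (t : ℕ) (S : List V) :
    (I.repeatUntilFair U γ t S).prob (fun S => ¬ (I.checkFair S).val = true) ≤ (1 - p) ^ t := by
  induction t generalizing S with
  | zero => simpa using Rand.prob_le_one _ _
  | succ t ih =>
    rw [Problem.repeatUntilFair, Rand.prob_lift_bind]
    refine (Rand.prob_bind_le (r := fun Ds => (I.checkFair (I.flow Ds).val).val = true)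
      (q := (1 - p) ^ t) ?_ ?_).trans ?_
    · intro Ds hDs
      rw [Rand.prob_lift_bind, Rand.prob_lift_bind, if_pos hDs, Rand.prob_eq,
        Rand.resultLaw_pure, PMF.toOuterMeasure_pure_apply, if_neg]
      simpa using hDs
    · intro Ds hDs
      rw [Rand.prob_lift_bind, Rand.prob_lift_bind, if_neg hDs]
      exact ih _
    · rw [pow_succ, mul_comm]
      gcongr
      have h1 := Rand.prob_add_prob_not (decompose m U γ)
        fun Ds => (I.checkFair (I.flow Ds).val).val = true
      refine ENNReal.le_sub_of_add_le_left (ne_top_of_le_ne_top ENNReal.one_ne_top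
        (hp.trans (Rand.prob_le_one _ _))) ?_
      rw [← h1]
      gcongr

theorem Problem.IsFair.image {V : Type} [DecidableEq V] {I : Problem V m} {O : Finset V} (hO : I.IsFair O)
    {f : V → V} (hf : Set.InjOn f O) (hc : ∀ o ∈ O, I.color (f o) = I.color o) :
    I.IsFair (O.image f) := by
  refine ⟨(Finset.card_image_of_injOn hf).trans hO.1, fun i => ?_⟩
  have : ((O.image f).filter fun v => I.color v = i).card =
      (O.filter fun v => I.color v = i).card := by
    rw [Finset.filter_image, Finset.card_image_of_injOn]
    · congr 1
      exact Finset.filter_congr fun o ho => by rw [hc o ho]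
    · exact hf.mono (by
        intro x hx
        exact (Finset.mem_filter.1 hx).1)
  rw [this]
  exact hO.2 i

/-- The main algorithm returns a fair set with high probability. -/
theorem Problem.le_prob_mainAlgorithm [Fintype V] [DecidableEq V] (I : Problem V m) {pts : List V} (hpts : pts.Nodup)
    (hmem : ∀ v, v ∈ pts) (hk : I.k ≤ m) (T : ℕ) {τ : ℝ} (hτ : 0 < τ) {O : Finset V}
    (hO : I.IsFair O) (hdiv : ENNReal.ofReal τ ≤ diversity O) :
    ENNReal.ofReal (1 - 2 ^ (-(Real.exp (-128) * T))) ≤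
      (I.mainAlgorithm pts (τ / 3) (τ / 3) (Fintype.card V) T).prob
        fun S => (I.checkFair S).val = true := by
  -- Without colors there are no points, and the empty list is fair.
  rcases Nat.eq_zero_or_pos m with rfl | hm
  · have hV : IsEmpty V := ⟨fun v => (I.color v).elim0⟩
    rw [Rand.prob_eq_one]
    · rw [← ENNReal.ofReal_one]
      exact ENNReal.ofReal_le_ofReal (by
        have : (0 : ℝ) < 2 ^ (-(Real.exp (-128) * T)) := by positivity
        linarith)
    · intro b _
      have hb : b.val = [] := List.eq_nil_iff_forall_not_mem.2 fun v => isEmptyElim v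
      rw [hb, I.checkFair_eq_true]
      have hk : I.k = 0 := by rw [← hO.1, Finset.eq_empty_of_isEmpty O, Finset.card_empty]
      exact ⟨by simp [hk], fun j => j.elim0⟩
  · set γ := τ / 3 with hγdef
    have hγ : 0 < γ := by positivity
    set U := (I.prune γ (Fintype.card V) pts).val with hU
    have hdist : ∀ o ∈ O, ∀ o' ∈ O, o ≠ o' → τ ≤ dist o o' := by
      intro o ho o' ho' hne
      have := Set.le_einfsep_iff.1 hdiv o ho o' ho' hne
      rw [edist_dist] at this
      exact (ENNReal.ofReal_le_ofReal_iff dist_nonneg).1 this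
    have hex : ∀ o, ∃ u ∈ U, I.color u = I.color o ∧ dist o u < γ := fun o =>
      I.exists_mem_prune hγ hpts.length_le_card (hmem o)
    choose f hfU hfc hfd using hex
    -- The triangle inequality leaves more than τ - 2γ = γ; strictness comes from the strict
    -- covering radius.
    have hsep : ∀ o ∈ O, ∀ o' ∈ O, o ≠ o' → γ < dist (f o) (f o') := by
      intro o ho o' ho' hne
      have h1 := hdist o ho o' ho' hne
      have h2 := dist_triangle4 o (f o) (f o') o'
      have h3 := hfd o
      have h4 := hfd o'
      rw [dist_comm] at h4
      linarith
    have hinj : Set.InjOn f O := by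
      intro o ho o' ho' he
      by_contra hne
      have := hsep o ho o' ho' hne
      rw [he, dist_self] at this
      linarith
    have hp := I.le_prob_decompose hm (I.prune_nodup hγ (Fintype.card V) pts) hγ
      (fun u hu v hv => I.le_dist_of_mem_prune _ pts hu hv) (hO.image hinj fun o _ => hfc o)
      (by
        intro o ho
        obtain ⟨o, -, rfl⟩ := Finset.mem_image.1 ho
        exact hfU o) hk (by
        intro x hx y hy hxy
        obtain ⟨o, ho, rfl⟩ := Finset.mem_image.1 hx
        obtain ⟨o', ho', rfl⟩ := Finset.mem_image.1 hy
        exact hsep o ho o' ho' fun h => hxy (h ▸ rfl))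
    have hfail := I.prob_repeatUntilFair_not U γ hp (T * m) []
    have hmain : ∀ P : List V → Prop, (I.mainAlgorithm pts γ γ (Fintype.card V) T).prob P =
        (I.repeatUntilFair U γ (T * m) []).prob P := fun P => Rand.prob_lift_bind _ _ _
    rw [hmain]
    have hm0 : (0 : ℝ) < m := by exact_mod_cast hm
    set q := Real.exp (-128) / m with hq
    have hq0 : 0 < q := by positivity
    have hq1 : q ≤ 1 := by
      rw [hq, div_le_one hm0]
      have h1 : Real.exp (-128) ≤ 1 := Real.exp_le_one_iff.2 (by norm_num)
      have h2 : (1 : ℝ) ≤ m := by exact_mod_cast hm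
      linarith
    -- With q = c/m, 1 - q ≤ exp(-q) turns `T * m` rounds into exp(-cT), and log 2 ≤ 1 allows the
    -- base 2.
    have hpow : (1 - ENNReal.ofReal q) ^ (T * m) ≤
        ENNReal.ofReal (2 ^ (-(Real.exp (-128) * T))) := by
      rw [← ENNReal.ofReal_one, ← ENNReal.ofReal_sub _ hq0.le,
        ← ENNReal.ofReal_pow (by linarith)]
      refine ENNReal.ofReal_le_ofReal ?_
      calc (1 - q) ^ (T * m) ≤ (Real.exp (-q)) ^ (T * m) := by
            refine pow_le_pow_left₀ (by linarith) ?_ _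
            have := Real.add_one_le_exp (-q)
            linarith
        _ = Real.exp (-(Real.exp (-128) * T)) := by
            rw [← Real.exp_nat_mul]
            congr 1
            rw [hq]
            push_cast
            field_simp
        _ ≤ 2 ^ (-(Real.exp (-128) * T)) := by
            rw [Real.rpow_def_of_pos two_pos]
            refine Real.exp_le_exp.2 ?_
            have h1 : Real.log 2 ≤ 1 := by
              have := Real.log_two_lt_d9
              linarith
            have h2 : 0 ≤ Real.exp (-128) * T := by positivity
            nlinarith
    have hadd := Rand.prob_add_prob_not (I.repeatUntilFair U γ (T * m) [])
      fun S => (I.checkFair S).val = true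
    rw [ENNReal.ofReal_sub _ (by positivity), ENNReal.ofReal_one, ← hadd]
    refine tsub_le_iff_right.2 ?_
    gcongr
    exact hfail.trans hpow

end Main

section Grid

variable {V : Type} [MetricSpace V] {m : ℕ}

/-! ### The list of distances -/

theorem pairDists_length_le (l : List V) : (pairDists l).val.length ≤ l.length ^ 2 := by
  induction l with
  | nil => simp [pairDists]
  | cons u l ih =>
    simp only [pairDists, Timed.val_bind, appendT_val, mapT_val, List.length_append,
      List.length_map, List.length_cons]
    nlinarith

theorem pairDists_steps_le (l : List V) :
    (pairDists l).steps ≤ l.length * (3 * l.length + 3) + 1 := by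
  induction l with
  | nil => simp [pairDists]
  | cons u l ih =>
    simp only [pairDists, Timed.steps_bind, tick_steps, appendT_steps, mapT_val,
      List.length_map, List.length_cons]
    have := mapT_steps_le (fun v => (do tick; return dist u v : Timed ℝ)) l 1 fun _ _ => by simp
    nlinarith

theorem exists_of_mem_pairDists {l : List V} (hl : l.Nodup) {x : ℝ}
    (hx : x ∈ (pairDists l).val) : ∃ u v : V, u ≠ v ∧ x = dist u v := by
  induction l with
  | nil => simp [pairDists] at hx
  | cons u l ih =>
    simp only [pairDists, Timed.val_bind, appendT_val, mapT_val, List.mem_append, List.mem_map,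
      Timed.val_pure] at hx
    rcases hx with ⟨v, hv, rfl⟩ | hx
    · refine ⟨u, v, ?_, rfl⟩
      rintro rfl
      exact (List.nodup_cons.1 hl).1 hv
    · exact ih (List.nodup_cons.1 hl).2 hx

theorem dist_mem_pairDists {l : List V} {u v : V} (hu : u ∈ l) (hv : v ∈ l) (huv : u ≠ v) :
    dist u v ∈ (pairDists l).val := by
  induction l with
  | nil => simp at hu
  | cons w l ih =>
    simp only [pairDists, Timed.val_bind, appendT_val, mapT_val, List.mem_append, List.mem_map,
      Timed.val_pure]
    rcases List.mem_cons.1 hu with rfl | hu'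
    · exact .inl ⟨v, (List.mem_cons.1 hv).resolve_left huv.symm, rfl⟩
    · rcases List.mem_cons.1 hv with rfl | hv'
      · exact .inl ⟨u, hu', dist_comm _ _⟩
      · exact .inr (ih hu' hv')

theorem extremes_steps_le (l : List ℝ) : (extremes l).steps ≤ 2 * l.length + 1 := by
  cases l with
  | nil => simp [extremes]
  | cons x l =>
    simp only [extremes, Timed.steps_bind, tick_steps, minT_steps, maxT_steps, Timed.steps_pure,
      List.length_cons]
    omega

theorem extremes_mem {l : List ℝ} (hl : l ≠ []) :
    (extremes l).val.1 ∈ l ∧ (extremes l).val.2 ∈ l := by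
  cases l with
  | nil => contradiction
  | cons x l => exact ⟨minT_val_mem x l, maxT_val_mem x l⟩

theorem extremes_bounds {l : List ℝ} {x : ℝ} (hx : x ∈ l) :
    (extremes l).val.1 ≤ x ∧ x ≤ (extremes l).val.2 := by
  cases l with
  | nil => simp at hx
  | cons y l => exact ⟨minT_val_le y l x hx, le_maxT_val y l x hx⟩

theorem extremes_pairDists_pos {l : List V} (hl : l.Nodup) :
    0 < (extremes (pairDists l).val).val.1 := by
  by_cases h : (pairDists l).val = []
  · rw [h]
    exact one_pos
  · obtain ⟨u, v, huv, h⟩ := exists_of_mem_pairDists hl (extremes_mem h).1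
    rw [h]
    exact dist_pos.2 huv

theorem extremes_fst_le_snd (l : List ℝ) : (extremes l).val.1 ≤ (extremes l).val.2 := by
  by_cases h : l = []
  · rw [h]
    exact le_rfl
  · exact (extremes_bounds (extremes_mem h).1).2

theorem log_extremes_le [Finite V] {l : List V} (hl : l.Nodup) (hmem : ∀ v, v ∈ l) :
    Real.log ((extremes (pairDists l).val).val.2 / (extremes (pairDists l).val).val.1) ≤
      Real.log (spread V) := by
  by_cases h : (pairDists l).val = []
  -- With at most one point, `extremes` gives the default ratio `1` and the spread is `0`; both
  -- logarithms are `0`.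
  · have hs : Subsingleton V := ⟨fun u v => by
      by_contra huv
      have := dist_mem_pairDists (hmem u) (hmem v) huv
      simp [h] at this⟩
    rw [h, spread, Metric.diam_subsingleton Set.subsingleton_univ]
    simp [extremes]
  · obtain ⟨h1, h2⟩ := extremes_mem h
    obtain ⟨u, v, huv, e1⟩ := exists_of_mem_pairDists hl h1
    obtain ⟨u', v', huv', e2⟩ := exists_of_mem_pairDists hl h2
    have hnt : (Set.univ : Set V).Nontrivial := ⟨u, trivial, v, trivial, huv⟩
    have hpos : 0 < Set.infsep (Set.univ : Set V) :=
      (Set.Finite.infsep_pos_iff_nontrivial Set.finite_univ).2 hnt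
    rw [e1, e2, spread]
    have h3 : 0 < dist u v := dist_pos.2 huv
    have h4 : 0 < dist u' v' := dist_pos.2 huv'
    refine Real.log_le_log (by positivity) ?_
    have h5 : Set.infsep (Set.univ : Set V) ≤ dist u v :=
      Set.infsep_le_dist_of_mem trivial trivial huv
    have h6 : dist u' v' ≤ Metric.diam (Set.univ : Set V) :=
      Metric.dist_le_diam_of_mem (Set.toFinite _).isBounded trivial trivial
    gcongr

/-! ### The grid search -/

/-- `S` is fair and its diversity is as good as guaranteed for the guess `τ`. -/
def Problem.IsGood [DecidableEq V] (I : Problem V m) (τ : ℝ) (S : List V) : Prop :=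
  I.IsFair S.toFinset ∧ ENNReal.ofReal (edgeBound m (τ / 3)) ≤ diversity S.toFinset

theorem Problem.IsGood.mono [DecidableEq V] {I : Problem V m} {τ σ : ℝ} {S : List V} (h : I.IsGood τ S)
    (hσ : σ ≤ τ) : I.IsGood σ S :=
  ⟨h.1, (ENNReal.ofReal_le_ofReal (edgeBound_mono m (by linarith))).trans h.2⟩

theorem Problem.isGood_of_separated [DecidableEq V] {I : Problem V m} {τ : ℝ} {S : List V}
    (h : Separated (edgeBound m (τ / 3)) S) (hf : (I.checkFair S).val = true) : I.IsGood τ S :=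
  ⟨Problem.isFair_toFinset h.nodup hf, h.le_diversity⟩

/-- Guesses increase, so a later success replaces `best` by a set with an even stronger guarantee.
Whatever is good for some `σ ≤ τ` is never lost. -/
theorem Problem.ensures_gridLoop [DecidableEq V] [Fintype V] (I : Problem V m) {pts : List V} (hpts : pts.Nodup) (T : ℕ)
    {ε : ℝ} (hε : 0 < ε) {M : ℕ} (hM : M = Fintype.card V + m + 1) (c : ℕ) {τ : ℝ} (hτ : 0 < τ)
    (best : List V) :
    (I.gridLoop pts (Fintype.card V) T ε c τ best).Ensures
      (fun S => ∀ σ ≤ τ, I.IsGood σ best → I.IsGood σ S)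
      (c * (210 * M ^ 5 * (T + 1)) + 1) := by
  induction c generalizing τ best with
  | zero =>
    have h : (I.gridLoop pts (Fintype.card V) T ε 0 τ best).Ensures
        (fun S => ∀ σ ≤ τ, I.IsGood σ best → I.IsGood σ S) (1 + 0) := by
      rw [Problem.gridLoop]
      exact Rand.Ensures.lift_bind le_rfl (Rand.ensures_pure fun _ _ h => h)
    simpa using h
  | succ c ih =>
    have h : (I.gridLoop pts (Fintype.card V) T ε (c + 1) τ best).Ensures
        (fun S => ∀ σ ≤ τ, I.IsGood σ best → I.IsGood σ S)
        (1 + (200 * M ^ 5 * (T + 1) + (9 * M ^ 2 + (c * (210 * M ^ 5 * (T + 1)) + 1)))) := by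
      rw [Problem.gridLoop]
      refine Rand.Ensures.lift_bind le_rfl ((I.ensures_mainAlgorithm hpts (γ := τ / 3)
        (by positivity) _ T hM).bind fun S hS => Rand.Ensures.lift_bind
          (I.checkFair_steps_le_of_length (by have := hS.length_le; omega)) ?_)
      have hτ' : τ ≤ τ * (1 + ε) := by nlinarith
      refine (ih (τ := τ * (1 + ε)) (by positivity) _).mono ?_ le_rfl
      intro S' hS' σ hσ hbest
      refine hS' σ (hσ.trans hτ') ?_
      split_ifs with hok
      · exact (Problem.isGood_of_separated hS hok).mono hσ
      · exact hbest
    refine h.mono (fun _ h => h) ?_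
    have hM1 : 1 ≤ M := by omega
    have p0 : 1 ≤ M ^ 5 := Nat.one_le_pow _ _ hM1
    have p2 : M ^ 2 ≤ M ^ 5 := Nat.pow_le_pow_right hM1 (by norm_num)
    have e1 : 200 * M ^ 5 * (T + 1) = 200 * (M ^ 5 * T) + 200 * M ^ 5 := by ring
    have e2 : (c + 1) * (210 * M ^ 5 * (T + 1)) =
        c * (210 * M ^ 5 * (T + 1)) + 210 * (M ^ 5 * T) + 210 * M ^ 5 := by ring
    rw [e1, e2]
    omega

/-- Only the randomness of run `i` matters: earlier runs may leave any `best`, and later runs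
preserve what it achieved. Hence no union bound over the guesses is needed. -/
theorem Problem.le_prob_gridLoop [DecidableEq V] [Fintype V] (I : Problem V m) {pts : List V} (hpts : pts.Nodup) (T : ℕ)
    {ε : ℝ} (hε : 0 < ε) {q : ℝ≥0∞} {i c : ℕ} (hi : i < c) {τ : ℝ} (hτ : 0 < τ)
    (hq : q ≤ (I.mainAlgorithm pts (τ * (1 + ε) ^ i / 3) (τ * (1 + ε) ^ i / 3)
      (Fintype.card V) T).prob fun S => (I.checkFair S).val = true) (best : List V) :
    q ≤ (I.gridLoop pts (Fintype.card V) T ε c τ best).prob (I.IsGood (τ * (1 + ε) ^ i)) := by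
  induction c generalizing τ best i with
  | zero => omega
  | succ c ih =>
    rw [Problem.gridLoop, Rand.prob_lift_bind]
    cases i with
    | zero =>
      simp only [pow_zero, mul_one] at hq ⊢
      have hsep := I.ensures_mainAlgorithm hpts (γ := τ / 3) (by positivity) (Fintype.card V) T rfl
      refine (hq.trans (Rand.prob_mono (q := fun S => (I.checkFair S).val = true ∧
        Separated (edgeBound m (τ / 3)) S) fun b hb h => ⟨h, (hsep b hb).1⟩)).trans
        (Rand.prob_le_prob_bind ?_)
      rintro S ⟨hok, hS⟩
      rw [Rand.prob_lift_bind, if_pos hok]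
      have hτ' : τ ≤ τ * (1 + ε) := by nlinarith
      exact Rand.prob_eq_one fun b hb => (I.ensures_gridLoop hpts T hε rfl c
        (τ := τ * (1 + ε)) (by positivity) S b hb).1 τ hτ' (Problem.isGood_of_separated hS hok)
    | succ i =>
      refine Rand.le_prob_bind fun b hb => ?_
      rw [Rand.prob_lift_bind]
      have e : τ * (1 + ε) ^ (i + 1) = τ * (1 + ε) * (1 + ε) ^ i := by ring
      rw [e] at hq ⊢
      exact ih (by omega) (by positivity) hq _

/-- The number of guesses after the first one. -/
noncomputable def guesses (pts : List V) (ε : ℝ) : ℕ :=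
  ⌊Real.log ((extremes (pairDists pts).val).val.2 / (extremes (pairDists pts).val).val.1) /
    Real.log (1 + ε)⌋₊

theorem guesses_le [Fintype V] {pts : List V} (hpts : pts.Nodup) (hmem : ∀ v, v ∈ pts) {ε : ℝ} (hε : 0 < ε) :
    (guesses pts ε : ℝ) ≤ (1 + 1 / ε) * Real.log (spread V) := by
  have hpos := extremes_pairDists_pos hpts
  have h0 : 0 ≤ Real.log ((extremes (pairDists pts).val).val.2 /
      (extremes (pairDists pts).val).val.1) :=
    Real.log_nonneg ((one_le_div hpos).2 (extremes_fst_le_snd _))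
  have hlog : 0 < Real.log (1 + ε) := Real.log_pos (by linarith)
  refine (Nat.floor_le (by positivity)).trans ?_
  have h1 := log_extremes_le hpts hmem
  -- From log x ≥ 1 - 1/x at x = 1 + ε.
  have h2 : (Real.log (1 + ε))⁻¹ ≤ 1 + 1 / ε := by
    rw [inv_le_comm₀ hlog (by positivity)]
    have h3 := Real.one_sub_inv_le_log_of_pos (x := 1 + ε) (by positivity)
    have h4 : (1 + 1 / ε)⁻¹ = 1 - (1 + ε)⁻¹ := by
      field_simp
      ring
    rw [h4]
    exact h3
  rw [div_eq_inv_mul]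
  gcongr

theorem Problem.ensures_gridSearch [DecidableEq V] [Fintype V] (I : Problem V m) {pts : List V} (hpts : pts.Nodup)
    (hmem : ∀ v, v ∈ pts) (T : ℕ) {ε : ℝ} (hε : 0 < ε) {M : ℕ}
    (hM : M = Fintype.card V + m + 1) :
    (I.gridSearch pts T ε).Ensures (fun _ => True)
      (240 * M ^ 5 * (T + 1) * (guesses pts ε + 1)) := by
  have hn : pts.length = Fintype.card V :=
    le_antisymm hpts.length_le_card (by
      rw [← List.toFinset_card_of_nodup hpts, ← Finset.card_univ]
      exact Finset.card_le_card fun v _ => by simpa using hmem v)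
  have hM1 : 1 ≤ M := by omega
  have hloop := (I.ensures_gridLoop hpts T hε hM (guesses pts ε + 1)
    (extremes_pairDists_pos hpts) []).mono (Q := fun _ => True) (fun _ _ => trivial) le_rfl
  have h : (I.gridSearch pts T ε).Ensures (fun _ => True)
      (M + ((M * (3 * M + 3) + 1) + ((2 * M ^ 2 + 1) + ((guesses pts ε + 1) +
        ((guesses pts ε + 1) * (210 * M ^ 5 * (T + 1)) + 1))))) := by
    rw [Problem.gridSearch]
    refine Rand.Ensures.lift_bind (by rw [lengthT_steps]; omega) (Rand.Ensures.lift_bind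
      ((pairDists_steps_le pts).trans (by gcongr <;> omega)) (Rand.Ensures.lift_bind
      ((extremes_steps_le _).trans ?_) (Rand.Ensures.lift_bind le_rfl ?_)))
    · have h1 := pairDists_length_le pts
      have h2 : pts.length ^ 2 ≤ M ^ 2 := Nat.pow_le_pow_left (by omega) 2
      omega
    · rw [lengthT_val, hn]
      exact hloop
  refine h.mono (fun _ h => h) ?_
  have p0 : 1 ≤ M ^ 5 := Nat.one_le_pow _ _ hM1
  have p1 : M ≤ M ^ 5 := Nat.le_self_pow (by norm_num) M
  have p2 : M ^ 2 ≤ M ^ 5 := Nat.pow_le_pow_right hM1 (by norm_num)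
  set N := guesses pts ε + 1 with hN
  have hN1 : 1 ≤ N := Nat.succ_pos _
  set X := M ^ 5 * (T + 1) * N with hX
  have q1 : M ^ 5 ≤ X := by
    rw [hX, mul_assoc]
    exact Nat.le_mul_of_pos_right _ (by positivity)
  have q2 : N ≤ X := Nat.le_mul_of_pos_left _ (by positivity)
  have e1 : 240 * M ^ 5 * (T + 1) * N = 240 * X := by rw [hX]; ring
  have e2 : N * (210 * M ^ 5 * (T + 1)) = 210 * X := by rw [hX]; ring
  have e3 : M * (3 * M + 3) = 3 * M ^ 2 + 3 * M := by ring
  rw [e1, e2, e3]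
  omega

theorem Problem.prob_gridSearch [DecidableEq V] [Fintype V] (I : Problem V m) {pts : List V} (hpts : pts.Nodup)
    (hmem : ∀ v, v ∈ pts) (T : ℕ) (ε : ℝ) (p : List V → Prop) :
    (I.gridSearch pts T ε).prob p = (I.gridLoop pts (Fintype.card V) T ε (guesses pts ε + 1)
      (extremes (pairDists pts).val).val.1 []).prob p := by
  have hn : pts.length = Fintype.card V :=
    le_antisymm hpts.length_le_card (by
      rw [← List.toFinset_card_of_nodup hpts, ← Finset.card_univ]
      exact Finset.card_le_card fun v _ => by simpa using hmem v)
  rw [Problem.gridSearch, Rand.prob_lift_bind, Rand.prob_lift_bind, Rand.prob_lift_bind,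
    Rand.prob_lift_bind, lengthT_val, hn]
  rfl

theorem Problem.exists_opt_eq [Fintype V] (I : Problem V m) (h : ∃ O : Finset V, I.IsFair O) :
    ∃ O : Finset V, I.IsFair O ∧ I.opt = diversity O := by
  classical
  obtain ⟨O, hO⟩ := h
  obtain ⟨O', hO', hmax⟩ := (Finset.univ.filter fun S : Finset V => I.IsFair S).exists_max_image
    diversity ⟨O, by simpa using hO⟩
  have hO'' : I.IsFair O' := by simpa using hO'
  refine ⟨O', hO'', le_antisymm ?_ ?_⟩
  · exact iSup₂_le fun S hS => hmax S (by simpa using hS)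
  · exact le_iSup₂_of_le O' hO'' le_rfl

/-- The grid search returns a good approximation with high probability. -/
theorem Problem.le_prob_gridSearch [DecidableEq V] [Fintype V] (I : Problem V m) {pts : List V} (hpts : pts.Nodup)
    (hmem : ∀ v, v ∈ pts) (hk : I.k ≤ m) (T : ℕ) {ε : ℝ} (hε : 0 < ε)
    (h : ∃ O : Finset V, I.IsFair O) :
    ENNReal.ofReal (1 - 2 ^ (-(Real.exp (-128) * T))) ≤
      (I.gridSearch pts T ε).prob fun S => I.IsFair S.toFinset ∧
        ENNReal.ofReal (√(Real.log m) / (3 * m * (1 + ε))) * I.opt ≤ diversity S.toFinset := by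
  obtain ⟨O, hO, hopt⟩ := I.exists_opt_eq h
  rw [I.prob_gridSearch hpts hmem, hopt]
  set e := (extremes (pairDists pts).val).val with he
  have hpos : 0 < e.1 := extremes_pairDists_pos hpts
  -- With at most one point in `O` the diversity is `⊤`. The first guess already works, and the
  -- returned set has as many points as `O`, so its diversity is `⊤` too.
  by_cases hs : (O : Set V).Subsingleton
  · refine (I.le_prob_gridLoop hpts T hε (i := 0) (Nat.succ_pos _) hpos ?_ []).trans
      (Rand.prob_mono fun b _ hb => ⟨hb.1, ?_⟩)
    · refine I.le_prob_mainAlgorithm hpts hmem hk T (by positivity) hO ?_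
      rw [diversity, hs.einfsep]
      exact le_top
    · have hcard : b.val.toFinset.card ≤ 1 := by
        rw [hb.1.1, ← hO.1]
        exact Finset.card_le_one.2 fun x hx y hy => hs hx hy
      have : ((b.val.toFinset : Finset V) : Set V).Subsingleton :=
        fun x hx y hy => Finset.card_le_one.1 hcard x hx y hy
      rw [diversity, diversity, this.einfsep]
      exact le_top
  · obtain ⟨u, hu, v, hv, huv, hd⟩ := (Set.not_subsingleton_iff.1 hs).einfsep_exists_of_finite
    rw [edist_dist] at hd
    obtain ⟨h1, h2⟩ := extremes_bounds (dist_mem_pairDists (hmem u) (hmem v) huv)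
    rw [← he] at h1 h2
    -- The optimum is a distance, hence between the extremes of the grid. `i` indexes the last power
    -- of `1 + ε` not above its ratio to the smallest distance.
    obtain ⟨i, hi1, hi2⟩ := exists_nat_pow_near ((one_le_div hpos).2 h1)
      (by linarith : 1 < 1 + ε)
    rw [le_div_iff₀ hpos] at hi1
    rw [div_lt_iff₀ hpos] at hi2
    have hiN : i < guesses pts ε + 1 := by
      refine Nat.lt_succ_of_le (Nat.le_floor ?_)
      rw [le_div_iff₀ (Real.log_pos (by linarith)), ← Real.log_pow]
      refine Real.log_le_log (by positivity) ?_
      rw [← he, le_div_iff₀ hpos]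
      exact hi1.trans h2
    refine (I.le_prob_gridLoop hpts T hε hiN hpos ?_ []).trans
      (Rand.prob_mono fun b _ hb => ⟨hb.1, le_trans ?_ hb.2⟩)
    · refine I.le_prob_mainAlgorithm hpts hmem hk T (by positivity) hO ?_
      rw [diversity, hd]
      exact ENNReal.ofReal_le_ofReal (by linarith)
    · rw [diversity, hd, ← ENNReal.ofReal_mul (by positivity)]
      refine ENNReal.ofReal_le_ofReal ?_
      have e1 : √(Real.log m) / (3 * m * (1 + ε)) * dist u v =
          √(Real.log m) / m / 3 * (dist u v / (1 + ε)) := by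
        rcases Nat.eq_zero_or_pos m with rfl | hm
        · simp
        · field_simp
      have e2 : edgeBound m (e.1 * (1 + ε) ^ i / 3) =
          √(Real.log m) / m / 3 * (e.1 * (1 + ε) ^ i) := by
        rw [edgeBound]
        ring
      rw [e1, e2]
      gcongr
      rw [div_le_iff₀ (by positivity)]
      calc dist u v ≤ (1 + ε) ^ (i + 1) * e.1 := hi2.le
        _ = e.1 * (1 + ε) ^ i * (1 + ε) := by ring

end Grid

end FairDiversity

/-! ### The theorem -/

theorem theorem1 :
    ∃ c : ℝ, 0 < c ∧ ∃ C q : ℕ,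
      ∀ (V : Type) [MetricSpace V] [Fintype V] [DecidableEq V] (m : ℕ)
        (I : FairDiversity.Problem V m) (pts : List V),
        pts.Nodup → (∀ v : V, v ∈ pts) → I.k ≤ m → ∀ T : ℕ,
          -- the main algorithm with a guess `τ` of the optimum
          (∀ τ : ℝ, 0 < τ →
            (I.mainAlgorithm pts (τ / 3) (τ / 3) (Fintype.card V) T).StepsLE
                (C * (Fintype.card V + m + 1) ^ q * (T + 1)) ∧
            ((∃ O : Finset V, I.IsFair O ∧ ENNReal.ofReal τ ≤ FairDiversity.diversity O) →
              ENNReal.ofReal (1 - 2 ^ (-(c * T))) ≤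
                (I.mainAlgorithm pts (τ / 3) (τ / 3) (Fintype.card V) T).prob fun S =>
                  I.IsFair S.toFinset ∧
                  ENNReal.ofReal (√(Real.log m) / (3 * m) * τ) ≤
                    FairDiversity.diversity S.toFinset)) ∧
          -- the main algorithm with the grid search
          (∀ ε : ℝ, 0 < ε →
            (I.gridSearch pts T ε).StepsLE
                (C * (Fintype.card V + m + 1) ^ q * (T + 1) *
                  (1 + (1 + 1 / ε) * Real.log (FairDiversity.spread V))) ∧
            ((∃ O : Finset V, I.IsFair O) →
              ENNReal.ofReal (1 - 2 ^ (-(c * T))) ≤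
                (I.gridSearch pts T ε).prob fun S =>
                  I.IsFair S.toFinset ∧
                  ENNReal.ofReal (√(Real.log m) / (3 * m * (1 + ε))) * I.opt ≤
                    FairDiversity.diversity S.toFinset)) := by
  -- The constant `240` and the degree `5` come from the step count of the grid search and also
  -- cover the main algorithm.
  refine ⟨Real.exp (-128), Real.exp_pos _, 240, 5, ?_⟩
  intro V _ _ _ m I pts hpts hmem hk T
  refine ⟨fun τ hτ => ⟨?_, ?_⟩, fun ε hε => ⟨?_, fun h => ?_⟩⟩
  · refine (I.ensures_mainAlgorithm hpts (by positivity) _ T rfl).stepsLE ?_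
    push_cast
    gcongr
    norm_num
  · rintro ⟨O, hO, hdiv⟩
    refine (I.le_prob_mainAlgorithm hpts hmem hk T hτ hO hdiv).trans
      (FairDiversity.Rand.prob_mono fun b hb hok => ?_)
    -- Separation holds for every draw, so a fair result automatically has the claimed diversity.
    have hsep := (I.ensures_mainAlgorithm hpts (γ := τ / 3) (by positivity) _ T rfl b hb).1
    obtain ⟨h1, h2⟩ := FairDiversity.Problem.isGood_of_separated hsep hok
    refine ⟨h1, le_of_eq_of_le ?_ h2⟩
    rw [FairDiversity.edgeBound]
    congr 1
    ring
  · refine (I.ensures_gridSearch hpts hmem T hε rfl).stepsLE ?_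
    push_cast
    rw [add_comm (1 : ℝ)]
    gcongr
    exact FairDiversity.guesses_le hpts hmem hε
  · exact I.le_prob_gridSearch hpts hmem hk T hε h
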